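/- Let $p$ be an odd prime. A Dehn $p$-coloring of a knot diagram $D$ is a map $C$ from the set of regions of $D$ to $\mathbb{Z}/p\mathbb{Z}$ such that at every crossing, with regions $x_1,x_2,x_3,x_4$ around it, where $x_2$ is adjacent to $x_1$ across an under-arc, $x_3$ is adjacent to $x_1$ across the over-arc and $x_4$ is opposite to $x_1$, one has $C(x_1)+C(x_3)=C(x_2)+C(x_4)$. The crossing is trivially colored if $C(x_1)=C(x_4)$ and $C(x_2)=C(x_3)$, and $C$ is nontrivial if some crossing is not trivially colored. A knot $K$ is Dehn $p$-colorable if some diagram of $K$ has a nontrivial Dehn $p$-coloring; in that case $\mathrm{mincol}_p(K)$ denotes the minimum of $\#\,\mathrm{Im}\,C$ over all diagrams $D$ of $K$ and all nontrivial Dehn $p$-colorings $C$ of $D$. **Proposition 5.3.** Let $p$ be an odd prime number with $5<p<2^5$ and $p\neq 17$. Then there exists a Dehn $p$-colorable knot $K$ with $$\mathrm{mincol}_p(K)\ \ge\ \lfloor \log_2 p\rfloor+3 .$$ In particular, when $p\in\{7,11,13,19,29\}$, there exists a Dehn $p$-colorable knot $K$ with $$\mathrm{mincol}_p(K)=\lfloor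 \log_2 p\rfloor+3$$ (for $p=7$ the knot $5_2$ has this property), and when $p\in\{23,31\}$, there exists a Dehn $p$-colorable knot $K$ with $$\mathrm{mincol}_p(K)=\lfloor \log_2 p\rfloor+3\quad\text{or}\quad \mathrm{mincol}_p(K)=\lfloor \log_2 p\rfloor+4 .$$ -/

import Mathlib

/-!
Knots and knot diagrams, combinatorially.

A diagram of a knot on the oriented sphere (equivalently, in the plane: the regions are the same)
is a connected 4-valent plane graph with over/under information.  It is recorded as a combinatorial
map: a finite set of darts (half-edges), the permutation `rot` that turns counterclockwise around
each crossing, and the involution `edge` that exchanges the two halves of each semiarc.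
-/

/-- A knot diagram.  The darts around one crossing form an orbit `a, rot a, rot² a, rot³ a`, listed
counterclockwise; `a` and `rot² a` lie on the same strand, and `isOver a` says whether this is the
over-strand.  The diagram without darts is the crossingless circle. -/
structure KnotDiagram where
  /-- The half-edges. -/
  Dart : Type
  finite_dart : Finite Dart
  /-- The next dart, counterclockwise, at the same crossing. -/
  rot : Equiv.Perm Dart
  /-- The other half of the same semiarc. -/
  edge : Equiv.Perm Dart
  /-- Whether the dart belongs to the over-strand of its crossing. -/
  isOver : Dart → Bool
  rot_four : ∀ a, rot (rot (rot (rot a))) = a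
  rot_two_ne : ∀ a, rot (rot a) ≠ a
  edge_edge : ∀ a, edge (edge a) = a
  edge_ne : ∀ a, edge a ≠ a
  isOver_rot : ∀ a, isOver (rot a) = !isOver a
  /-- There is only one component: travelling along the curve, straight through every crossing,
  each semiarc is met, in one of its two directions. -/
  one_component : ∀ a b, (rot * rot * edge).SameCycle a b ∨ (rot * rot * edge).SameCycle a (edge b)
  /-- The surface is a sphere: Euler's formula, vertices (crossings) + faces = edges (semiarcs) + 2,
  where the faces are the orbits of `a ↦ rot⁻¹ (edge a)`. -/
  planar : Nonempty Dart →
    Nat.card (Quotient (Equiv.Perm.SameCycle.setoid rot)) +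
      Nat.card (Quotient (Equiv.Perm.SameCycle.setoid (rot⁻¹ * edge))) =
    Nat.card (Quotient (Equiv.Perm.SameCycle.setoid edge)) + 2

namespace KnotDiagram

variable (D : KnotDiagram)

/-- The opposite dart at the same crossing: the continuation of the strand. -/
def opp (a : D.Dart) : D.Dart := D.rot (D.rot a)

/-- The face permutation.  A dart `a` stands for the corner between `a` and `rot a`, which lies on
the left when one leaves the crossing along `a`; the next corner of the same region, reached by
walking along the semiarc of `a`, is the one between `rot⁻¹ (edge a)` and `edge a`. -/
def face : Equiv.Perm D.Dart := D.rot⁻¹ * D.edge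

/-- The set of darts at the crossing of `a`. -/
def crossing (a : D.Dart) : Set D.Dart := {x | D.rot.SameCycle a x}

/-- The regions of the diagram: the orbits of the face permutation; the crossingless circle has two
regions. -/
def Region : Type :=
  Quotient (Equiv.Perm.SameCycle.setoid D.face) ⊕ {_b : Bool // IsEmpty D.Dart}

/-- The region in which the corner between `a` and `rot a` lies. -/
def corner (a : D.Dart) : D.Region :=
  Sum.inl (Quotient.mk (Equiv.Perm.SameCycle.setoid D.face) a)

/-! ### Reidemeister moves -/

/-- Isomorphism of diagrams (orientation-preserving isotopy on the sphere). -/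
def Iso (D D' : KnotDiagram) : Prop :=
  ∃ f : D.Dart ≃ D'.Dart,
    (∀ x, f (D.rot x) = D'.rot (f x)) ∧ (∀ x, D'.isOver (f x) = D.isOver x) ∧
    (∀ x, f (D.edge x) = D'.edge (f x))

/-- `D'` arises from `D` by erasing the crossings whose darts form the set `S`: the other crossings
stay as they are, and a semiarc of `D'` leads to the first dart outside `S` that is reached by
following the strand of `D`, straight through the crossings in `S`. -/
def Erases (D D' : KnotDiagram) (S : Set D.Dart) : Prop :=
  ∃ f : D'.Dart → D.Dart, Function.Injective f ∧ Set.range f = Sᶜ ∧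
    (∀ x, f (D'.rot x) = D.rot (f x)) ∧ (∀ x, D'.isOver x = D.isOver (f x)) ∧
    (∀ x, ∃ k : ℕ, f (D'.edge x) = (fun y => D.edge (D.opp y))^[k] (D.edge (f x)) ∧
      ∀ j < k, (fun y => D.edge (D.opp y))^[j] (D.edge (f x)) ∈ S)

/-- First Reidemeister move: a crossing with a one-sided region at it is removed. -/
def R1 (D D' : KnotDiagram) : Prop :=
  ∃ a : D.Dart, D.face a = a ∧ Erases D D' (D.crossing a)

/-- Second Reidemeister move: two crossings are the corners of a two-sided region, one of whose two
sides is the over-strand at both crossings, and both crossings are removed.  (The semiarc of `a`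
joins the darts `a` and `edge a = rot b`.) -/
def R2 (D D' : KnotDiagram) : Prop :=
  ∃ a b : D.Dart, D.face a = b ∧ D.face b = a ∧ b ∉ D.crossing a ∧
    D.isOver a = D.isOver (D.edge a) ∧ Erases D D' (D.crossing a ∪ D.crossing b)

/-- Third Reidemeister move, at a three-sided region with corners `a 0`, `a 1`, `a 2` at distinct
crossings.  One of the three strands is over, another one under the other two: the three crossings
are not arranged cyclically.  The crossings are carried over by `f`.  Along each of the three
strands, the two crossings are interchanged: where the strand passed through
`opp u, u, edge u, opp (edge u)` in this order, it now passes through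
`edge u, opp (edge u), opp u, u`. -/
def R3 (D D' : KnotDiagram) : Prop :=
  ∃ a : ZMod 3 → D.Dart,
    (∀ i, D.face (a i) = a (i + 1)) ∧ (∀ i, a (i + 1) ∉ D.crossing (a i)) ∧
    (¬ ∀ i j, D.isOver (a i) = D.isOver (a j)) ∧
    ∃ f g : D.Dart ≃ D'.Dart,
      (∀ x, f (D.rot x) = D'.rot (f x)) ∧ (∀ x, D'.isOver (f x) = D.isOver x) ∧
      (∀ x, g (D.edge x) = D'.edge (g x)) ∧
      (∀ x, (∀ i, x ∉ D.crossing (a i)) → g x = f x) ∧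
      (∀ i, ∀ u, u = a i ∨ u = D.edge (a i) →
        g u = f (D.opp (D.edge u)) ∧ g (D.opp u) = f (D.edge u))

/-- One Reidemeister move (or an isomorphism). -/
def Move (D D' : KnotDiagram) : Prop := Iso D D' ∨ R1 D D' ∨ R2 D D' ∨ R3 D D'

/-- Two diagrams represent the same (unoriented) knot if they are connected by a finite sequence of
Reidemeister moves and their inverses. -/
def equivalence : Setoid KnotDiagram := Relation.EqvGen.setoid Move

/-! ### Dehn colorings -/

variable {D} {p : ℕ}

/-- A Dehn `p`-coloring.  For a dart `a` of the under-strand, let `x₁` be the region between `a` and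
`rot a`.  Then `x₂`, between `rot³ a` and `a`, is adjacent to `x₁` by the under-arc `a`, and `x₃`,
between `rot a` and `rot² a`, is adjacent to `x₁` by the over-arc; `x₄` is the region opposite to
`x₁`.  The condition is `C x₁ + C x₃ = C x₂ + C x₄`. -/
def IsDehnColoring (C : D.Region → ZMod p) : Prop :=
  ∀ a, D.isOver a = false →
    C (D.corner a) + C (D.corner (D.rot a)) =
      C (D.corner (D.rot (D.rot (D.rot a)))) + C (D.corner (D.rot (D.rot a)))

/-- The crossing of the under-dart `a` is trivially colored: `C x₁ = C x₄` and `C x₃ = C x₂`. -/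
def TriviallyColoredAt (C : D.Region → ZMod p) (a : D.Dart) : Prop :=
  C (D.corner a) = C (D.corner (D.rot (D.rot a))) ∧
    C (D.corner (D.rot a)) = C (D.corner (D.rot (D.rot (D.rot a))))

/-- A nontrivial Dehn `p`-coloring: some crossing is not trivially colored. -/
def IsNontrivialDehnColoring (C : D.Region → ZMod p) : Prop :=
  IsDehnColoring C ∧ ∃ a, D.isOver a = false ∧ ¬ TriviallyColoredAt C a

end KnotDiagram

/-- Knots, up to equivalence. -/
def Knot : Type 1 := Quotient KnotDiagram.equivalence

/-- The knot represented by a diagram. -/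
def KnotDiagram.knot (D : KnotDiagram) : Knot := Quotient.mk KnotDiagram.equivalence D

namespace Knot

/-- A knot is Dehn `p`-colorable if it has a diagram with a nontrivial Dehn `p`-coloring. -/
def DehnColorable (p : ℕ) (K : Knot) : Prop :=
  ∃ D : KnotDiagram, D.knot = K ∧
    ∃ C : D.Region → ZMod p, KnotDiagram.IsNontrivialDehnColoring C

/-- The minimum number of colors: the minimum, over all diagrams of `K` and all their nontrivial
Dehn `p`-colorings, of the number of colors used. -/
noncomputable def mincol (p : ℕ) (K : Knot) : ℕ :=
  sInf {m | ∃ D : KnotDiagram, D.knot = K ∧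
    ∃ C : D.Region → ZMod p, KnotDiagram.IsNontrivialDehnColoring C ∧ (Set.range C).ncard = m}

end Knot

/-! ### The knot `5₂` -/

namespace FiveTwo

/-- The darts `4 c, 4 c + 1, 4 c + 2, 4 c + 3` belong to the crossing number `c`. -/
def rot : Equiv.Perm (Fin 20) where
  toFun := ![1, 2, 3, 0, 5, 6, 7, 4, 9, 10, 11, 8, 13, 14, 15, 12, 17, 18, 19, 16]
  invFun := ![3, 0, 1, 2, 7, 4, 5, 6, 11, 8, 9, 10, 15, 12, 13, 14, 19, 16, 17, 18]
  left_inv := by decide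
  right_inv := by decide

/-- Two darts form a semiarc if they carry the same label in the planar diagram code
`X[1,4,2,5], X[3,8,4,9], X[5,10,6,1], X[9,6,10,7], X[7,2,8,3]` of the knot `5₂`. -/
def edge : Equiv.Perm (Fin 20) where
  toFun := ![11, 6, 17, 8, 19, 18, 1, 12, 3, 14, 13, 0, 7, 10, 9, 16, 15, 2, 5, 4]
  invFun := ![11, 6, 17, 8, 19, 18, 1, 12, 3, 14, 13, 0, 7, 10, 9, 16, 15, 2, 5, 4]
  left_inv := by decide
  right_inv := by decide

/-- Counting orbits by a function that separates them. -/
theorem card_orbits {A : Type} (σ : Equiv.Perm A) (n : ℕ) (h : A → Fin n)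
    (hs : Function.Surjective h) (h1 : ∀ a, h (σ a) = h a)
    (h2 : ∀ a b, h a = h b → σ.SameCycle a b) :
    Nat.card (Quotient (Equiv.Perm.SameCycle.setoid σ)) = n := by
  have hp : ∀ k : ℕ, ∀ a, h ((σ ^ k) a) = h a := by
    intro k
    induction k with
    | zero => simp
    | succ k ih => intro a; rw [pow_succ', Equiv.Perm.mul_apply, h1, ih]
  have hz : ∀ a b, σ.SameCycle a b → h a = h b := by
    rintro a b ⟨i, rfl⟩
    obtain ⟨k, rfl | rfl⟩ := i.eq_nat_or_neg
    · simp [hp]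
    · have := hp k ((σ ^ (-(k : ℤ))) a)
      rw [← this, ← zpow_natCast, ← Equiv.Perm.mul_apply, ← zpow_add]
      simp
  let g : Quotient (Equiv.Perm.SameCycle.setoid σ) → Fin n := Quotient.lift h hz
  have hg : Function.Bijective g := by
    constructor
    · rintro ⟨a⟩ ⟨b⟩ hab
      exact Quotient.sound (h2 a b hab)
    · intro i
      obtain ⟨a, rfl⟩ := hs i
      exact ⟨Quotient.mk _ a, rfl⟩
  rw [Nat.card_eq_of_bijective g hg, Nat.card_fin]

theorem sameCycle_of_lt {A : Type} (σ : Equiv.Perm A) (n : ℕ) {a b : A}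
    (h : ∃ k < n, (σ ^ k) a = b) : σ.SameCycle a b := by
  obtain ⟨k, -, hk⟩ := h
  exact ⟨k, by simpa using hk⟩

theorem card_rot : Nat.card (Quotient (Equiv.Perm.SameCycle.setoid rot)) = 5 :=
  card_orbits rot 5 ![0, 0, 0, 0, 1, 1, 1, 1, 2, 2, 2, 2, 3, 3, 3, 3, 4, 4, 4, 4]
    (by decide) (by decide) (fun a b h => sameCycle_of_lt rot 4 (by revert a b; decide +kernel))

theorem card_face : Nat.card (Quotient (Equiv.Perm.SameCycle.setoid (rot⁻¹ * edge))) = 7 :=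
  card_orbits _ 7 ![0, 1, 2, 3, 4, 1, 0, 5, 2, 6, 0, 3, 0, 6, 2, 5, 2, 1, 4, 5]
    (by decide) (by decide +kernel)
    (fun a b h => sameCycle_of_lt _ 5 (by revert a b; decide +kernel))

theorem card_edge : Nat.card (Quotient (Equiv.Perm.SameCycle.setoid edge)) = 10 :=
  card_orbits edge 10 ![0, 1, 2, 3, 4, 5, 1, 6, 3, 7, 8, 0, 6, 8, 7, 9, 9, 2, 5, 4]
    (by decide) (by decide +kernel)
    (fun a b h => sameCycle_of_lt edge 2 (by revert a b; decide +kernel))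

theorem one_component (a b : Fin 20) :
    (rot * rot * edge).SameCycle a b ∨ (rot * rot * edge).SameCycle a (edge b) := by
  have h : ∀ a b : Fin 20, (∃ k < 10, ((rot * rot * edge) ^ k) a = b) ∨
      ∃ k < 10, ((rot * rot * edge) ^ k) a = edge b := by decide +kernel
  exact (h a b).imp (sameCycle_of_lt _ 10) (sameCycle_of_lt _ 10)

/-- The standard five-crossing diagram of the knot `5₂`. -/
def diagram : KnotDiagram where
  Dart := Fin 20
  finite_dart := inferInstance
  rot := rot
  edge := edge
  isOver := fun a => decide (a.val % 2 = 1)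
  rot_four := by decide
  rot_two_ne := by decide
  edge_edge := by decide
  edge_ne := by decide
  isOver_rot := by decide
  one_component := one_component
  planar := fun _ => by rw [card_rot, card_face, card_edge]

end FiveTwo

/-- The knot `5₂` of the standard knot tables. -/
def Knot.fiveTwo : Knot := FiveTwo.diagram.knot

/-!
Lower bounds for numbers of Dehn colors come from a linking pairing.

Let `C` and `y` be Dehn `p`-colorings of a diagram, and `X` an integer lift of `C`.  At each
crossing `X x₁ + X x₃ - X x₂ - X x₄` is a multiple of `p`; the sum over the crossings of the
quotients, multiplied by `y x₁ - y x₄`, is an element `pairing C y` of `ZMod p`.  It does not depend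
on the lift (`liftPairing_congr`), it vanishes on trivial colorings, and it is invariant under
Reidemeister moves (`Move.corresponds`): up to a constant factor it is the linking pairing of the
double branched cover.

If the palette `range C` is small, then `pairing C C` vanishes.  Up to an affine change of colors,
either no two sums of two colors differ by `p`, so that the crossing relations hold over the integers
and all quotients are zero (`totallyIsotropic_of_noWrap`), or the palette is one of finitely many
exceptions, for which the terms of the sum form a coboundary: each of them is a sum, over the four
semiarcs at the crossing, of an antisymmetric function of the colors on the two sides of the semiarc
(`HasPotential.isotropic`).  That the list of palettes is complete is a finite check
(`CoversPalettes.exists_affine`).  So a knot on which the pairing is anisotropic needs many colors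
(`lt_mincol_of_self`).

The knots are given by diagrams whose colorings form, up to trivial ones, a space of dimension one on
which the pairing does not vanish; `5₂` is the one for `p = 7`.  A coloring with few colors is then
written down.  For `p = 29` the self-pairing of the given coloring with seven colors is zero, so a
different argument serves: the exceptional palettes of six colors have a potential that is linear in
the second coloring, hence they force `C` into the radical of the pairing
(`HasLinearPotential.totallyIsotropic`), and the knot has a space of colorings of dimension two, with
a nondegenerate pairing (`lt_mincol_of_radical`, `lt_mincol_of_gram`).
-/

namespace KnotDiagram

/-! ### Colorings of corners -/

section Basic

variable {D : KnotDiagram}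

noncomputable instance (D : KnotDiagram) : Fintype D.Dart := @Fintype.ofFinite _ D.finite_dart

@[simp] theorem rot_rot_rot_rot (a : D.Dart) : D.rot (D.rot (D.rot (D.rot a))) = a := D.rot_four a

@[simp] theorem edge_edge_apply (a : D.Dart) : D.edge (D.edge a) = a := D.edge_edge a

theorem isOver_rot_apply (a : D.Dart) : D.isOver (D.rot a) = !D.isOver a := D.isOver_rot a

theorem rot_inv_apply (a : D.Dart) : D.rot⁻¹ a = D.rot (D.rot (D.rot a)) := by
  rw [Equiv.Perm.inv_eq_iff_eq]; simp

theorem face_apply (a : D.Dart) : D.face a = D.rot (D.rot (D.rot (D.edge a))) := by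
  rw [face, Equiv.Perm.mul_apply, rot_inv_apply]

@[simp] theorem rot_face (a : D.Dart) : D.rot (D.face a) = D.edge a := by simp [face_apply]

/-- A function on the corners that is constant on each region. -/
def FaceInvariant {A : Type*} (X : D.Dart → A) : Prop := ∀ a, X (D.face a) = X a

theorem FaceInvariant.edge {A : Type*} {X : D.Dart → A} (hX : FaceInvariant X) (a : D.Dart) :
    X (D.edge a) = X (D.rot (D.rot (D.rot a))) := by
  rw [← hX (D.edge a), face_apply, edge_edge_apply]

theorem FaceInvariant.rot_edge {A : Type*} {X : D.Dart → A} (hX : FaceInvariant X) (a : D.Dart) :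
    X (D.rot (D.rot (D.rot (D.edge a)))) = X a := by
  rw [← hX a, face_apply]

/-- The alternating sum `x₁ + x₃ - x₂ - x₄` of the values at the corners of the crossing of `a`;
a Dehn coloring is a function for which it vanishes at each under-dart. -/
def cross {A : Type*} [AddCommGroup A] (X : D.Dart → A) (a : D.Dart) : A :=
  X a + X (D.rot a) - X (D.rot (D.rot (D.rot a))) - X (D.rot (D.rot a))

/-- A Dehn coloring, as a function on the corners.  Face invariance takes the place of functions on
`Region`, which for the crossingless circle has elements without corners. -/
structure IsCornerColoring {A : Type*} [AddCommGroup A] (C : D.Dart → A) : Prop where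
  face : FaceInvariant C
  cross_eq : ∀ a, D.isOver a = false → cross C a = 0

/-- Some crossing is not trivially colored.  By the crossing relation, one pair of opposite corners
has equal colors if and only if the other pair has. -/
def NontrivialCorners {A : Type*} (C : D.Dart → A) : Prop :=
  ∃ a, D.isOver a = false ∧ C (D.rot a) ≠ C (D.rot (D.rot (D.rot a)))

/-- The Fox coloring of a Dehn coloring: a semiarc gets the sum of the colors on its two sides. -/
def fox {A : Type*} [AddCommGroup A] (C : D.Dart → A) (a : D.Dart) : A :=
  C a + C (D.rot (D.rot (D.rot a)))

variable {A : Type*} [AddCommGroup A]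

theorem IsCornerColoring.sub_eq {C : D.Dart → A} (hC : IsCornerColoring C) {a : D.Dart}
    (ha : D.isOver a = false) :
    C a - C (D.rot (D.rot a)) = C (D.rot (D.rot (D.rot a))) - C (D.rot a) := by
  have := hC.cross_eq a ha
  rw [cross] at this
  rw [← sub_eq_zero, ← this]; abel

theorem sub_eq_fox (C : D.Dart → A) (a : D.Dart) :
    C (D.rot (D.rot (D.rot a))) - C (D.rot a) = fox C a - fox C (D.rot a) := by
  simp only [fox, rot_rot_rot_rot]; abel

theorem nontrivialCorners_iff_fox (C : D.Dart → A) :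
    NontrivialCorners C ↔ ∃ a, D.isOver a = false ∧ fox C a ≠ fox C (D.rot a) := by
  refine exists_congr fun a => and_congr_right fun _ => not_congr ?_
  rw [← sub_eq_zero (a := fox C a), ← sub_eq_fox, sub_eq_zero, eq_comm]

/-- A sum over all corners, crossing by crossing; each crossing has two under-darts. -/
theorem sum_under {R : Type*} [CommRing R] (h : D.Dart → R) :
    (∑ a, if D.isOver a then 0 else
      (h a + h (D.rot a) + h (D.rot (D.rot a)) + h (D.rot (D.rot (D.rot a))))) = 2 * ∑ a, h a := by
  have key : ∀ k : D.Dart → R, (∑ a, if D.isOver a then 0 else (k a + k (D.rot a))) = ∑ a, k a := by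
    intro k
    have h1 : ∀ a, (if D.isOver a then 0 else (k a + k (D.rot a))) =
        (if D.isOver a then 0 else k a) + (if D.isOver (D.rot a) then k (D.rot a) else 0) := by
      intro a; rw [isOver_rot_apply]; cases D.isOver a <;> simp
    rw [Finset.sum_congr rfl fun a _ => h1 a, Finset.sum_add_distrib,
      Equiv.sum_comp D.rot (fun a => if D.isOver a then k a else 0), ← Finset.sum_add_distrib]
    refine Finset.sum_congr rfl fun a _ => ?_
    cases D.isOver a <;> simp
  have h2 : ∑ a, h (D.rot (D.rot a)) = ∑ a, h a := by
    rw [Equiv.sum_comp D.rot (fun a => h (D.rot a)), Equiv.sum_comp D.rot h]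
  have := key h
  have h3 := key (fun a => h (D.rot (D.rot a)))
  rw [h2] at h3
  rw [two_mul, ← this]
  nth_rewrite 2 [this]
  rw [← h3, ← Finset.sum_add_distrib]
  refine Finset.sum_congr rfl fun a _ => ?_
  cases D.isOver a <;> simp
  ring

/-- A quantity attached to the directed semiarcs, antisymmetric under reversal, has sum zero. -/
theorem two_mul_sum_eq_zero {R : Type*} [CommRing R] (h : D.Dart → R)
    (hh : ∀ a, h (D.edge a) = -h a) : 2 * ∑ a, h a = 0 := by
  have : ∑ a, h a = ∑ a, -h a := by
    rw [← Equiv.sum_comp D.edge h]; exact Finset.sum_congr rfl fun a _ => hh a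
  rw [Finset.sum_neg_distrib] at this
  linear_combination this

/-- Summation by parts along the boundaries of the regions. -/
theorem sum_mul_sub_eq_zero {R : Type*} [CommRing R] {v y : D.Dart → R} (hv : FaceInvariant v)
    (hy : FaceInvariant y) :
    ∑ a, v a * (y (D.rot (D.rot (D.rot a))) - y (D.rot a)) = 0 := by
  have h : ∑ a, v a * y (D.rot a) = ∑ a, v a * y (D.edge a) := by
    rw [← Equiv.sum_comp D.face]
    exact Finset.sum_congr rfl fun a _ => by rw [hv, rot_face]
  simp only [mul_sub, Finset.sum_sub_distrib, h, hy.edge, sub_self]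

end Basic

/-! ### The linking pairing of colorings -/

section Pairing

variable {D : KnotDiagram} {p : ℕ}

/-- The contribution of an under-dart to the pairing of a Dehn `p`-coloring, given by an integer
lift `X`, with a Dehn `p`-coloring `y`. -/
def pairTerm (X : D.Dart → ℤ) (y : D.Dart → ZMod p) (a : D.Dart) : ZMod p :=
  if D.isOver a then 0 else ((cross X a / p : ℤ) : ZMod p) * (y a - y (D.rot (D.rot a)))

/-- The pairing of two Dehn `p`-colorings, the first one being given by an integer lift.  Up
to a constant factor it is the linking pairing of the double branched cover on the corresponding
classes: `cross X / p` is the boundary of the chain `X` modulo `p`, divided by `p`. -/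
noncomputable def liftPairing (X : D.Dart → ℤ) (y : D.Dart → ZMod p) : ZMod p :=
  ∑ a, pairTerm X y a

/-- The standard integer lift of a function with values in `ZMod p`. -/
def lift (C : D.Dart → ZMod p) (a : D.Dart) : ℤ := ((C a).val : ℤ)

/-- The pairing of two Dehn `p`-colorings. -/
noncomputable def pairing (C y : D.Dart → ZMod p) : ZMod p := liftPairing (lift C) y

theorem FaceInvariant.lift {C : D.Dart → ZMod p} (hC : FaceInvariant C) :
    FaceInvariant (lift C) := fun a => by simp only [KnotDiagram.lift, hC a]

theorem intCast_lift [NeZero p] (C : D.Dart → ZMod p) (a : D.Dart) :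
    ((lift C a : ℤ) : ZMod p) = C a := by simp [lift]

theorem intCast_cross (X : D.Dart → ℤ) (a : D.Dart) :
    ((cross X a : ℤ) : ZMod p) = cross (fun a => ((X a : ℤ) : ZMod p)) a := by simp [cross]

theorem dvd_cross {C : D.Dart → ZMod p} (hC : IsCornerColoring C) {X : D.Dart → ℤ}
    (hX : ∀ a, (X a : ZMod p) = C a) {a : D.Dart} (ha : D.isOver a = false) :
    (p : ℤ) ∣ cross X a := by
  rw [← ZMod.intCast_zmod_eq_zero_iff_dvd, intCast_cross, funext hX, hC.cross_eq a ha]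

theorem cross_add (X Y : D.Dart → ℤ) (a : D.Dart) :
    cross (fun a => X a + Y a) a = cross X a + cross Y a := by simp [cross]; ring

theorem cross_mul (n : ℤ) (X : D.Dart → ℤ) (a : D.Dart) :
    cross (fun a => n * X a) a = n * cross X a := by simp [cross]; ring

theorem sum_cross_mul {R : Type*} [CommRing R] {v y : D.Dart → R} (hv : FaceInvariant v)
    (hy : IsCornerColoring y) :
    (∑ a, if D.isOver a then 0 else cross v a * (y a - y (D.rot (D.rot a)))) = 0 := by
  -- by the relation for `y`, each crossing contributes the boundary terms at its four corners
  have := sum_under fun a => v a * (y (D.rot (D.rot (D.rot a))) - y (D.rot a))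
  rw [sum_mul_sub_eq_zero hv hy.face, mul_zero] at this
  refine Eq.trans (Finset.sum_congr rfl fun a _ => ?_) this
  cases ha : D.isOver a
  · have h := hy.sub_eq ha
    simp only [Bool.false_eq_true, if_false, rot_rot_rot_rot, cross]
    linear_combination (v a - v (D.rot (D.rot a))) * h
  · simp

/-- The pairing does not depend on the integer lift. -/
theorem liftPairing_congr [NeZero p] {C y : D.Dart → ZMod p} (hy : IsCornerColoring y)
    {X X' : D.Dart → ℤ} (hX : FaceInvariant X) (hX' : FaceInvariant X')
    (h : ∀ a, (X a : ZMod p) = C a) (h' : ∀ a, (X' a : ZMod p) = C a) :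
    liftPairing X y = liftPairing X' y := by
  have hp : (p : ℤ) ≠ 0 := by exact_mod_cast NeZero.ne p
  have hdvd : ∀ a, (p : ℤ) ∣ X' a - X a := fun a => by
    rw [← ZMod.intCast_zmod_eq_zero_iff_dvd]; simp [h, h']
  choose v hv using hdvd
  have hvf : FaceInvariant v := fun a => by
    have h1 := hv a
    have h2 := hv (D.face a)
    rw [hX, hX', h1] at h2
    exact (mul_left_cancel₀ hp h2).symm
  have hXv : X' = fun a => X a + p * v a := funext fun a => by rw [← hv]; ring
  have h0 := sum_cross_mul (R := ZMod p) (v := fun a => (v a : ZMod p)) (y := y)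
    (fun a => by simp [hvf a]) hy
  have : liftPairing X' y = liftPairing X y +
      ∑ a, if D.isOver a then 0 else cross (fun a => (v a : ZMod p)) a *
        (y a - y (D.rot (D.rot a))) := by
    rw [liftPairing, liftPairing, ← Finset.sum_add_distrib]
    refine Finset.sum_congr rfl fun a _ => ?_
    unfold pairTerm
    cases D.isOver a
    · simp only [Bool.false_eq_true, if_false]
      rw [hXv, cross_add, cross_mul, Int.add_mul_ediv_left _ _ hp, ← intCast_cross]
      push_cast; ring
    · simp
  rw [this, h0, add_zero]

theorem liftPairing_eq_pairing [NeZero p] {C y : D.Dart → ZMod p} (hC : IsCornerColoring C)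
    (hy : IsCornerColoring y) {X : D.Dart → ℤ} (hX : FaceInvariant X)
    (h : ∀ a, (X a : ZMod p) = C a) : liftPairing X y = pairing C y :=
  liftPairing_congr hy hX hC.face.lift h (intCast_lift C)

/-- If the terms of the pairing form a coboundary, then the pairing vanishes: each term is the sum
of a quantity over the four semiarcs that leave a crossing, and the two ends of a semiarc
cancel. -/
theorem liftPairing_eq_zero {X : D.Dart → ℤ} {y : D.Dart → ZMod p} (h : D.Dart → ZMod p)
    (hh : ∀ a, h (D.edge a) = -h a)
    (hX : ∀ a, D.isOver a = false → ((cross X a / p : ℤ) : ZMod p) * (y a - y (D.rot (D.rot a))) =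
      h a + h (D.rot a) + h (D.rot (D.rot a)) + h (D.rot (D.rot (D.rot a)))) :
    liftPairing X y = 0 := by
  rw [← two_mul_sum_eq_zero h hh, ← sum_under, liftPairing]
  refine Finset.sum_congr rfl fun a _ => ?_
  unfold pairTerm
  cases ha : D.isOver a
  · simp [hX a ha]
  · simp

/-- The pairing only depends on the Fox colorings: two Dehn colorings with the same Fox coloring
differ by a function with opposite values on the two sides of each semiarc. -/
theorem pairing_congr_fox [NeZero p] {C C' y y' : D.Dart → ZMod p} (hC : IsCornerColoring C)
    (hC' : IsCornerColoring C') (hy : IsCornerColoring y) (hy' : IsCornerColoring y')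
    (h : fox C = fox C') (h' : fox y = fox y') : pairing C y = pairing C' y' := by
  have h1 : pairing C y = liftPairing (lift C) y' := by
    refine Finset.sum_congr rfl fun a _ => ?_
    unfold pairTerm
    cases ha : D.isOver a
    · simp only [Bool.false_eq_true, if_false]
      rw [hy.sub_eq ha, hy'.sub_eq ha, sub_eq_fox, sub_eq_fox, h']
    · simp
  have hτ : ∀ a, C' (D.rot a) - C (D.rot a) = -(C' a - C a) := by
    intro a
    have := congrFun h (D.rot a)
    simp only [fox, rot_rot_rot_rot] at this
    linear_combination -this
  have hτ2 : ∀ a, C' (D.rot (D.rot a)) - C (D.rot (D.rot a)) = C' a - C a := by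
    intro a; rw [hτ, hτ, neg_neg]
  have h2 : liftPairing (fun a => lift C a + lift (fun a => C' a - C a) a) y' =
      liftPairing (lift C) y' := by
    refine Finset.sum_congr rfl fun a _ => ?_
    unfold pairTerm
    have : cross (lift fun a => C' a - C a) a = 0 := by
      simp only [cross, lift, hτ2]; ring
    rw [cross_add, this, add_zero]
  rw [h1, ← h2]
  refine liftPairing_eq_pairing hC' hy' ?_ ?_
  · intro a
    have := (FaceInvariant.lift (C := fun a => C' a - C a)
      (fun a => by simp [hC.face a, hC'.face a])) a
    show lift C _ + _ = _
    rw [this, hC.face.lift a]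
  · intro a
    push_cast
    rw [intCast_lift, intCast_lift]; ring

end Pairing

end KnotDiagram

namespace KnotDiagram

/-! ### Fox colorings extend to regions -/

section Planar

variable {D : KnotDiagram}

/-- All darts are connected by turning around crossings and walking along semiarcs. -/
theorem dart_induction {P : D.Dart → Prop} (hedge : ∀ a, P a → P (D.edge a))
    (hrot : ∀ a, P a → P (D.rot a)) {a₀ : D.Dart} (h₀ : P a₀) (a : D.Dart) : P a := by
  have := D.finite_dart
  have hpow : ∀ k : ℕ, P (((D.rot * D.rot * D.edge) ^ k) a₀) := by
    intro k
    induction k with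
    | zero => simpa using h₀
    | succ k ih =>
      rw [pow_succ', Equiv.Perm.mul_apply]
      exact hrot _ (hrot _ (hedge _ ih))
  rcases D.one_component a₀ a with h | h
  · obtain ⟨k, -, rfl⟩ := h.exists_pow_eq'
    exact hpow k
  · obtain ⟨k, -, hk⟩ := h.exists_pow_eq'
    have := hedge _ (hpow k)
    rwa [hk, edge_edge_apply] at this

/-- A function that is constant along the strand, through every crossing, is constant. -/
theorem eq_of_strand_invariant {A : Type*} {c : D.Dart → A} (hedge : ∀ a, c (D.edge a) = c a)
    (hopp : ∀ a, c (D.rot (D.rot a)) = c a) (a b : D.Dart) : c a = c b := by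
  have := D.finite_dart
  have hpow : ∀ k : ℕ, c (((D.rot * D.rot * D.edge) ^ k) a) = c a := by
    intro k
    induction k with
    | zero => simp
    | succ k ih =>
      rw [pow_succ', Equiv.Perm.mul_apply, Equiv.Perm.mul_apply, Equiv.Perm.mul_apply, hopp, hedge,
        ih]
  rcases D.one_component a b with h | h
  · obtain ⟨k, -, rfl⟩ := h.exists_pow_eq'
    exact (hpow k).symm
  · obtain ⟨k, -, hk⟩ := h.exists_pow_eq'
    rw [← hedge b, ← hk, hpow]

/-- A Fox coloring, as a function on the darts: constant on semiarcs and over-strands, and at each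
crossing the over-strand is the mean of the two under-strands. -/
structure IsFoxColoring {A : Type*} [AddCommGroup A] (c : D.Dart → A) : Prop where
  edge : ∀ a, c (D.edge a) = c a
  of_over : ∀ a, D.isOver a = true → c (D.rot (D.rot a)) = c a
  of_under : ∀ a, D.isOver a = false →
    c a + c (D.rot (D.rot a)) = c (D.rot a) + c (D.rot (D.rot (D.rot a)))

theorem IsCornerColoring.isFoxColoring {A : Type*} [AddCommGroup A] {C : D.Dart → A}
    (hC : IsCornerColoring C) : IsFoxColoring (fox C) where
  edge a := by
    simp only [fox]
    rw [hC.face.edge, hC.face.rot_edge, add_comm]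
  of_over a ha := by
    have h := hC.sub_eq (a := D.rot a) (by rw [isOver_rot_apply, ha]; rfl)
    simp only [rot_rot_rot_rot] at h
    simp only [fox, rot_rot_rot_rot]
    rw [sub_eq_sub_iff_add_eq_add] at h
    rw [add_comm, h]
  of_under a _ := by
    simp only [fox, rot_rot_rot_rot]; abel

theorem sameCycle_edge_iff {a b : D.Dart} : D.edge.SameCycle b a ↔ b = a ∨ b = D.edge a := by
  have := D.finite_dart
  constructor
  · intro h
    obtain ⟨k, -, hk⟩ := h.symm.exists_pow_eq'
    have : ∀ k : ℕ, (D.edge ^ k) a = a ∨ (D.edge ^ k) a = D.edge a := by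
      intro k
      induction k with
      | zero => simp
      | succ k ih =>
        rw [pow_succ', Equiv.Perm.mul_apply]
        rcases ih with h | h <;> rw [h] <;> simp
    exact hk ▸ this k
  · rintro (rfl | rfl)
    · exact Equiv.Perm.SameCycle.refl _ _
    · exact ⟨1, by simp⟩

theorem sameCycle_rot_iff {a b : D.Dart} : D.rot.SameCycle a b ↔
    b = a ∨ b = D.rot a ∨ b = D.rot (D.rot a) ∨ b = D.rot (D.rot (D.rot a)) := by
  have := D.finite_dart
  constructor
  · intro h
    obtain ⟨k, -, hk⟩ := h.exists_pow_eq'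
    have : ∀ k : ℕ, (D.rot ^ k) a = a ∨ (D.rot ^ k) a = D.rot a ∨ (D.rot ^ k) a = D.rot (D.rot a) ∨
        (D.rot ^ k) a = D.rot (D.rot (D.rot a)) := by
      intro k
      induction k with
      | zero => simp
      | succ k ih =>
        rw [pow_succ', Equiv.Perm.mul_apply]
        rcases ih with h | h | h | h <;> rw [h] <;> simp
    exact hk ▸ this k
  · rintro (rfl | rfl | rfl | rfl)
    · exact Equiv.Perm.SameCycle.refl _ _
    · exact ⟨1, by simp⟩
    · exact ⟨2, by simp [zpow_ofNat, pow_succ]⟩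
    · exact ⟨3, by simp [zpow_ofNat, pow_succ]⟩

theorem rot_ne (a : D.Dart) : D.rot a ≠ a := fun h => by
  have := isOver_rot_apply a
  rw [h] at this
  cases hh : D.isOver a <;> simp [hh] at this

theorem rot_three_ne (a : D.Dart) : D.rot (D.rot (D.rot a)) ≠ a := fun h =>
  rot_ne a (by conv_rhs => rw [← rot_rot_rot_rot a, h])

open Classical in
theorem sum_edge_orbit {R : Type*} [AddCommMonoid R] (h : D.Dart → R) (a : D.Dart) :
    (∑ b, if D.edge.SameCycle b a then h b else 0) = h a + h (D.edge a) := by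
  have : Finset.univ.filter (fun b => D.edge.SameCycle b a) = {a, D.edge a} := by
    ext b; simp [sameCycle_edge_iff]
  rw [← Finset.sum_filter, this, Finset.sum_pair (D.edge_ne a).symm]

open Classical in
theorem sum_rot_orbit {R : Type*} [AddCommMonoid R] (h : D.Dart → R) (a : D.Dart) :
    (∑ b, if D.rot.SameCycle a b then h b else 0) =
      h a + (h (D.rot a) + (h (D.rot (D.rot a)) + h (D.rot (D.rot (D.rot a))))) := by
  have : Finset.univ.filter (fun b => D.rot.SameCycle a b) =
      {a, D.rot a, D.rot (D.rot a), D.rot (D.rot (D.rot a))} := by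
    ext b; simp [sameCycle_rot_iff]
  have h2 := D.rot_two_ne
  rw [← Finset.sum_filter, this, Finset.sum_insert, Finset.sum_insert,
    Finset.sum_pair (rot_ne _).symm]
  · simpa using ⟨(rot_ne _).symm, (h2 _).symm⟩
  · simpa using ⟨(rot_ne _).symm, (h2 _).symm, (rot_three_ne _).symm⟩

open Classical in
/-- On the sphere each Fox coloring is induced by a coloring of the regions.  This is exactness of
`(regions → K) → (semiarcs → K) → (crossings → K)` in the middle: the first map has a kernel, the
second one a cokernel of dimension at most one, as the diagram is connected, and Euler's formula
gives the rest. -/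
theorem IsFoxColoring.exists_corner_coloring {K : Type*} [Field K] {c : D.Dart → K}
    (hc : IsFoxColoring c) : ∃ C : D.Dart → K, IsCornerColoring C ∧ fox C = c := by
  rcases isEmpty_or_nonempty D.Dart with hD | hD
  · exact ⟨c, ⟨fun a => hD.elim a, fun a => hD.elim a⟩, funext fun a => hD.elim a⟩
  obtain ⟨a₀⟩ := id hD
  have := D.finite_dart
  let Reg := Quotient (Equiv.Perm.SameCycle.setoid D.face)
  let Arc := Quotient (Equiv.Perm.SameCycle.setoid D.edge)
  let Cro := Quotient (Equiv.Perm.SameCycle.setoid D.rot)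
  let : Fintype Reg := Fintype.ofFinite _
  let : Fintype Arc := Fintype.ofFinite _
  let : Fintype Cro := Fintype.ofFinite _
  let reg : D.Dart → Reg := Quotient.mk _
  let arc : D.Dart → Arc := Quotient.mk _
  let cro : D.Dart → Cro := Quotient.mk _
  have harc : ∀ {a b}, arc b = arc a ↔ D.edge.SameCycle b a := fun {a b} => Quotient.eq
  have hcro : ∀ {a b}, cro b = cro a ↔ D.rot.SameCycle a b :=
    fun {a b} => Quotient.eq.trans ⟨fun h => h.symm, fun h => h.symm⟩
  have hreg : ∀ a, reg (D.face a) = reg a :=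
    fun a => Quotient.sound (Equiv.Perm.SameCycle.symm ⟨1, by simp⟩)
  have hregrot : ∀ a, reg (D.edge (D.rot a)) = reg a := by
    intro a; rw [← hreg, face_apply, edge_edge_apply, rot_rot_rot_rot]
  -- over-darts and under-darts enter the sum at a crossing with opposite signs
  let σ : D.Dart → K := fun a => if D.isOver a then -1 else 1
  have hσ : ∀ a, σ (D.rot a) = -σ a := by
    intro a; simp only [σ, isOver_rot_apply]; cases D.isOver a <;> simp
  have hσ0 : ∀ a, σ a ≠ 0 := by intro a; simp only [σ]; split_ifs <;> simp
  let Φ : (Reg → K) →ₗ[K] (Arc → K) :=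
    { toFun := fun C e => ∑ b, if arc b = e then C (reg b) else 0
      map_add' := fun C C' => by
        funext e; simp only [Pi.add_apply, ← Finset.sum_add_distrib]
        exact Finset.sum_congr rfl fun b _ => by split_ifs <;> simp
      map_smul' := fun k C => by
        funext e; simp only [Pi.smul_apply, smul_eq_mul, RingHom.id_apply, Finset.mul_sum]
        exact Finset.sum_congr rfl fun b _ => by split_ifs <;> simp }
  let Ψ : (Arc → K) →ₗ[K] (Cro → K) :=
    { toFun := fun c x => ∑ b, if cro b = x then σ b * c (arc b) else 0
      map_add' := fun C C' => by
        funext e; simp only [Pi.add_apply, ← Finset.sum_add_distrib]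
        exact Finset.sum_congr rfl fun b _ => by split_ifs <;> simp [mul_add]
      map_smul' := fun k C => by
        funext e; simp only [Pi.smul_apply, smul_eq_mul, RingHom.id_apply, Finset.mul_sum]
        exact Finset.sum_congr rfl fun b _ => by split_ifs <;> simp [mul_left_comm] }
  have hΦ : ∀ C a, Φ C (arc a) = C (reg a) + C (reg (D.edge a)) := by
    intro C a
    simp only [Φ, LinearMap.coe_mk, AddHom.coe_mk, harc]
    exact sum_edge_orbit (fun b => C (reg b)) a
  have hΨ : ∀ c a, Ψ c (cro a) = σ a * (c (arc a) - c (arc (D.rot a)) + c (arc (D.rot (D.rot a))) -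
      c (arc (D.rot (D.rot (D.rot a))))) := by
    intro c a
    simp only [Ψ, LinearMap.coe_mk, AddHom.coe_mk, hcro]
    rw [sum_rot_orbit (fun b => σ b * c (arc b)) a]
    simp only [hσ]; ring
  have hΦrot : ∀ C a, Φ C (arc a) = C (reg a) + C (reg (D.rot (D.rot (D.rot a)))) := by
    intro C a
    rw [hΦ]
    congr 2
    rw [← hregrot (D.rot (D.rot (D.rot a))), rot_rot_rot_rot]
  have hle : LinearMap.range Φ ≤ LinearMap.ker Ψ := by
    rintro _ ⟨C, rfl⟩
    rw [LinearMap.mem_ker]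
    funext x
    obtain ⟨a, rfl⟩ := Quotient.exists_rep x
    show Ψ (Φ C) (cro a) = 0
    rw [hΨ]
    simp only [hΦrot, rot_rot_rot_rot]; ring
  have hkerΦ : Module.finrank K (LinearMap.ker Φ) ≤ 1 := by
    let ev : LinearMap.ker Φ →ₗ[K] K := (LinearMap.proj (reg a₀)).comp (LinearMap.ker Φ).subtype
    have hinj : Function.Injective ev := by
      rw [← LinearMap.ker_eq_bot, LinearMap.ker_eq_bot']
      rintro ⟨C, hC⟩ h0
      have h0 : C (reg a₀) = 0 := h0
      have hC' : ∀ a, C (reg (D.edge a)) = -C (reg a) := by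
        intro a
        have := congrFun (LinearMap.mem_ker.1 hC) (arc a)
        rw [hΦ] at this
        exact eq_neg_of_add_eq_zero_right this
      have : ∀ a, C (reg a) = 0 := by
        refine dart_induction (a₀ := a₀) (fun a ha => ?_) (fun a ha => ?_) h0
        · rw [hC', ha, neg_zero]
        · have := hC' (D.rot a)
          rw [hregrot, ha] at this
          rw [← neg_eq_zero, ← this]
      ext x
      obtain ⟨a, rfl⟩ := Quotient.exists_rep x
      exact this a
    calc _ ≤ Module.finrank K K := LinearMap.finrank_le_finrank_of_injective hinj
      _ = 1 := Module.finrank_self K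
  have hrangeΨ : Nat.card Cro ≤ Module.finrank K (LinearMap.range Ψ) + 1 := by
    have htop : LinearMap.range Ψ ⊔ Submodule.span K {Pi.single (cro a₀) (1 : K)} = ⊤ := by
      set W := LinearMap.range Ψ ⊔ Submodule.span K {Pi.single (cro a₀) (1 : K)}
      -- a semiarc makes the classes of its two end crossings proportional
      have hmem : ∀ a, Pi.single (cro a) (1 : K) ∈ W := by
        refine dart_induction (a₀ := a₀) (fun a ha => ?_) (fun a ha => ?_) ?_
        · have h1 : Ψ (Pi.single (arc a) 1) =
              σ a • Pi.single (cro a) 1 + σ (D.edge a) • Pi.single (cro (D.edge a)) 1 := by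
            funext x
            have : ∀ b, (if cro b = x then σ b * (Pi.single (arc a) (1 : K) : Arc → K) (arc b)
                else 0) = if D.edge.SameCycle b a then
                  σ b * (Pi.single (cro b) (1 : K) : Cro → K) x else 0 := by
              intro b
              simp only [Pi.single_apply, harc, eq_comm (a := x)]
              split_ifs <;> simp
            simp only [Ψ, LinearMap.coe_mk, AddHom.coe_mk, this]
            rw [sum_edge_orbit (fun b => σ b * (Pi.single (cro b) (1 : K) : Cro → K) x)]
            simp
          have h2 : σ (D.edge a) • (Pi.single (cro (D.edge a)) 1 : Cro → K) ∈ W := by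
            rw [eq_sub_of_add_eq' h1.symm]
            exact W.sub_mem (Submodule.mem_sup_left ⟨_, rfl⟩) (W.smul_mem _ ha)
          exact (W.smul_mem_iff (hσ0 _)).1 h2
        · rwa [(hcro (a := a)).2 ⟨1, by simp⟩]
        · exact Submodule.mem_sup_right (Submodule.subset_span rfl)
      rw [eq_top_iff, ← (Pi.basisFun K Cro).span_eq, Submodule.span_le]
      rintro _ ⟨x, rfl⟩
      obtain ⟨a, rfl⟩ := Quotient.exists_rep x
      simpa using hmem a
    have h1 := Submodule.finrank_add_le_finrank_add_finrank (LinearMap.range Ψ)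
      (Submodule.span K {Pi.single (cro a₀) (1 : K)})
    rw [htop, finrank_top, Module.finrank_fintype_fun_eq_card] at h1
    have h2 := finrank_span_le_card (R := K) ({Pi.single (cro a₀) (1 : K)} : Set (Cro → K))
    simp only [Set.toFinset_singleton, Finset.card_singleton] at h2
    rw [Nat.card_eq_fintype_card]
    omega
  -- the ranks of `Φ` and `Ψ` and Euler's formula
  have heq : LinearMap.range Φ = LinearMap.ker Ψ := by
    refine Submodule.eq_of_le_of_finrank_le hle ?_
    have e1 := LinearMap.finrank_range_add_finrank_ker Φ
    have e2 := LinearMap.finrank_range_add_finrank_ker Ψ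
    rw [Module.finrank_fintype_fun_eq_card, ← Nat.card_eq_fintype_card] at e1 e2
    have e3 : Nat.card Cro + Nat.card Reg = Nat.card Arc + 2 := D.planar hD
    omega
  -- the Fox coloring as a function on the semiarcs
  let c' : Arc → K := Quotient.lift c (by
    intro a b h
    rcases sameCycle_edge_iff.1 (show D.edge.SameCycle a b from h) with rfl | rfl
    · rfl
    · exact hc.edge b)
  have hc' : ∀ a, c' (arc a) = c a := fun a => rfl
  have hker : c' ∈ LinearMap.ker Ψ := by
    rw [LinearMap.mem_ker]
    funext x
    obtain ⟨a, rfl⟩ := Quotient.exists_rep x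
    show Ψ c' (cro a) = 0
    rw [hΨ]
    simp only [hc']
    cases ha : D.isOver a
    · have := hc.of_under a ha
      linear_combination σ a * this
    · have := hc.of_under (D.rot a) (by rw [isOver_rot_apply, ha]; rfl)
      rw [rot_rot_rot_rot] at this
      linear_combination -σ a * this
  rw [← heq] at hker
  obtain ⟨C, hC⟩ := hker
  have hfox : ∀ a, C (reg a) + C (reg (D.rot (D.rot (D.rot a)))) = c a := by
    intro a; rw [← hΦrot, hC, hc']
  refine ⟨fun a => C (reg a), ⟨fun a => by rw [hreg], fun a ha => ?_⟩, funext hfox⟩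
  have h1 := hfox (D.rot a)
  have h3 := hfox (D.rot (D.rot (D.rot a)))
  have h := hc.of_over (D.rot a) (by rw [isOver_rot_apply, ha]; rfl)
  simp only [rot_rot_rot_rot] at h1 h3
  simp only [cross]
  linear_combination h1 - h3 - h

end Planar

end KnotDiagram

namespace KnotDiagram

/-! ### Correspondences of colorings -/

section Correspondence

variable {p : ℕ}

/-- The Dehn `p`-colorings of `D` and `D'` correspond to each other (up to trivial colorings), in a
way that preserves nontriviality and the pairing.  A relation is used instead of a bijection, as this
makes the notion an equivalence relation without any bookkeeping for the trivial colorings. -/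
def Corresponds (p : ℕ) (D D' : KnotDiagram) : Prop :=
  ∃ T : (D.Dart → ZMod p) → (D'.Dart → ZMod p) → Prop,
    (∀ C, IsCornerColoring C → ∃ C', IsCornerColoring C' ∧ T C C') ∧
    (∀ C', IsCornerColoring C' → ∃ C, IsCornerColoring C ∧ T C C') ∧
    (∀ C C', IsCornerColoring C → IsCornerColoring C' → T C C' →
      (NontrivialCorners C ↔ NontrivialCorners C')) ∧
    ∀ C C' y y', IsCornerColoring C → IsCornerColoring C' → IsCornerColoring y →
      IsCornerColoring y' → T C C' → T y y' → pairing C y = pairing C' y'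

theorem Corresponds.refl (D : KnotDiagram) : Corresponds p D D :=
  ⟨Eq, fun C h => ⟨C, h, rfl⟩, fun C h => ⟨C, h, rfl⟩, fun _ _ _ _ h => by rw [h],
    fun _ _ _ _ _ _ _ _ h h' => by rw [h, h']⟩

theorem Corresponds.symm {D D' : KnotDiagram} (h : Corresponds p D D') : Corresponds p D' D := by
  obtain ⟨T, h1, h2, h3, h4⟩ := h
  exact ⟨fun C' C => T C C', h2, h1, fun C' C hC' hC h => (h3 C C' hC hC' h).symm,
    fun C' C y' y hC' hC hy' hy h h' => (h4 C C' y y' hC hC' hy hy' h h').symm⟩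

theorem Corresponds.trans {D D' D'' : KnotDiagram} (h : Corresponds p D D')
    (h' : Corresponds p D' D'') : Corresponds p D D'' := by
  obtain ⟨T, h1, h2, h3, h4⟩ := h
  obtain ⟨T', h1', h2', h3', h4'⟩ := h'
  refine ⟨fun C C'' => ∃ C', IsCornerColoring C' ∧ T C C' ∧ T' C' C'', ?_, ?_, ?_, ?_⟩
  · intro C hC
    obtain ⟨C', hC', hT⟩ := h1 C hC
    obtain ⟨C'', hC'', hT'⟩ := h1' C' hC'
    exact ⟨C'', hC'', C', hC', hT, hT'⟩
  · intro C'' hC''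
    obtain ⟨C', hC', hT'⟩ := h2' C'' hC''
    obtain ⟨C, hC, hT⟩ := h2 C' hC'
    exact ⟨C, hC, C', hC', hT, hT'⟩
  · rintro C C'' hC hC'' ⟨C', hC', hT, hT'⟩
    exact (h3 C C' hC hC' hT).trans (h3' C' C'' hC' hC'' hT')
  · rintro C C'' y y'' hC hC'' hy hy'' ⟨C', hC', hT, hT'⟩ ⟨y', hy', hU, hU'⟩
    exact (h4 C C' y y' hC hC' hy hy' hT hU).trans (h4' C' C'' y' y'' hC' hC'' hy' hy'' hT' hU')

theorem Iso.corresponds {D D' : KnotDiagram} (h : Iso D D') : Corresponds p D D' := by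
  obtain ⟨f, hrot, hover, hedge⟩ := h
  have hcr : ∀ {A : Type} [AddCommGroup A] (C' : D'.Dart → A) a,
      cross (fun a => C' (f a)) a = cross C' (f a) := by
    intro A _ C' a; simp only [cross, hrot]
  have key : ∀ C : D.Dart → ZMod p, ∀ C' : D'.Dart → ZMod p, (C = fun a => C' (f a)) →
      (IsCornerColoring C ↔ IsCornerColoring C') := by
    rintro C C' rfl
    constructor
    · rintro ⟨h1, h2⟩
      constructor
      · intro a
        obtain ⟨a, rfl⟩ := f.surjective a
        have := h1 a
        simp only [face_apply, hrot, hedge] at this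
        rw [face_apply, this]
      · intro a ha
        obtain ⟨a, rfl⟩ := f.surjective a
        rw [← hcr]
        exact h2 a (by rw [← hover, ha])
    · rintro ⟨h1, h2⟩
      constructor
      · intro a
        simp only [face_apply, hrot, hedge]
        rw [← face_apply, h1]
      · intro a ha
        rw [hcr]
        exact h2 _ (by rw [hover, ha])
  refine ⟨fun C C' => C = fun a => C' (f a), ?_, ?_, ?_, ?_⟩
  · intro C hC
    have : C = fun a => C (f.symm (f a)) := by simp
    exact ⟨fun a => C (f.symm a), (key _ _ this).1 hC, this⟩
  · intro C' hC'
    exact ⟨fun a => C' (f a), (key _ _ rfl).2 hC', rfl⟩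
  · rintro _ C' - - rfl
    constructor
    · rintro ⟨a, ha, h⟩
      exact ⟨f a, by rw [hover, ha], by simpa only [hrot] using h⟩
    · rintro ⟨a, ha, h⟩
      obtain ⟨a, rfl⟩ := f.surjective a
      exact ⟨a, by rw [← hover, ha], by simpa only [hrot] using h⟩
  · rintro _ C' _ y' - - - - rfl rfl
    unfold pairing liftPairing
    rw [← Equiv.sum_comp f]
    refine Finset.sum_congr rfl fun a _ => ?_
    simp only [pairTerm, cross, lift, hrot, hover]

end Correspondence

/-! ### Erasing crossings -/

section Erasing

variable {D D' : KnotDiagram} {p : ℕ}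

/-- The next dart along the strand, straight through the crossing. -/
def step (D : KnotDiagram) (y : D.Dart) : D.Dart := D.edge (D.opp y)

theorem step_opp (y : D.Dart) : D.step (D.opp y) = D.edge y := by simp [step, opp]

/-- The structure of an embedding `f` of the crossings of `D'` into those of `D`, as in the
definition of `Erases`, for a set `S` made of full crossings. -/
structure IsErasure (S : Set D.Dart) (f : D'.Dart → D.Dart) : Prop where
  rot_mem : ∀ x, D.rot x ∈ S ↔ x ∈ S
  inj : Function.Injective f
  range_eq : Set.range f = Sᶜ
  map_rot : ∀ x, f (D'.rot x) = D.rot (f x)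
  isOver_eq : ∀ x, D'.isOver x = D.isOver (f x)
  map_edge : ∀ x, ∃ k : ℕ, f (D'.edge x) = D.step^[k] (D.edge (f x)) ∧
    ∀ j < k, D.step^[j] (D.edge (f x)) ∈ S

variable {S : Set D.Dart} {f : D'.Dart → D.Dart}

theorem IsErasure.notMem (hf : IsErasure S f) (x : D'.Dart) : f x ∉ S := by
  have : f x ∈ Set.range f := ⟨x, rfl⟩
  rwa [hf.range_eq] at this

theorem IsErasure.exists_eq (hf : IsErasure S f) {y : D.Dart} (hy : y ∉ S) : ∃ x, f x = y := by
  have : y ∈ Sᶜ := hy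
  rwa [← hf.range_eq] at this

theorem IsErasure.opp_mem (hf : IsErasure S f) (x : D.Dart) : D.opp x ∈ S ↔ x ∈ S := by
  rw [opp, hf.rot_mem, hf.rot_mem]

/-- A quantity preserved by each pass through two crossings in `S` is preserved until the strand
leaves `S`. -/
theorem iterate_step_eq {A : Type*} {Φ : D.Dart → A} {O : Set D.Dart}
    (hO : ∀ y ∈ O, D.step y ∈ S ∧ (D.step (D.step y) ∈ S → D.step (D.step y) ∈ O) ∧
      Φ (D.step (D.step y)) = Φ y) :
    ∀ k y, (y ∈ S → y ∈ O) → (∀ j < k, D.step^[j] y ∈ S) → D.step^[k] y ∉ S →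
      Φ (D.step^[k] y) = Φ y
  | 0, _, _, _, _ => rfl
  | 1, y, hy, hS, hn => absurd (hO y (hy (hS 0 one_pos))).1 hn
  | k + 2, y, hy, hS, hn => by
    obtain ⟨-, h2, h3⟩ := hO y (hy (hS 0 (by omega)))
    rw [← h3]
    exact iterate_step_eq hO k _ h2 (fun j hj => hS (j + 2) (by omega)) hn

/-- If the color on the left of a strand is the same before and after it passes through `S`, then a
Dehn coloring of `D` restricts to one of `D'`. -/
theorem IsErasure.restrict (hf : IsErasure S f) {O : Set D.Dart}
    (hO : ∀ y ∈ S, D.edge y ∉ S → y ∈ O) {C : D.Dart → ZMod p} (hC : IsCornerColoring C)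
    (h : ∀ y ∈ O, D.step y ∈ S ∧ (D.step (D.step y) ∈ S → D.step (D.step y) ∈ O) ∧
      C (D.rot (D.rot (D.rot (D.step (D.step y))))) = C (D.rot (D.rot (D.rot y)))) :
    IsCornerColoring fun x => C (f x) where
  face x := by
    obtain ⟨k, hk, hS⟩ := hf.map_edge x
    have h1 := iterate_step_eq (Φ := fun y => C (D.rot (D.rot (D.rot y)))) h k (D.edge (f x))
      (fun hy => hO _ hy (by rw [edge_edge_apply]; exact hf.notMem x)) hS (hk ▸ hf.notMem _)
    show C (f (D'.face x)) = C (f x)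
    rw [face_apply, hf.map_rot, hf.map_rot, hf.map_rot, hk, h1, hC.face.rot_edge]
  cross_eq x hx := by
    have := hC.cross_eq (f x) (by rw [← hf.isOver_eq, hx])
    simpa only [cross, hf.map_rot] using this

/-- Walking from any dart one gets out of `S`, as there is only one component. -/
theorem IsErasure.exists_exit (hf : IsErasure S f) (x₀ : D'.Dart) (y : D.Dart) :
    ∃ (x : D'.Dart) (k : ℕ), D.step^[k] y = f x ∧ ∀ j < k, D.step^[j] y ∈ S := by
  classical
  have := D.finite_dart
  suffices h : ∃ k : ℕ, D.step^[k] y ∉ S by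
    obtain ⟨x, hx⟩ := hf.exists_eq (Nat.find_spec h)
    exact ⟨x, Nat.find h, hx.symm, fun j hj => not_not.1 (Nat.find_min h hj)⟩
  by_contra! hall
  let s : Equiv.Perm D.Dart := D.edge * D.rot * D.rot
  have hs : ∀ b, s b = D.step b := fun b => rfl
  have hs' : ∀ b, s⁻¹ (D.edge b) = D.opp b := by
    intro b; rw [Equiv.Perm.inv_eq_iff_eq, hs, step_opp]
  have hconj : D.edge * s * D.edge⁻¹ = s⁻¹ := by
    ext b
    rw [eq_comm, Equiv.Perm.inv_eq_iff_eq]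
    simp [s]
  -- a strand that stays inside `S` in one direction does so in the other one
  let U : D.Dart → Prop := fun a => ∀ b, s.SameCycle a b → b ∈ S
  have hU : ∀ a, U a → U (D.edge a) := by
    intro a ha b hb
    have h1 : s.SameCycle a (D.edge b) := by
      rw [← Equiv.Perm.sameCycle_inv, ← hconj, Equiv.Perm.sameCycle_conj]
      have : ∀ b, D.edge⁻¹ b = D.edge b := fun b => by
        rw [Equiv.Perm.inv_eq_iff_eq, edge_edge_apply]
      rwa [this, this, edge_edge_apply]
    rw [← hf.opp_mem, ← hs']
    exact ha _ ((Equiv.Perm.sameCycle_symm_apply_right (f := s)).2 h1)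
  have hU' : ∀ a, U (D.edge a) = U a := fun a =>
    propext ⟨fun h => by simpa using hU _ h, hU a⟩
  have hopp : ∀ a, U (D.rot (D.rot a)) = U a := by
    intro a
    rw [← hU' a]
    have : D.edge a = s (D.opp a) := by rw [hs, step_opp]
    simp only [U, this, Equiv.Perm.sameCycle_apply_left]
    rfl
  have hy : U y := by
    intro b hb
    obtain ⟨k, -, rfl⟩ := hb.exists_pow_eq'
    rw [← Equiv.Perm.iterate_eq_pow]
    exact hall k
  rw [eq_of_strand_invariant hU' hopp y (f x₀)] at hy
  exact hf.notMem x₀ (hy _ (Equiv.Perm.SameCycle.refl _ _))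

/-- A function on the semiarcs of `D'` extends to `D`, constant along the strands in `S`: a dart of
`D` gets the value at the exit of its strand from `S`. -/
theorem IsErasure.exists_extension (hf : IsErasure S f) {A : Type*} [Nonempty A]
    {c' : D'.Dart → A} (hc' : ∀ x, c' (D'.edge x) = c' x) :
    ∃ c : D.Dart → A, (∀ y, c (D.edge y) = c y) ∧ (∀ y ∈ S, c (D.opp y) = c y) ∧
      ∀ x, c (f x) = c' x := by
  rcases isEmpty_or_nonempty D'.Dart with hD' | ⟨⟨x₀⟩⟩
  · exact ⟨fun _ => Classical.arbitrary A, fun _ => rfl, fun _ _ => rfl, fun x => hD'.elim x⟩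
  let Exit : D.Dart → D'.Dart → Prop := fun y x =>
    ∃ k : ℕ, D.step^[k] y = f x ∧ ∀ j < k, D.step^[j] y ∈ S
  have huniq : ∀ y x x', Exit y x → Exit y x' → x = x' := by
    rintro y x x' ⟨k, hk, hS⟩ ⟨k', hk', hS'⟩
    rcases lt_trichotomy k k' with h | rfl | h
    · exact absurd (hk ▸ hS' k h) (hf.notMem x)
    · exact hf.inj (hk.symm.trans hk')
    · exact absurd (hk' ▸ hS k' h) (hf.notMem x')
  have hself : ∀ x, Exit (f x) x := fun x => ⟨0, rfl, fun j hj => absurd hj (Nat.not_lt_zero j)⟩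
  have hstep : ∀ y ∈ S, ∀ x, Exit (D.step y) x → Exit y x := by
    rintro y hy x ⟨k, hk, hS⟩
    refine ⟨k + 1, hk, fun j hj => ?_⟩
    cases j with
    | zero => exact hy
    | succ j => exact hS j (by omega)
  choose ex hex using hf.exists_exit x₀
  have hedge : ∀ k : ℕ, ∀ y x, D.step^[k] y = f x → (∀ j < k, D.step^[j] y ∈ S) →
      Exit (D.edge y) (D'.edge x) := by
    intro k
    induction k with
    | zero =>
      intro y x hy _
      have hy : y = f x := hy
      obtain ⟨k, hk, hS⟩ := hf.map_edge x
      exact hy ▸ ⟨k, hk.symm, hS⟩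
    | succ k ih =>
      intro y x hy hS
      have h1 := ih (D.step y) x hy fun j hj => hS (j + 1) (by omega)
      have h2 : D.edge (D.step y) = D.opp y := by simp [step]
      have h3 : D.opp y ∈ S := (hf.opp_mem y).2 (hS 0 (by omega))
      have h4 := hex (D.edge y)
      have h5 := hstep _ h3 (ex (D.edge y)) (by rw [step_opp]; exact h4)
      rw [h2] at h1
      rw [huniq _ _ _ h1 h5]
      exact h4
  have hexedge : ∀ y, ex (D.edge y) = D'.edge (ex y) := by
    intro y
    obtain ⟨k, hk, hS⟩ := hex y
    exact huniq _ _ _ (hex _) (hedge k y _ hk hS)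
  refine ⟨fun y => c' (ex y), fun y => ?_, fun y hy => ?_, fun x => ?_⟩
  · show c' (ex (D.edge y)) = c' (ex y)
    rw [hexedge, hc']
  · have h := hstep _ ((hf.opp_mem y).2 hy) _ (hex (D.step (D.opp y)))
    show c' (ex (D.opp y)) = c' (ex y)
    rw [huniq _ _ _ (hex _) h, step_opp, hexedge, hc']
  · show c' (ex (f x)) = c' x
    rw [huniq _ _ _ (hex _) (hself x)]

open Classical in
/-- Erasing crossings gives a correspondence of colorings if colorings restrict and Fox colorings
extend, and the erased crossings do not contribute to the pairing. -/
theorem IsErasure.corresponds (hf : IsErasure S f) [Fact p.Prime]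
    (hres : ∀ C : D.Dart → ZMod p, IsCornerColoring C → IsCornerColoring fun x => C (f x))
    (hsum : ∀ C y : D.Dart → ZMod p, IsCornerColoring C → IsCornerColoring y →
      (∑ a, if a ∈ S then pairTerm (lift C) y a else 0) = 0)
    (hext : ∀ c' : D'.Dart → ZMod p, IsFoxColoring c' →
      ∃ c, IsFoxColoring c ∧ ∀ x, c (f x) = c' x)
    (hnon : ∀ C : D.Dart → ZMod p, IsCornerColoring C → NontrivialCorners C →
      NontrivialCorners fun x => C (f x)) :
    Corresponds p D D' := by
  have hfox : ∀ (C : D.Dart → ZMod p) x, fox (fun x => C (f x)) x = fox C (f x) := by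
    intro C x; simp only [fox, hf.map_rot]
  refine ⟨fun C C' => (fox fun x => C (f x)) = fox C', fun C hC => ⟨_, hres C hC, rfl⟩, ?_, ?_, ?_⟩
  · intro C' hC'
    obtain ⟨c, hc, hcf⟩ := hext _ hC'.isFoxColoring
    obtain ⟨C, hC, rfl⟩ := hc.exists_corner_coloring
    exact ⟨C, hC, funext fun x => (hfox C x).trans (hcf x)⟩
  · intro C C' hC hC' hT
    have h1 : NontrivialCorners C' ↔ NontrivialCorners fun x => C (f x) := by
      rw [nontrivialCorners_iff_fox, nontrivialCorners_iff_fox, hT]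
    rw [h1]
    refine ⟨hnon C hC, ?_⟩
    rintro ⟨x, hx, h⟩
    exact ⟨f x, by rw [← hf.isOver_eq, hx], by simpa only [hf.map_rot] using h⟩
  · intro C C' y y' hC hC' hy hy' hT hU
    rw [← pairing_congr_fox (hres C hC) hC' (hres y hy) hy' hT hU]
    have h1 : ∀ x, pairTerm (lift fun x => C (f x)) (fun x => y (f x)) x =
        pairTerm (lift C) y (f x) := by
      intro x
      simp only [pairTerm, cross, lift, hf.map_rot, hf.isOver_eq]
    have h2 : ∑ x, pairTerm (lift C) y (f x) =
        ∑ a, if a ∈ S then 0 else pairTerm (lift C) y a := by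
      rw [← Finset.sum_image (s := Finset.univ) (g := f) (f := fun a => pairTerm (lift C) y a)
        fun a _ b _ h => hf.inj h, Finset.sum_ite, Finset.sum_const_zero, zero_add]
      refine Finset.sum_congr ?_ fun _ _ => rfl
      ext a
      have : a ∈ Set.range f ↔ a ∈ Sᶜ := by rw [hf.range_eq]
      simpa using this
    have h3 : ∑ a, pairTerm (lift C) y a = (∑ a, if a ∈ S then 0 else pairTerm (lift C) y a) +
        ∑ a, if a ∈ S then pairTerm (lift C) y a else 0 := by
      rw [← Finset.sum_add_distrib]
      exact Finset.sum_congr rfl fun a _ => by by_cases h : a ∈ S <;> simp [h]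
    unfold pairing liftPairing
    rw [Finset.sum_congr rfl fun x _ => h1 x, h2, h3, hsum C y hC hy, add_zero]

end Erasing

end KnotDiagram

namespace KnotDiagram

/-! ### The first and second Reidemeister moves -/

section FirstSecond

variable {D D' : KnotDiagram} {p : ℕ}

theorem rot_sameCycle_iff (a x : D.Dart) : D.rot.SameCycle a (D.rot x) ↔ D.rot.SameCycle a x :=
  Equiv.Perm.sameCycle_apply_right

theorem Erases.exists_isErasure {S : Set D.Dart} (h : Erases D D' S)
    (hS : ∀ x, D.rot x ∈ S ↔ x ∈ S) : ∃ f : D'.Dart → D.Dart, IsErasure S f := by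
  obtain ⟨f, h1, h2, h3, h4, h5⟩ := h
  exact ⟨f, hS, h1, h2, h3, h4, h5⟩

theorem IsErasure.isFoxColoring {S : Set D.Dart} {f : D'.Dart → D.Dart} (hf : IsErasure S f)
    {c' : D'.Dart → ZMod p} (hc' : IsFoxColoring c') {c : D.Dart → ZMod p}
    (hc : ∀ x, c (f x) = c' x) (hedge : ∀ y, c (D.edge y) = c y)
    (hover : ∀ y ∈ S, D.isOver y = true → c (D.rot (D.rot y)) = c y)
    (hunder : ∀ y ∈ S, D.isOver y = false →
      c y + c (D.rot (D.rot y)) = c (D.rot y) + c (D.rot (D.rot (D.rot y)))) :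
    IsFoxColoring c where
  edge := hedge
  of_over y hy := by
    by_cases hS : y ∈ S
    · exact hover y hS hy
    · obtain ⟨x, rfl⟩ := hf.exists_eq hS
      rw [← hf.map_rot, ← hf.map_rot, hc, hc]
      exact hc'.of_over x (by rw [hf.isOver_eq, hy])
  of_under y hy := by
    by_cases hS : y ∈ S
    · exact hunder y hS hy
    · obtain ⟨x, rfl⟩ := hf.exists_eq hS
      rw [← hf.map_rot, ← hf.map_rot, ← hf.map_rot, hc, hc, hc, hc]
      exact hc'.of_under x (by rw [hf.isOver_eq, hy])

/-- The corners `rot a` and `rot³ a` at the loop lie in the same region, so that each coloring is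
trivial at the erased crossing. -/
theorem R1.corresponds [Fact p.Prime] (h : R1 D D') : Corresponds p D D' := by
  classical
  obtain ⟨a, ha, hE⟩ := h
  obtain ⟨f, hf⟩ := hE.exists_isErasure fun x => rot_sameCycle_iff a x
  have e1 : D.edge a = D.rot a := by rw [← rot_face, ha]
  have e2 : D.edge (D.rot a) = a := by rw [← e1, edge_edge_apply]
  have hmem : ∀ x, x ∈ D.crossing a ↔ x = a ∨ x = D.rot a ∨ x = D.rot (D.rot a) ∨
      x = D.rot (D.rot (D.rot a)) := fun x => sameCycle_rot_iff
  have h13 : ∀ {C : D.Dart → ZMod p}, IsCornerColoring C →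
      C (D.rot a) = C (D.rot (D.rot (D.rot a))) := by
    intro C hC
    rw [← hC.face.edge, e1]
  have h02 : ∀ {C : D.Dart → ZMod p}, IsCornerColoring C → C a = C (D.rot (D.rot a)) := by
    intro C hC
    cases h : D.isOver a
    · have := hC.sub_eq h
      rw [h13 hC, sub_self] at this
      exact sub_eq_zero.1 this
    · have := hC.sub_eq (a := D.rot a) (by rw [isOver_rot_apply, h]; rfl)
      rw [h13 hC, sub_self] at this
      simpa using (sub_eq_zero.1 this.symm)
  refine hf.corresponds ?_ ?_ ?_ ?_
  · intro C hC
    refine hf.restrict (O := {D.rot (D.rot a), D.rot (D.rot (D.rot a))}) ?_ hC ?_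
    · intro y hy hy'
      rcases (hmem y).1 hy with rfl | rfl | rfl | rfl
      · exact absurd ((hmem _).2 (by simp [e1])) hy'
      · exact absurd ((hmem _).2 (by simp [e2])) hy'
      · simp
      · simp
    · have hO : ∀ y, D.edge y ≠ a → D.edge y ≠ D.rot a → D.edge y ∈ D.crossing a →
          D.edge y ∈ ({D.rot (D.rot a), D.rot (D.rot (D.rot a))} : Set D.Dart) := by
        intro y h1 h2 h
        rcases (hmem _).1 h with h | h | h | h
        · exact absurd h h1
        · exact absurd h h2
        · simp [h]
        · simp [h]
      rintro y (rfl | rfl)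
      · simp only [step, opp, rot_rot_rot_rot, e1, hC.face.rot_edge]
        refine ⟨(hmem _).2 (by simp), hO _ ?_ ?_, (h13 hC).symm⟩
        · intro h
          exact D.rot_two_ne (D.rot a) (by rw [← edge_edge_apply (D.rot (D.rot (D.rot a))), h, e1])
        · intro h
          exact rot_three_ne a (by rw [← edge_edge_apply (D.rot (D.rot (D.rot a))), h, e2])
      · simp only [step, opp, rot_rot_rot_rot, e2, hC.face.rot_edge]
        refine ⟨(hmem _).2 (by simp), hO _ ?_ ?_, trivial⟩
        · intro h
          exact rot_ne (D.rot a) (by rw [← edge_edge_apply (D.rot (D.rot a)), h, e1])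
        · intro h
          exact D.rot_two_ne a (by rw [← edge_edge_apply (D.rot (D.rot a)), h, e2])
  · intro C y hC hy
    refine Finset.sum_eq_zero fun x _ => ?_
    split_ifs with h
    · have : y x = y (D.rot (D.rot x)) := by
        rcases (hmem x).1 h with rfl | rfl | rfl | rfl
        · exact h02 hy
        · exact h13 hy
        · simpa using (h02 hy).symm
        · simpa using (h13 hy).symm
      simp [pairTerm, ← this]
    · rfl
  · intro c' hc'
    obtain ⟨c, h1, h2, h3⟩ := hf.exists_extension hc'.edge
    have hra : c (D.rot a) = c a := by rw [← e1, h1]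
    have hr2 : c (D.rot (D.rot a)) = c a := h2 a ((hmem _).2 (by simp))
    have hr3 : c (D.rot (D.rot (D.rot a))) = c a :=
      (h2 (D.rot a) ((hmem _).2 (by simp))).trans hra
    refine ⟨c, hf.isFoxColoring hc' h3 h1 (fun y hy _ => h2 y hy) ?_, h3⟩
    intro y hy _
    rcases (hmem y).1 hy with rfl | rfl | rfl | rfl <;> simp [hra, hr2, hr3]
  · rintro C hC ⟨x, hx, hne⟩
    by_cases h : x ∈ D.crossing a
    · refine absurd ?_ hne
      rcases (hmem x).1 h with rfl | rfl | rfl | rfl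
      · exact h13 hC
      · simpa using (h02 hC).symm
      · simpa using (h13 hC).symm
      · simpa using h02 hC
    · obtain ⟨x, rfl⟩ := hf.exists_eq h
      exact ⟨x, by rw [hf.isOver_eq, hx], by simpa only [hf.map_rot] using hne⟩

/-- The second Reidemeister move, when the semiarc of `a` is under at both crossings.  The quotients
of the crossing relations at the two crossings are opposite, so that the contributions to the pairing
cancel.  A Fox coloring of `D'` extends after the color of the under-side of the bigon is reflected
in the color of the over-strand. -/
theorem corresponds_of_bigon [Fact p.Prime] {a b : D.Dart} (hab : D.face a = b) (hba : D.face b = a)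
    (hb : b ∉ D.crossing a) (hua : D.isOver a = false) (hub : D.isOver b = true)
    (hE : Erases D D' (D.crossing a ∪ D.crossing b)) : Corresponds p D D' := by
  classical
  obtain ⟨f, hf⟩ := hE.exists_isErasure fun x =>
    or_congr (rot_sameCycle_iff a x) (rot_sameCycle_iff b x)
  have ea : D.edge a = D.rot b := by rw [← rot_face, hab]
  have eb : D.edge b = D.rot a := by rw [← rot_face, hba]
  have era : D.edge (D.rot a) = b := by rw [← eb, edge_edge_apply]
  have erb : D.edge (D.rot b) = a := by rw [← ea, edge_edge_apply]
  have hmema : ∀ x, x ∈ D.crossing a ↔ x = a ∨ x = D.rot a ∨ x = D.rot (D.rot a) ∨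
      x = D.rot (D.rot (D.rot a)) := fun x => sameCycle_rot_iff
  have hmemb : ∀ x, x ∈ D.crossing b ↔ x = b ∨ x = D.rot b ∨ x = D.rot (D.rot b) ∨
      x = D.rot (D.rot (D.rot b)) := fun x => sameCycle_rot_iff
  have hmem : ∀ x, x ∈ D.crossing a ∪ D.crossing b ↔ (x = a ∨ x = D.rot a ∨ x = D.rot (D.rot a) ∨
      x = D.rot (D.rot (D.rot a))) ∨ (x = b ∨ x = D.rot b ∨ x = D.rot (D.rot b) ∨
      x = D.rot (D.rot (D.rot b))) := fun x => or_congr (hmema x) (hmemb x)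
  have hdis : ∀ x ∈ D.crossing a, x ∉ D.crossing b := by
    intro x h1 h2
    exact hb (Equiv.Perm.SameCycle.trans (show D.rot.SameCycle a x from h1)
      (show D.rot.SameCycle b x from h2).symm)
  have hne : ∀ x y, x ∈ D.crossing a → y ∈ D.crossing b → x ≠ y := by
    rintro x _ h1 h2 rfl
    exact hdis x h1 h2
  have hura : D.isOver (D.rot a) = true := by rw [isOver_rot_apply, hua]; rfl
  have hurb : D.isOver (D.rot b) = false := by rw [isOver_rot_apply, hub]; rfl
  have h1 : ∀ {A : Type} {C : D.Dart → A}, FaceInvariant C →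
      C b = C a ∧ C (D.rot b) = C (D.rot (D.rot (D.rot a))) ∧
        C (D.rot (D.rot (D.rot b))) = C (D.rot a) := by
    intro A C hC
    exact ⟨by rw [← hC a, hab], by rw [← hC.edge, ea], by rw [← hC.edge, eb]⟩
  have h2 : ∀ {C : D.Dart → ZMod p}, IsCornerColoring C →
      C (D.rot (D.rot b)) = C (D.rot (D.rot a)) := by
    intro C hC
    obtain ⟨e1, e2, e3⟩ := h1 hC.face
    have h3 := hC.sub_eq hua
    have h4 := hC.sub_eq hurb
    simp only [rot_rot_rot_rot, e1, e2, e3] at h4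
    linear_combination h3 + h4
  have hfoxS : ∀ {c : D.Dart → ZMod p}, IsFoxColoring c →
      c a + c (D.rot (D.rot a)) = c b + c b ∧ c a + c (D.rot (D.rot (D.rot b))) = c b + c b := by
    intro c hc
    have h3 := hc.of_under a hua
    have h4 := hc.of_over _ hura
    have h5 := hc.of_under _ hurb
    have h6 := hc.of_over _ hub
    have h7 := hc.edge a
    have h8 := hc.edge b
    rw [ea] at h7
    rw [eb] at h8
    simp only [rot_rot_rot_rot] at h3 h4 h5 h6
    exact ⟨by rw [h3, h4, h8], by rw [← h7, h5, h6]⟩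
  -- the functions on the semiarcs stay such after a change of the color of the under-side
  have hrec : ∀ (c : D.Dart → ZMod p) (k : ZMod p), (∀ y, c (D.edge y) = c y) →
      ∀ y, (fun y => if y = a ∨ y = D.rot b then k else c y) (D.edge y) =
        (fun y => if y = a ∨ y = D.rot b then k else c y) y := by
    intro c k hc y
    have : (D.edge y = a ∨ D.edge y = D.rot b) ↔ (y = a ∨ y = D.rot b) := by
      constructor
      · rintro (h | h)
        · right; rw [← edge_edge_apply y, h, ea]
        · left; rw [← edge_edge_apply y, h, erb]
      · rintro (rfl | rfl)
        · right; exact ea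
        · left; exact erb
    simp only [this, hc]
  have hinS : ∀ x, x = a ∨ x = D.rot b → x ∈ D.crossing a ∪ D.crossing b := by
    intro x h
    rw [hmem]
    tauto
  have hna : ∀ x, x ∈ D.crossing a → x ≠ D.rot b := fun x hx =>
    hne _ _ hx ((hmemb _).2 (by simp))
  have hnb : ∀ x, x ∈ D.crossing b → x ≠ a := fun x hx =>
    (hne _ _ ((hmema _).2 (by simp)) hx).symm
  have n1 : ¬ (D.rot a = a ∨ D.rot a = D.rot b) := by
    rintro (h | h)
    · exact rot_ne a h
    · exact hna _ ((hmema _).2 (by simp)) h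
  have n2 : ¬ (D.rot (D.rot a) = a ∨ D.rot (D.rot a) = D.rot b) := by
    rintro (h | h)
    · exact D.rot_two_ne a h
    · exact hna _ ((hmema _).2 (by simp)) h
  have n3 : ¬ (D.rot (D.rot (D.rot a)) = a ∨ D.rot (D.rot (D.rot a)) = D.rot b) := by
    rintro (h | h)
    · exact rot_three_ne a h
    · exact hna _ ((hmema _).2 (by simp)) h
  have n4 : ¬ (b = a ∨ b = D.rot b) := by
    rintro (h | h)
    · exact hnb _ ((hmemb _).2 (by simp)) h
    · exact rot_ne b h.symm
  have n5 : ¬ (D.rot (D.rot b) = a ∨ D.rot (D.rot b) = D.rot b) := by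
    rintro (h | h)
    · exact hnb _ ((hmemb _).2 (by simp)) h
    · exact rot_ne _ h
  have n6 : ¬ (D.rot (D.rot (D.rot b)) = a ∨ D.rot (D.rot (D.rot b)) = D.rot b) := by
    rintro (h | h)
    · exact hnb _ ((hmemb _).2 (by simp)) h
    · exact D.rot_two_ne _ h
  refine hf.corresponds ?_ ?_ ?_ ?_
  · intro C hC
    obtain ⟨e1, e2, e3⟩ := h1 hC.face
    refine hf.restrict (O := {y | y = D.rot (D.rot a) ∨ y = D.rot (D.rot (D.rot a)) ∨
      y = D.rot (D.rot b) ∨ y = D.rot (D.rot (D.rot b))}) ?_ hC ?_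
    · intro y hy hy'
      rw [hmem] at hy hy'
      rcases hy with (rfl | rfl | rfl | rfl) | (rfl | rfl | rfl | rfl) <;>
        simp [ea, eb, era, erb] at hy' ⊢
    · have hO : ∀ y, y ≠ D.rot b → y ≠ b → y ≠ D.rot a → y ≠ a →
          D.edge y ∈ D.crossing a ∪ D.crossing b →
          D.edge y ∈ {y | y = D.rot (D.rot a) ∨ y = D.rot (D.rot (D.rot a)) ∨
            y = D.rot (D.rot b) ∨ y = D.rot (D.rot (D.rot b))} := by
        intro y h1 h2 h3 h4 h
        have h5 := edge_edge_apply y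
        rw [hmem] at h
        rcases h with (h | h | h | h) | (h | h | h | h)
        · exact absurd (by rw [← h5, h, ea]) h1
        · exact absurd (by rw [← h5, h, era]) h2
        · simp [h]
        · simp [h]
        · exact absurd (by rw [← h5, h, eb]) h3
        · exact absurd (by rw [← h5, h, erb]) h4
        · simp [h]
        · simp [h]
      have ma : ∀ x, x ∈ D.crossing a → x ≠ b := fun x hx => hne _ _ hx ((hmemb _).2 (by simp))
      have mb : ∀ x, x ∈ D.crossing b → x ≠ D.rot a := fun x hx =>
        (hne _ _ ((hmema _).2 (by simp)) hx).symm
      have i2 : D.rot (D.rot a) ∈ D.crossing a := (hmema _).2 (by simp)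
      have i3 : D.rot (D.rot (D.rot a)) ∈ D.crossing a := (hmema _).2 (by simp)
      have j2 : D.rot (D.rot b) ∈ D.crossing b := (hmemb _).2 (by simp)
      have j3 : D.rot (D.rot (D.rot b)) ∈ D.crossing b := (hmemb _).2 (by simp)
      rintro y (rfl | rfl | rfl | rfl)
      · simp only [step, opp, rot_rot_rot_rot, ea, hC.face.rot_edge]
        exact ⟨(hmem _).2 (by simp), hO _ (D.rot_two_ne _) (rot_three_ne b) (mb _ j3) (hnb _ j3),
          e3⟩
      · simp only [step, opp, rot_rot_rot_rot, era, hC.face.rot_edge]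
        exact ⟨(hmem _).2 (by simp), hO _ (rot_ne _) (D.rot_two_ne _) (mb _ j2) (hnb _ j2), h2 hC⟩
      · simp only [step, opp, rot_rot_rot_rot, eb, hC.face.rot_edge]
        exact ⟨(hmem _).2 (by simp), hO _ (hna _ i3) (ma _ i3) (D.rot_two_ne _) (rot_three_ne a),
          e2.symm⟩
      · simp only [step, opp, rot_rot_rot_rot, erb, hC.face.rot_edge]
        exact ⟨(hmem _).2 (by simp), hO _ (hna _ i2) (ma _ i2) (rot_ne _) (D.rot_two_ne _),
          (h2 hC).symm⟩
  · intro C y hC hy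
    have hsplit : ∀ h : D.Dart → ZMod p, (∑ x, if x ∈ D.crossing a ∪ D.crossing b then h x else 0) =
        (∑ x, if D.rot.SameCycle a x then h x else 0) +
          ∑ x, if D.rot.SameCycle b x then h x else 0 := by
      intro h
      rw [← Finset.sum_add_distrib]
      refine Finset.sum_congr rfl fun x _ => ?_
      have := hdis x
      by_cases h1 : x ∈ D.crossing a
      · have h2 := this h1
        have h1' : D.rot.SameCycle a x := h1
        have h2' : ¬ D.rot.SameCycle b x := h2
        simp [h1, h1', h2']
      · have h1' : ¬ D.rot.SameCycle a x := h1
        by_cases h2 : x ∈ D.crossing b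
        · have h2' : D.rot.SameCycle b x := h2
          simp [h2, h2', h1']
        · have h2' : ¬ D.rot.SameCycle b x := h2
          simp [h1, h2, h1', h2']
    refine Eq.trans (Eq.trans (Finset.sum_congr rfl fun x _ => by congr) (hsplit _)) ?_
    rw [sum_rot_orbit, sum_rot_orbit]
    obtain ⟨e1, e2, e3⟩ := h1 hC.face.lift
    obtain ⟨u1, u2, u3⟩ := h1 hy.face
    have e4 : lift C (D.rot (D.rot b)) = lift C (D.rot (D.rot a)) := by simp only [lift, h2 hC]
    have hd := dvd_cross hC (intCast_lift C) hua (p := p)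
    have c1 : cross (lift C) (D.rot (D.rot a)) = -cross (lift C) a := by
      simp only [cross, rot_rot_rot_rot]; ring
    have c2 : cross (lift C) (D.rot b) = -cross (lift C) a := by
      simp only [cross, rot_rot_rot_rot, e1, e2, e3, e4]; ring
    have c3 : cross (lift C) (D.rot (D.rot (D.rot b))) = cross (lift C) a := by
      simp only [cross, rot_rot_rot_rot, e1, e2, e3, e4]; ring
    have hs := hy.sub_eq hua
    simp only [pairTerm, isOver_rot_apply, hua, hub, rot_rot_rot_rot, c1, c2, c3, u2, u3,
      Int.neg_ediv_of_dvd hd]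
    simp only [Bool.not_false, Bool.not_true, Bool.false_eq_true, if_false, if_true]
    push_cast
    linear_combination (2 * ((cross (lift C) a / p : ℤ) : ZMod p)) * hs
  · intro c' hc'
    obtain ⟨c, k1, k2, k3⟩ := hf.exists_extension hc'.edge
    have o1 : c (D.rot (D.rot a)) = c a := k2 a ((hmem _).2 (by simp))
    have o2 : c (D.rot (D.rot (D.rot a))) = c (D.rot a) := k2 (D.rot a) ((hmem _).2 (by simp))
    have o3 : c (D.rot (D.rot b)) = c b := k2 b ((hmem _).2 (by simp))
    have o4 : c (D.rot (D.rot (D.rot b))) = c (D.rot b) := k2 (D.rot b) ((hmem _).2 (by simp))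
    have o5 : c (D.rot a) = c b := by rw [← eb, k1]
    have o6 : c (D.rot b) = c a := by rw [← ea, k1]
    refine ⟨fun y => if y = a ∨ y = D.rot b then 2 * c b - c a else c y,
      hf.isFoxColoring hc' ?_ (hrec c _ k1) ?_ ?_, ?_⟩
    · intro x
      rw [if_neg fun h => hf.notMem x (hinS _ h), k3]
    · intro y hy hyo
      rcases (hmem y).1 hy with (rfl | rfl | rfl | rfl) | (rfl | rfl | rfl | rfl) <;>
        simp [isOver_rot_apply, hua, hub] at hyo
      · rw [if_neg n1, if_neg n3, o2]
      · simp only [rot_rot_rot_rot]; rw [if_neg n1, if_neg n3, o2]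
      · rw [if_neg n4, if_neg n5, o3]
      · simp only [rot_rot_rot_rot]; rw [if_neg n4, if_neg n5, o3]
    · intro y hy hyo
      rcases (hmem y).1 hy with (rfl | rfl | rfl | rfl) | (rfl | rfl | rfl | rfl) <;>
        simp [isOver_rot_apply, hua, hub] at hyo <;>
        simp only [rot_rot_rot_rot, n1, n2, n3, n4, n5, n6, true_or, or_true, if_true, if_false,
          o1, o2, o3, o4, o5, o6] <;> ring
    · intro x
      show (if _ then _ else _) = _
      rw [if_neg fun h => hf.notMem x (hinS _ h), k3]
  · intro C hC hnt
    -- otherwise the Fox coloring, changed on the under-side of the bigon, is constant along the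
    -- only component, so that the colors of both strands of the bigon agree
    by_contra htriv
    have hc := hC.isFoxColoring
    rw [nontrivialCorners_iff_fox] at hnt
    obtain ⟨z, hz, hzne⟩ := hnt
    have htr : ∀ y, y ∉ D.crossing a ∪ D.crossing b → D.isOver y = false →
        fox C y = fox C (D.rot y) := by
      intro y hy hyu
      obtain ⟨x, rfl⟩ := hf.exists_eq hy
      by_contra hne
      refine htriv ((nontrivialCorners_iff_fox _).2 ⟨x, by rw [hf.isOver_eq, hyu], ?_⟩)
      simpa only [fox, hf.map_rot] using hne
    set c := fox C
    obtain ⟨q1, q2⟩ := hfoxS hc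
    have hconst := eq_of_strand_invariant (D := D)
      (c := fun y => if y = a ∨ y = D.rot b then c (D.rot (D.rot a)) else c y)
      (hrec c _ hc.edge) (by
        intro y
        by_cases hy : y ∈ D.crossing a ∪ D.crossing b
        · have o1 := hc.of_over _ hura
          have o2 := hc.of_over _ hub
          have o3 : c (D.rot (D.rot (D.rot b))) = c (D.rot (D.rot a)) := by
            linear_combination q2 - q1
          rcases (hmem y).1 hy with (rfl | rfl | rfl | rfl) | (rfl | rfl | rfl | rfl) <;>
            simp only [rot_rot_rot_rot, n1, n2, n3, n4, n5, n6, true_or, or_true, if_true,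
              if_false, o1, o2, o3]
        · have hy2 : D.rot (D.rot y) ∉ D.crossing a ∪ D.crossing b := by
            rwa [hf.rot_mem, hf.rot_mem]
          rw [if_neg fun h => hy2 (hinS _ h), if_neg fun h => hy (hinS _ h)]
          cases hyo : D.isOver y
          · have r1 := htr y hy hyo
            have r2 := htr _ hy2 (by simp [isOver_rot_apply, hyo])
            have r3 := hc.of_over (D.rot y) (by simp [isOver_rot_apply, hyo])
            rw [r2, r3, r1]
          · exact hc.of_over _ hyo)
    have r1 : c (D.rot (D.rot a)) = c b := by
      have := hconst a b
      simpa only [true_or, n4, if_true, if_false] using this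
    have r2 : c a = c b := by linear_combination q1 - r1
    have hall : ∀ y, c y = c b := by
      intro y
      have := hconst y b
      by_cases hy : y = a ∨ y = D.rot b
      · rcases hy with rfl | rfl
        · exact r2
        · rw [← ea, hc.edge, r2]
      · simpa only [if_neg hy, if_neg n4] using this
    exact hzne (by rw [hall, hall (D.rot z)])

theorem R2.corresponds [Fact p.Prime] (h : R2 D D') : Corresponds p D D' := by
  obtain ⟨a, b, hab, hba, hb, ho, hE⟩ := h
  have ea : D.edge a = D.rot b := by rw [← rot_face, hab]
  rw [ea, isOver_rot_apply] at ho
  cases ha : D.isOver a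
  · exact corresponds_of_bigon hab hba hb ha (by simpa [ha] using ho) hE
  · refine corresponds_of_bigon hba hab (fun h => hb ?_) (by simpa [ha] using ho) ha
      (by rwa [Set.union_comm])
    exact (show D.rot.SameCycle b a from h).symm

end FirstSecond

end KnotDiagram

namespace KnotDiagram

/-! ### The third Reidemeister move -/

section Third

variable {D D' : KnotDiagram} {p : ℕ}

/-- The data of a third Reidemeister move; the strands are numbered in such a way that the corner
`a 2` is the one that differs from the other two in the position of the over-strand. -/
structure IsTriangleMove (a : ZMod 3 → D.Dart) (f g : D.Dart ≃ D'.Dart) : Prop where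
  face_eq : ∀ i, D.face (a i) = a (i + 1)
  notMem : ∀ i, a (i + 1) ∉ D.crossing (a i)
  isOver_one : D.isOver (a 1) = D.isOver (a 0)
  isOver_two : D.isOver (a 2) = !D.isOver (a 0)
  map_rot : ∀ x, f (D.rot x) = D'.rot (f x)
  map_isOver : ∀ x, D'.isOver (f x) = D.isOver x
  map_edge : ∀ x, g (D.edge x) = D'.edge (g x)
  outside : ∀ x, (∀ i, x ∉ D.crossing (a i)) → g x = f x
  inside : ∀ i, ∀ u, u = a i ∨ u = D.edge (a i) →
    g u = f (D.opp (D.edge u)) ∧ g (D.opp u) = f (D.edge u)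

theorem R3.exists_isTriangleMove (h : R3 D D') :
    ∃ (a : ZMod 3 → D.Dart) (f g : D.Dart ≃ D'.Dart), IsTriangleMove a f g := by
  obtain ⟨a, h1, h2, h3, f, g, h4, h5, h6, h7, h8⟩ := h
  have key : ∀ k : ZMod 3, D.isOver (a (1 + k)) = D.isOver (a (0 + k)) →
      D.isOver (a (2 + k)) = (!D.isOver (a (0 + k))) →
      ∃ (a : ZMod 3 → D.Dart) (f g : D.Dart ≃ D'.Dart), IsTriangleMove a f g := by
    intro k e1 e2
    refine ⟨fun i => a (i + k), f, g, ⟨fun i => ?_, fun i => ?_, e1, e2, h4, h5, h6, ?_,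
      fun i => h8 (i + k)⟩⟩
    · rw [h1, add_right_comm]
    · rw [add_right_comm]; exact h2 (i + k)
    · intro x hx
      refine h7 x fun i => ?_
      have := hx (i - k)
      rwa [sub_add_cancel] at this
  have e : (2 : ZMod 3) + 1 = 0 ∧ (1 : ZMod 3) + 1 = 2 ∧ (2 : ZMod 3) + 2 = 1 ∧
    (1 : ZMod 3) + 2 = 0 := by decide
  have k0 := key 0
  have k1 := key 1
  have k2 := key 2
  simp only [e, add_zero, zero_add] at k0 k1 k2
  rcases h0 : D.isOver (a 0) <;> rcases hh1 : D.isOver (a 1) <;> rcases hh2 : D.isOver (a 2) <;>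
    simp only [h0, hh1, hh2, Bool.not_true, Bool.not_false, forall_const, Bool.true_eq_false,
      Bool.false_eq_true, false_imp_iff] at k0 k1 k2
  all_goals first
    | exact k0
    | exact k1
    | exact k2
    | exact absurd (fun i j => by
        have : ∀ i : ZMod 3, i = 0 ∨ i = 1 ∨ i = 2 := by decide
        rcases this i with rfl | rfl | rfl <;> rcases this j with rfl | rfl | rfl <;>
          simp only [h0, hh1, hh2]) h3

namespace IsTriangleMove

variable {a : ZMod 3 → D.Dart} {f g : D.Dart ≃ D'.Dart}

theorem edge_eq (h : IsTriangleMove a f g) (i : ZMod 3) : D.edge (a i) = D.rot (a (i + 1)) := by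
  rw [← rot_face, h.face_eq]

theorem edge_rot (h : IsTriangleMove a f g) (i : ZMod 3) : D.edge (D.rot (a (i + 1))) = a i := by
  rw [← h.edge_eq, edge_edge_apply]

theorem map_zero (h : IsTriangleMove a f g) (i : ZMod 3) :
    g (a i) = f (D.rot (D.rot (D.rot (a (i + 1))))) := by
  rw [(h.inside i (a i) (Or.inl rfl)).1, h.edge_eq]; rfl

theorem map_two (h : IsTriangleMove a f g) (i : ZMod 3) :
    g (D.rot (D.rot (a i))) = f (D.rot (a (i + 1))) := by
  rw [← h.edge_eq]; exact (h.inside i (a i) (Or.inl rfl)).2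

theorem map_one (h : IsTriangleMove a f g) (i : ZMod 3) :
    g (D.rot (a (i + 1))) = f (D.rot (D.rot (a i))) := by
  rw [← h.edge_eq, (h.inside i _ (Or.inr rfl)).1, edge_edge_apply]; rfl

theorem map_three (h : IsTriangleMove a f g) (i : ZMod 3) :
    g (D.rot (D.rot (D.rot (a (i + 1))))) = f (a i) := by
  rw [← h.edge_eq]
  have := (h.inside i _ (Or.inr rfl)).2
  rwa [edge_edge_apply] at this

theorem eq_of_sameCycle (h : IsTriangleMove a f g) {i j : ZMod 3}
    (hij : D.rot.SameCycle (a i) (a j)) : i = j := by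
  have : ∀ i j : ZMod 3, i = j ∨ j = i + 1 ∨ i = j + 1 := by decide
  rcases this i j with h1 | rfl | rfl
  · exact h1
  · exact absurd hij (h.notMem i)
  · exact absurd hij.symm (h.notMem j)

/-- The inner semiarcs of the triangle. -/
def Inner (a : ZMod 3 → D.Dart) (w : D.Dart) : Prop := ∃ i, w = a i ∨ w = D.rot (a i)

theorem not_inner_two (h : IsTriangleMove a f g) (i : ZMod 3) : ¬ Inner a (D.rot (D.rot (a i))) := by
  rintro ⟨j, hj | hj⟩
  · obtain rfl := h.eq_of_sameCycle (i := i) (j := j) (sameCycle_rot_iff.2 (by simp [hj]))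
    exact D.rot_two_ne _ hj
  · rw [D.rot.apply_eq_iff_eq] at hj
    obtain rfl := h.eq_of_sameCycle (i := i) (j := j) (sameCycle_rot_iff.2 (by simp [hj]))
    exact rot_ne _ hj

theorem not_inner_three (h : IsTriangleMove a f g) (i : ZMod 3) :
    ¬ Inner a (D.rot (D.rot (D.rot (a i)))) := by
  rintro ⟨j, hj | hj⟩
  · obtain rfl := h.eq_of_sameCycle (i := i) (j := j) (sameCycle_rot_iff.2 (by simp [hj]))
    exact rot_three_ne _ hj
  · rw [D.rot.apply_eq_iff_eq] at hj
    obtain rfl := h.eq_of_sameCycle (i := i) (j := j) (sameCycle_rot_iff.2 (by simp [hj]))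
    exact D.rot_two_ne _ hj

theorem not_inner_of_outside {w : D.Dart} (hw : ∀ i, w ∉ D.crossing (a i)) : ¬ Inner a w := by
  rintro ⟨j, rfl | rfl⟩
  · exact hw j (sameCycle_rot_iff.2 (by simp))
  · exact hw j (sameCycle_rot_iff.2 (by simp))

theorem inner_edge (h : IsTriangleMove a f g) {w : D.Dart} (hw : Inner a w) :
    Inner a (D.edge w) := by
  obtain ⟨i, rfl | rfl⟩ := hw
  · exact ⟨i + 1, Or.inr (h.edge_eq i)⟩
  · refine ⟨i - 1, Or.inl ?_⟩
    have := h.edge_rot (i - 1)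
    rwa [sub_add_cancel] at this

theorem symm (h : IsTriangleMove a f g) :
    IsTriangleMove (D := D') (D' := D) (fun i => f (D.rot (D.rot (a i)))) f.symm g.symm := by
  have hrot : ∀ x, f.symm (D'.rot x) = D.rot (f.symm x) := by
    intro x; rw [Equiv.symm_apply_eq, h.map_rot, Equiv.apply_symm_apply]
  have hcyc : ∀ x y, D'.rot.SameCycle (f x) (f y) ↔ D.rot.SameCycle x y := by
    intro x y
    simp only [sameCycle_rot_iff, ← h.map_rot, f.apply_eq_iff_eq]
  have hcyc2 : ∀ x y, D.rot.SameCycle (D.rot (D.rot x)) y ↔ D.rot.SameCycle x y := by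
    intro x y
    rw [Equiv.Perm.sameCycle_apply_left, Equiv.Perm.sameCycle_apply_left]
  have hedge : ∀ i, D'.edge (f (D.rot (D.rot (a i)))) = f (D.rot (D.rot (D.rot (a (i + 1))))) := by
    intro i
    rw [← h.map_one, ← h.map_edge, h.edge_rot, h.map_zero]
  refine ⟨fun i => ?_, fun i => ?_, ?_, ?_, hrot, ?_, ?_, ?_, ?_⟩
  · rw [face_apply, hedge, ← h.map_rot, ← h.map_rot, ← h.map_rot, rot_rot_rot_rot]
  · intro h1
    have h1 : D'.rot.SameCycle _ _ := h1
    rw [hcyc, hcyc2, rot_sameCycle_iff, rot_sameCycle_iff] at h1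
    exact h.notMem i h1
  · simp only [h.map_isOver, isOver_rot_apply, h.isOver_one]
  · simp only [h.map_isOver, isOver_rot_apply, h.isOver_two]
  · intro x; rw [← h.map_isOver, Equiv.apply_symm_apply]
  · intro x; rw [Equiv.symm_apply_eq, h.map_edge, Equiv.apply_symm_apply]
  · intro x hx
    obtain ⟨x, rfl⟩ := f.surjective x
    rw [Equiv.symm_apply_apply, Equiv.symm_apply_eq]
    refine (h.outside x fun i hi => hx i ?_).symm
    show D'.rot.SameCycle _ _
    rw [hcyc, hcyc2]
    exact hi
  · rintro i u (rfl | rfl)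
    · constructor
      · rw [hedge, opp, hrot, hrot, Equiv.symm_apply_apply, ← h.map_one, Equiv.symm_apply_apply]
        simp
      · rw [hedge, opp, Equiv.symm_apply_apply, ← h.map_rot, ← h.map_rot, rot_rot_rot_rot,
          ← h.map_three, Equiv.symm_apply_apply]
    · rw [hedge]
      constructor
      · rw [← h.map_zero, ← h.map_edge, h.edge_eq, h.map_one, Equiv.symm_apply_apply, opp, hrot,
          hrot, Equiv.symm_apply_apply, rot_rot_rot_rot]
      · rw [opp, ← h.map_rot, ← h.map_rot, rot_rot_rot_rot, ← h.map_zero i, ← h.map_edge,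
          h.edge_eq, h.map_one, Equiv.symm_apply_apply, ← h.map_two, Equiv.symm_apply_apply]

/-- Two functions on corners agree away from the triangle: they have the same values on the two sides
of each semiarc that is not a side of the triangle. -/
def Agree (a : ZMod 3 → D.Dart) (g : D.Dart ≃ D'.Dart) {A : Type*} (C : D.Dart → A)
    (C' : D'.Dart → A) : Prop :=
  ∀ w, ¬ Inner a w → C' (g w) = C w ∧
    C' (D'.rot (D'.rot (D'.rot (g w)))) = C (D.rot (D.rot (D.rot w)))

theorem Agree.symm (h : IsTriangleMove a f g) {A : Type*} {C : D.Dart → A} {C' : D'.Dart → A}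
    (hA : Agree (fun i => f (D.rot (D.rot (a i)))) g.symm C' C) : Agree a g C C' := by
  intro w hw
  have := hA (g w) ?_
  · rw [Equiv.symm_apply_apply] at this
    exact ⟨this.1.symm, this.2.symm⟩
  · rintro ⟨i, hi | hi⟩
    · replace hi : g w = f (D.rot (D.rot (a i))) := hi
      rw [← h.map_one, g.apply_eq_iff_eq] at hi
      exact hw ⟨i + 1, Or.inr hi⟩
    · have := h.map_zero (i - 1)
      rw [sub_add_cancel] at this
      rw [← h.map_rot, ← this, g.apply_eq_iff_eq] at hi
      exact hw ⟨i - 1, Or.inl hi⟩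

theorem Agree.values (h : IsTriangleMove a f g) {A : Type*} {C : D.Dart → A} {C' : D'.Dart → A}
    (hA : Agree a g C C') (i : ZMod 3) :
    C' (f (a i)) = C (D.rot (D.rot (D.rot (a (i + 1))))) ∧
    C' (f (D.rot (a (i + 1)))) = C (D.rot (D.rot (a i))) ∧
    C' (f (D.rot (D.rot (D.rot (a i))))) = C (D.rot (D.rot (a (i + 1)))) := by
  refine ⟨?_, ?_, ?_⟩
  · rw [← h.map_three]; exact (hA _ (h.not_inner_three _)).1
  · rw [← h.map_two]; exact (hA _ (h.not_inner_two _)).1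
  · rw [h.map_rot, h.map_rot, h.map_rot, ← h.map_three, (hA _ (h.not_inner_three _)).2]
    simp

theorem Agree.outside (h : IsTriangleMove a f g) {A : Type*} {C : D.Dart → A} {C' : D'.Dart → A}
    (hA : Agree a g C C') {x : D.Dart} (hx : ∀ i, x ∉ D.crossing (a i)) : C' (f x) = C x := by
  rw [← h.outside x hx]; exact (hA x (not_inner_of_outside hx)).1

theorem rot_outside {x : D.Dart} (hx : ∀ i, x ∉ D.crossing (a i)) (i : ZMod 3) :
    D.rot x ∉ D.crossing (a i) := fun h => hx i ((rot_sameCycle_iff _ _).1 h)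

/-- The corners at the triangle of a function constant on the regions. -/
theorem corner_values (h : IsTriangleMove a f g) {A : Type*} {C : D.Dart → A}
    (hC : FaceInvariant C) (i : ZMod 3) :
    C (a (i + 1)) = C (a i) ∧ C (D.rot (a (i + 1))) = C (D.rot (D.rot (D.rot (a i)))) :=
  ⟨by rw [← h.face_eq, hC], by rw [← h.edge_eq, hC.edge]⟩

theorem add_one_zmod_three : (0 : ZMod 3) + 1 = 1 ∧ (1 : ZMod 3) + 1 = 2 ∧ (2 : ZMod 3) + 1 = 0 := by
  decide

theorem forall_zmod_three {P : ZMod 3 → Prop} (h0 : P 0) (h1 : P 1) (h2 : P 2) (i : ZMod 3) :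
    P i := by
  have : ∀ i : ZMod 3, i = 0 ∨ i = 1 ∨ i = 2 := by decide
  rcases this i with rfl | rfl | rfl <;> assumption

theorem cross_eq_zero {C : D.Dart → ZMod p} (hC : IsCornerColoring C) (x : D.Dart) :
    (D.isOver x = false → C x + C (D.rot x) = C (D.rot (D.rot (D.rot x))) + C (D.rot (D.rot x))) ∧
    (D.isOver x = true →
      C (D.rot x) + C (D.rot (D.rot x)) = C x + C (D.rot (D.rot (D.rot x)))) := by
  constructor
  · intro hx
    linear_combination hC.sub_eq hx
  · intro hx
    have := hC.sub_eq (a := D.rot x) (by rw [isOver_rot_apply, hx]; rfl)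
    simp only [rot_rot_rot_rot] at this
    linear_combination this

/-- A coloring carries over through the move: all regions but the triangle keep their colors, and the
color of the new triangle is forced by the crossing relations. -/
theorem exists_coloring (h : IsTriangleMove a f g) {C : D.Dart → ZMod p}
    (hC : IsCornerColoring C) : ∃ C' : D'.Dart → ZMod p, IsCornerColoring C' ∧ Agree a g C C' := by
  classical
  -- the new color of the triangle, from the three regions on the other sides of the old triangle
  let n : ZMod p := C (D.rot (D.rot (D.rot (a 1)))) + C (D.rot (D.rot (D.rot (a 2)))) -
    C (D.rot (D.rot (D.rot (a 0))))
  let V : D.Dart → ZMod p := fun w =>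
    if ∃ i, w = D.rot (a i) then n
    else if ∃ i, w = a i then C (D.opp (D.face (D.face w))) else C w
  let C' : D'.Dart → ZMod p := fun x => V (g.symm x)
  have hg : ∀ w, C' (g w) = V w := fun w => by simp [C']
  have hV1 : ∀ i, V (D.rot (a i)) = n := fun i => by simp [V]
  have hV0 : ∀ i, V (a i) = C (D.rot (D.rot (a (i + 1 + 1)))) := by
    intro i
    have h1 : ¬ ∃ j, a i = D.rot (a j) := by
      rintro ⟨j, hj⟩
      obtain rfl := h.eq_of_sameCycle (i := j) (j := i) (sameCycle_rot_iff.2 (by simp [hj]))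
      exact rot_ne _ hj.symm
    simp only [V, if_neg h1, if_pos (⟨i, rfl⟩ : ∃ j, a i = a j), h.face_eq]; rfl
  have hVn : ∀ w, ¬ Inner a w → V w = C w := by
    intro w hw
    have h1 : ¬ ∃ j, w = D.rot (a j) := fun ⟨j, hj⟩ => hw ⟨j, Or.inr hj⟩
    have h2 : ¬ ∃ j, w = a j := fun ⟨j, hj⟩ => hw ⟨j, Or.inl hj⟩
    simp only [V, if_neg h1, if_neg h2]
  have h3 : ∀ i : ZMod 3, i + 1 + 1 + 1 = i := by decide
  have v0 : ∀ i, C' (f (a i)) = C (D.rot (D.rot (D.rot (a (i + 1))))) := by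
    intro i; rw [← h.map_three, hg, hVn _ (h.not_inner_three _)]
  have v1 : ∀ i, C' (f (D.rot (a (i + 1)))) = C (D.rot (D.rot (a i))) := by
    intro i; rw [← h.map_two, hg, hVn _ (h.not_inner_two _)]
  have v2 : ∀ i, C' (f (D.rot (D.rot (a i)))) = n := by
    intro i; rw [← h.map_one, hg, hV1]
  have v3 : ∀ i, C' (f (D.rot (D.rot (D.rot (a i))))) = C (D.rot (D.rot (a (i + 1)))) := by
    intro i
    rw [← h3 i, ← h.map_zero, hg, hV0, h3]
  have vout : ∀ x, (∀ i, x ∉ D.crossing (a i)) → C' (f x) = C x := by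
    intro x hx
    rw [← h.outside x hx, hg, hVn _ (not_inner_of_outside hx)]
  have hA : Agree a g C C' := by
    intro w hw
    refine ⟨by rw [hg, hVn w hw], ?_⟩
    by_cases hout : ∀ i, w ∉ D.crossing (a i)
    · rw [h.outside w hout, ← h.map_rot, ← h.map_rot, ← h.map_rot,
        vout _ (rot_outside (rot_outside (rot_outside hout)))]
    · push Not at hout
      obtain ⟨i, hi⟩ := hout
      rcases sameCycle_rot_iff.1 hi with rfl | rfl | rfl | rfl
      · exact absurd ⟨i, Or.inl rfl⟩ hw
      · exact absurd ⟨i, Or.inr rfl⟩ hw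
      · rw [h.map_two, ← h.map_rot, ← h.map_rot, ← h.map_rot, rot_rot_rot_rot, v0,
          rot_rot_rot_rot, ← (h.corner_values hC.face _).2, h3]
      · have := h.map_three (i - 1)
        rw [sub_add_cancel] at this
        rw [this, ← h.map_rot, ← h.map_rot, ← h.map_rot, v3, sub_add_cancel, rot_rot_rot_rot]
  refine ⟨C', ⟨fun x => ?_, fun x hx => ?_⟩, hA⟩
  · obtain ⟨w, rfl⟩ := g.surjective x
    rw [face_apply, ← h.map_edge]
    by_cases hw : Inner a w
    · obtain ⟨i, rfl | rfl⟩ := hw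
      · rw [h.edge_eq, h.map_one, h.map_zero, v3, ← h.map_rot, ← h.map_rot, ← h.map_rot]
        have := v1 (i + 1 + 1)
        rw [h3] at this
        simpa using this
      · have := h.edge_rot (i - 1)
        have h4 := h.map_one (i - 1)
        rw [sub_add_cancel] at this h4
        rw [this, h4, h.map_zero, sub_add_cancel, ← h.map_rot, ← h.map_rot, ← h.map_rot]
        simp only [rot_rot_rot_rot, v2]
    · have hw' : ¬ Inner a (D.edge w) := fun hh => hw (by simpa using h.inner_edge hh)
      rw [(hA _ hw').2, (hA _ hw).1, hC.face.rot_edge]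
  · obtain ⟨x, rfl⟩ := f.surjective x
    rw [h.map_isOver] at hx
    by_cases hout : ∀ i, x ∉ D.crossing (a i)
    · have := hC.cross_eq x hx
      simp only [cross, ← h.map_rot] at this ⊢
      rwa [vout _ hout, vout _ (rot_outside hout), vout _ (rot_outside (rot_outside hout)),
        vout _ (rot_outside (rot_outside (rot_outside hout)))]
    · push Not at hout
      obtain ⟨i, hi⟩ := hout
      -- the crossing relations of `C` at the three corners
      obtain ⟨c0, d0⟩ := h.corner_values hC.face 0
      obtain ⟨c1, d1⟩ := h.corner_values hC.face 1
      obtain ⟨c2, d2⟩ := h.corner_values hC.face 2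
      have r0 := cross_eq_zero hC (a 0)
      have r1 := cross_eq_zero hC (a 1)
      have r2 := cross_eq_zero hC (a 2)
      have w0 := v0 0
      have w1 := v0 1
      have w2 := v0 2
      have x0 := v1 0
      have x1 := v1 1
      have x2 := v1 2
      have y0 := v3 0
      have y1 := v3 1
      have y2 := v3 2
      obtain ⟨z0, z1, z2⟩ := add_one_zmod_three
      simp only [z0, z1, z2] at c0 c1 c2 d0 d1 d2 w0 w1 w2 x0 x1 x2 y0 y1 y2
      have o1 := h.isOver_one
      have o2 := h.isOver_two
      have hn : n = C (D.rot (D.rot (D.rot (a 1)))) + C (D.rot (D.rot (D.rot (a 2)))) -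
        C (D.rot (D.rot (D.rot (a 0)))) := rfl
      have hx' : D.isOver (a i) = true ∨ D.isOver (a i) = false := by
        cases D.isOver (a i) <;> simp
      clear_value n
      have key : ∀ s : ZMod p, (s = C' (f (a i)) + C' (f (D.rot (a i))) -
          C' (f (D.rot (D.rot (D.rot (a i))))) - C' (f (D.rot (D.rot (a i)))) ∧
          D.isOver (a i) = false) ∨ (s = C' (f (D.rot (a i))) + C' (f (D.rot (D.rot (a i)))) -
            C' (f (a i)) - C' (f (D.rot (D.rot (D.rot (a i))))) ∧ D.isOver (a i) = true) →
          s = 0 := by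
        cases ho : D.isOver (a 0) <;> rw [ho] at o1 o2 <;>
          simp only [ho, o1, o2, Bool.not_true, Bool.not_false, forall_const, Bool.true_eq_false,
            Bool.false_eq_true, false_imp_iff, true_and, and_true] at r0 r1 r2 <;>
          revert i <;>
          refine forall_zmod_three ?_ ?_ ?_ <;>
          intro _ _ s <;>
          simp only [ho, o1, o2, Bool.not_true, Bool.not_false, Bool.true_eq_false,
            Bool.false_eq_true, and_false, and_true, false_or, or_false, w0, w1, w2, x0, x1, x2,
            y0, y1, y2, v2, hn] <;>
          rintro rfl <;>
          simp only [d0, d1, d2, c1, c0] at r0 r1 r2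
        · linear_combination r1 + r2
        · linear_combination -r0 - r2
        · linear_combination r0 - r1
        · linear_combination -r1 - r2
        · linear_combination r0 + r2
        · linear_combination r1 - r0
      cases hi' : D.isOver (a i)
      · have k1 := key _ (Or.inl ⟨rfl, hi'⟩)
        rcases sameCycle_rot_iff.1 hi with rfl | rfl | rfl | rfl
        · simpa only [cross, ← h.map_rot] using k1
        · simp [isOver_rot_apply, hi'] at hx
        · simp only [cross, ← h.map_rot, rot_rot_rot_rot]
          linear_combination -k1
        · simp [isOver_rot_apply, hi'] at hx
      · have k1 := key _ (Or.inr ⟨rfl, hi'⟩)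
        rcases sameCycle_rot_iff.1 hi with rfl | rfl | rfl | rfl
        · simp [hi'] at hx
        · simp only [cross, ← h.map_rot, rot_rot_rot_rot]
          linear_combination k1
        · simp [isOver_rot_apply, hi'] at hx
        · simp only [cross, ← h.map_rot, rot_rot_rot_rot]
          linear_combination -k1

/-- If the new coloring is trivial at the three new crossings, then all three regions across the sides
of the old triangle have the same color, and so the old coloring is trivial there. -/
theorem nontrivial_of_agree (h : IsTriangleMove a f g) {C : D.Dart → ZMod p} {C' : D'.Dart → ZMod p}
    (hC : IsCornerColoring C) (hC' : IsCornerColoring C') (hA : Agree a g C C')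
    (hnon : NontrivialCorners C) : NontrivialCorners C' := by
  by_contra htriv
  have htriv : ∀ x, D'.isOver x = false →
      C' (D'.rot x) = C' (D'.rot (D'.rot (D'.rot x))) := by
    intro x hx
    by_contra hne
    exact htriv ⟨x, hx, hne⟩
  obtain ⟨x, hx, hne⟩ := hnon
  by_cases hout : ∀ i, x ∉ D.crossing (a i)
  · have := htriv (f x) (by rw [h.map_isOver, hx])
    rw [← h.map_rot, ← h.map_rot, ← h.map_rot, hA.outside h (rot_outside hout),
      hA.outside h (rot_outside (rot_outside (rot_outside hout)))] at this
    exact hne this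
  push Not at hout
  obtain ⟨i, hi⟩ := hout
  have h3 : ∀ i : ZMod 3, i + 1 + 1 + 1 = i := by decide
  -- at the three crossings of `D'`, opposite corners have the same color
  have htriv2 : ∀ x, C' (D'.rot x) = C' (D'.rot (D'.rot (D'.rot x))) ∧
      C' x = C' (D'.rot (D'.rot x)) := by
    intro x
    cases hx : D'.isOver x
    · have h1 := htriv x hx
      exact ⟨h1, by linear_combination hC'.sub_eq hx - h1⟩
    · have h1 := htriv _ (by rw [isOver_rot_apply, hx]; rfl)
      have h2 := (cross_eq_zero hC' x).2 hx
      simp only [rot_rot_rot_rot] at h1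
      exact ⟨by linear_combination h2 - h1, h1.symm⟩
  have hm : ∀ i, C (D.rot (D.rot (D.rot (a (i + 1))))) =
      C (D.rot (D.rot (D.rot (a (i + 1 + 1))))) := by
    intro i
    have hn : ∀ i, C' (f (D.rot (D.rot (a (i + 1))))) = C' (f (D.rot (D.rot (a i)))) :=
      fun i => (h.symm.corner_values hC'.face i).1
    have e : ∀ i, C (D.rot (D.rot (D.rot (a (i + 1))))) = C' (f (D.rot (D.rot (a i)))) := by
      intro i
      rw [← (hA.values h i).1, (htriv2 _).2, ← h.map_rot, ← h.map_rot]
    rw [e, e, hn]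
  have e13 : C (D.rot (a i)) = C (D.rot (D.rot (D.rot (a i)))) := by
    have := (h.corner_values hC.face (i - 1)).2
    rw [sub_add_cancel] at this
    rw [this]
    have := hm (i - 1 - 1)
    rwa [sub_add_cancel, sub_add_cancel] at this
  have e02 : C (a i) = C (D.rot (D.rot (a i))) := by
    obtain ⟨h1, h2⟩ := cross_eq_zero hC (a i)
    cases hi : D.isOver (a i)
    · linear_combination h1 hi - e13
    · linear_combination e13 - h2 hi
  refine hne ?_
  rcases sameCycle_rot_iff.1 hi with rfl | rfl | rfl | rfl
  · exact e13
  · simpa using e02.symm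
  · simpa using e13.symm
  · simpa using e02

open Classical in
/-- Sums over the darts that differ only at the triangle. -/
theorem sum_sub_sum (h : IsTriangleMove a f g) {R : Type*} [AddCommGroup R] {u v : D.Dart → R}
    (huv : ∀ x, (∀ i, x ∉ D.crossing (a i)) → u x = v x) :
    ∑ x, u x - ∑ x, v x = ∑ i : ZMod 3, ((u (a i) - v (a i)) +
      ((u (D.rot (a i)) - v (D.rot (a i))) + ((u (D.rot (D.rot (a i))) - v (D.rot (D.rot (a i)))) +
        (u (D.rot (D.rot (D.rot (a i)))) - v (D.rot (D.rot (D.rot (a i)))))))) := by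
  have h1 : ∀ x, u x - v x = ∑ i : ZMod 3, if D.rot.SameCycle (a i) x then u x - v x else 0 := by
    intro x
    by_cases hout : ∀ i, x ∉ D.crossing (a i)
    · rw [huv x hout, sub_self]; simp
    · push Not at hout
      obtain ⟨i, hi⟩ := hout
      have hi : D.rot.SameCycle (a i) x := hi
      rw [Finset.sum_eq_single i]
      · rw [if_pos hi]
      · intro j _ hj
        rw [if_neg fun hjx => hj (h.eq_of_sameCycle (hjx.trans hi.symm))]
      · simp
  rw [← Finset.sum_sub_distrib, Finset.sum_congr rfl fun x _ => h1 x, Finset.sum_comm]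
  exact Finset.sum_congr rfl fun i _ => sum_rot_orbit (fun x => u x - v x) (a i)

/-- The contribution of one crossing to the pairing. -/
theorem sum_pairTerm {X : D.Dart → ℤ} {y : D.Dart → ZMod p} (x : D.Dart) {k : ℤ} (hp : (p : ℤ) ≠ 0)
    (hk : ((X x + X (D.rot x) - X (D.rot (D.rot (D.rot x))) - X (D.rot (D.rot x)) = p * k) ∧
      D.isOver x = false) ∨
      ((X (D.rot x) + X (D.rot (D.rot x)) - X x - X (D.rot (D.rot (D.rot x))) = p * k) ∧
      D.isOver x = true)) :
    pairTerm X y x + (pairTerm X y (D.rot x) + (pairTerm X y (D.rot (D.rot x)) +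
      pairTerm X y (D.rot (D.rot (D.rot x))))) = 2 * k *
      if D.isOver x then y (D.rot x) - y (D.rot (D.rot (D.rot x))) else
        y x - y (D.rot (D.rot x)) := by
  obtain ⟨hk, ho⟩ | ⟨hk, ho⟩ := hk
  · have e1 : cross X x / p = k := by
      rw [cross, hk, Int.mul_ediv_cancel_left _ hp]
    have e2 : cross X (D.rot (D.rot x)) / p = -k := by
      have : cross X (D.rot (D.rot x)) = p * -k := by
        simp only [cross, rot_rot_rot_rot]; linear_combination -hk
      rw [this, Int.mul_ediv_cancel_left _ hp]
    simp only [pairTerm, isOver_rot_apply, ho, Bool.not_false, Bool.not_true, if_true,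
      Bool.false_eq_true, if_false, e1, e2, rot_rot_rot_rot]
    push_cast
    ring
  · have e1 : cross X (D.rot x) / p = k := by
      have : cross X (D.rot x) = p * k := by
        simp only [cross, rot_rot_rot_rot]; linear_combination hk
      rw [this, Int.mul_ediv_cancel_left _ hp]
    have e2 : cross X (D.rot (D.rot (D.rot x))) / p = -k := by
      have : cross X (D.rot (D.rot (D.rot x))) = p * -k := by
        simp only [cross, rot_rot_rot_rot]; linear_combination -hk
      rw [this, Int.mul_ediv_cancel_left _ hp]
    simp only [pairTerm, isOver_rot_apply, ho, Bool.not_false, Bool.not_true, if_true,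
      Bool.false_eq_true, if_false, e1, e2, rot_rot_rot_rot]
    push_cast
    ring

theorem exists_quotient {C : D.Dart → ZMod p} [NeZero p] (hC : IsCornerColoring C) (x : D.Dart) :
    ∃ k : ℤ, ((lift C x + lift C (D.rot x) - lift C (D.rot (D.rot (D.rot x))) -
        lift C (D.rot (D.rot x)) = p * k) ∧ D.isOver x = false) ∨
      ((lift C (D.rot x) + lift C (D.rot (D.rot x)) - lift C x -
        lift C (D.rot (D.rot (D.rot x))) = p * k) ∧ D.isOver x = true) := by
  cases hx : D.isOver x
  · obtain ⟨k, hk⟩ := dvd_cross hC (intCast_lift C) hx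
    exact ⟨k, Or.inl ⟨hk, rfl⟩⟩
  · obtain ⟨k, hk⟩ := dvd_cross hC (intCast_lift C) (a := D.rot x)
      (by rw [isOver_rot_apply, hx]; rfl)
    refine ⟨k, Or.inr ⟨?_, rfl⟩⟩
    rw [← hk, cross, rot_rot_rot_rot]

/-- The move preserves the pairing.  The quotients at the new crossings `1` and `2` are combinations
of the quotient `l0` at the new crossing `0` and of those at the old crossings, and `l0` cancels. -/
theorem pairing_eq (h : IsTriangleMove a f g) [NeZero p] {C y : D.Dart → ZMod p}
    {C' y' : D'.Dart → ZMod p} (hC : IsCornerColoring C) (hC' : IsCornerColoring C')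
    (hy : IsCornerColoring y) (hy' : IsCornerColoring y') (hA : Agree a g C C')
    (hB : Agree a g y y') : pairing C y = pairing C' y' := by
  have hp : (p : ℤ) ≠ 0 := by exact_mod_cast NeZero.ne p
  have hAl : Agree a g (lift C) (lift C') := fun w hw =>
    ⟨congrArg (fun c : ZMod p => (c.val : ℤ)) (hA w hw).1,
      congrArg (fun c : ZMod p => (c.val : ℤ)) (hA w hw).2⟩
  have hpull : ∀ x, pairTerm (lift C') y' (f x) =
      pairTerm (fun x => lift C' (f x)) (fun x => y' (f x)) x := by
    intro x; simp only [pairTerm, cross, h.map_isOver, h.map_rot]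
  rw [← sub_eq_zero]
  unfold pairing liftPairing
  rw [← Equiv.sum_comp f, Finset.sum_congr rfl fun x _ => hpull x, h.sum_sub_sum]
  · have hsplit : ∀ i, (∃ k k' : ℤ,
        (((lift C (a i) + lift C (D.rot (a i)) - lift C (D.rot (D.rot (D.rot (a i)))) -
        lift C (D.rot (D.rot (a i))) = p * k) ∧ D.isOver (a i) = false) ∨
        ((lift C (D.rot (a i)) + lift C (D.rot (D.rot (a i))) - lift C (a i) -
        lift C (D.rot (D.rot (D.rot (a i)))) = p * k) ∧ D.isOver (a i) = true)) ∧
        (((lift C' (f (a i)) + lift C' (f (D.rot (a i))) - lift C' (f (D.rot (D.rot (D.rot (a i))))) -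
        lift C' (f (D.rot (D.rot (a i)))) = p * k') ∧ D.isOver (a i) = false) ∨
        ((lift C' (f (D.rot (a i))) + lift C' (f (D.rot (D.rot (a i)))) - lift C' (f (a i)) -
        lift C' (f (D.rot (D.rot (D.rot (a i))))) = p * k') ∧ D.isOver (a i) = true))) := by
      intro i
      obtain ⟨k, hk⟩ := exists_quotient hC (a i)
      obtain ⟨k', hk'⟩ := exists_quotient hC' (f (a i))
      simp only [← h.map_rot, h.map_isOver] at hk'
      exact ⟨k, k', hk, hk'⟩
    obtain ⟨k0, l0, hk0, hl0⟩ := hsplit 0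
    obtain ⟨k1, l1, hk1, hl1⟩ := hsplit 1
    obtain ⟨k2, l2, hk2, hl2⟩ := hsplit 2
    have hterm : ∀ i : ZMod 3, ∀ u v : D.Dart → ZMod p, (u (a i) - v (a i)) +
        ((u (D.rot (a i)) - v (D.rot (a i))) +
        ((u (D.rot (D.rot (a i))) - v (D.rot (D.rot (a i)))) +
        (u (D.rot (D.rot (D.rot (a i)))) - v (D.rot (D.rot (D.rot (a i))))))) =
        (u (a i) + (u (D.rot (a i)) + (u (D.rot (D.rot (a i))) + u (D.rot (D.rot (D.rot (a i))))))) -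
        (v (a i) + (v (D.rot (a i)) + (v (D.rot (D.rot (a i))) +
          v (D.rot (D.rot (D.rot (a i))))))) := by
      intro i u v; ring
    rw [show (Finset.univ : Finset (ZMod 3)) = {0, 1, 2} from by decide,
      Finset.sum_insert (by decide), Finset.sum_insert (by decide), Finset.sum_singleton,
      hterm, hterm, hterm, sum_pairTerm _ hp hk0, sum_pairTerm _ hp hk1, sum_pairTerm _ hp hk2,
      sum_pairTerm (X := fun x => lift C' (f x)) _ hp hl0,
      sum_pairTerm (X := fun x => lift C' (f x)) _ hp hl1,
      sum_pairTerm (X := fun x => lift C' (f x)) _ hp hl2]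
    -- everything in terms of the corners of `D`
    obtain ⟨z0, z1, z2⟩ := add_one_zmod_three
    obtain ⟨c0, d0⟩ := h.corner_values hC.face.lift 0
    obtain ⟨c1, d1⟩ := h.corner_values hC.face.lift 1
    obtain ⟨-, d2⟩ := h.corner_values hC.face.lift 2
    obtain ⟨c0', -⟩ := h.symm.corner_values hC'.face.lift 0
    obtain ⟨c1', -⟩ := h.symm.corner_values hC'.face.lift 1
    obtain ⟨v0, v1, v2⟩ := hAl.values h 0
    obtain ⟨v3, v4, v5⟩ := hAl.values h 1
    obtain ⟨v6, v7, v8⟩ := hAl.values h 2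
    obtain ⟨e0, f0⟩ := h.corner_values hy.face 0
    obtain ⟨e1, f1⟩ := h.corner_values hy.face 1
    obtain ⟨-, f2⟩ := h.corner_values hy.face 2
    obtain ⟨e0', -⟩ := h.symm.corner_values hy'.face 0
    obtain ⟨e1', -⟩ := h.symm.corner_values hy'.face 1
    obtain ⟨w0, w1, w2⟩ := hB.values h 0
    obtain ⟨w3, w4, w5⟩ := hB.values h 1
    obtain ⟨w6, w7, w8⟩ := hB.values h 2
    simp only [z0, z1, z2] at c0 c1 d0 d1 d2 c0' c1' e0 e1 f0 f1 f2 e0' e1'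
    simp only [z0, z1, z2] at v0 v1 v2 v3 v4 v5 v6 v7 v8 w0 w1 w2 w3 w4 w5 w6 w7 w8
    have r0 := cross_eq_zero hy (a 0)
    have r1 := cross_eq_zero hy (a 1)
    have r2 := cross_eq_zero hy (a 2)
    have r3 := cross_eq_zero hy' (f (a 0))
    simp only [← h.map_rot, h.map_isOver] at r3
    have o1 := h.isOver_one
    have o2 := h.isOver_two
    cases ho : D.isOver (a 0) <;> rw [ho] at o1 o2 <;>
      simp only [ho, o1, o2, Bool.not_true, Bool.not_false, forall_const, Bool.true_eq_false,
        Bool.false_eq_true, false_imp_iff, true_and, and_true, and_false, or_false, false_or,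
        if_true, if_false, c0, c1, d0, d1, d2, c0', c1', e0, e1, f0, f1, f2, e0', e1', v0, v1, v2, v3,
        v4, v5, v6, v7, v8, w0, w1, w2, w3, w4, w5, w6, w7, w8]
        at r0 r1 r2 r3 hk0 hk1 hk2 hl0 hl1 hl2 ⊢
    · have hl1' : l1 = l0 - k1 - 2 * k2 - k0 := mul_left_cancel₀ hp (by
        linear_combination hl0 - hl1 - hk1 - 2 * hk2 - hk0)
      have hl2' : l2 = -l0 + k2 + k0 := mul_left_cancel₀ hp (by
        linear_combination -hl0 - hl2 + hk2 + hk0)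
      have s0 := eq_sub_of_add_eq' r0.symm
      have s1 := eq_sub_of_add_eq' r1.symm
      have s2 := eq_sub_of_add_eq' r2
      have s3 := eq_sub_of_add_eq' r3.symm
      rw [hl1', hl2', s3, s0, s1, s2]
      push_cast
      ring
    · have hl1' : l1 = l0 + k1 + 2 * k2 + k0 := mul_left_cancel₀ hp (by
        linear_combination hl0 - hl1 + hk1 + 2 * hk2 + hk0)
      have hl2' : l2 = -l0 - k2 - k0 := mul_left_cancel₀ hp (by
        linear_combination -hl0 - hl2 - hk2 - hk0)
      have s0 := eq_sub_of_add_eq' r0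
      have s1 := eq_sub_of_add_eq' r1
      have s2 := eq_sub_of_add_eq' r2.symm
      have s3 := eq_sub_of_add_eq' r3
      rw [hl1', hl2', s3, s0, s1, s2]
      push_cast
      ring
  · intro x hx
    have h1 := rot_outside hx
    have h2 := rot_outside h1
    have h3 := rot_outside h2
    simp only [pairTerm, cross, hAl.outside h hx, hAl.outside h h1, hAl.outside h h2,
      hAl.outside h h3, hB.outside h hx, hB.outside h h2]

end IsTriangleMove

theorem R3.corresponds [NeZero p] (h : R3 D D') : Corresponds p D D' := by
  obtain ⟨a, f, g, h⟩ := h.exists_isTriangleMove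
  refine ⟨IsTriangleMove.Agree a g, fun C hC => h.exists_coloring hC, fun C' hC' => ?_, ?_, ?_⟩
  · obtain ⟨C, hC, hA⟩ := h.symm.exists_coloring hC'
    exact ⟨C, hC, hA.symm h⟩
  · intro C C' hC hC' hA
    refine ⟨h.nontrivial_of_agree hC hC' hA, h.symm.nontrivial_of_agree hC' hC ?_⟩
    refine IsTriangleMove.Agree.symm h.symm ?_
    have : (fun i => f.symm (D'.rot (D'.rot (f (D.rot (D.rot (a i))))))) = a := by
      funext i; simp [← h.map_rot]
    rwa [this]
  · intro C C' y y' hC hC' hy hy' hA hB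
    exact h.pairing_eq hC hC' hy hy' hA hB

end Third

end KnotDiagram

namespace KnotDiagram

/-! ### Invariance under equivalence, and colorings of regions -/

section Equivalence

variable {D D' : KnotDiagram} {p : ℕ}

theorem Move.corresponds [Fact p.Prime] (h : Move D D') : Corresponds p D D' := by
  rcases h with h | h | h | h
  exacts [h.corresponds, h.corresponds, h.corresponds, h.corresponds]

theorem corresponds_of_knot_eq [Fact p.Prime] (h : D.knot = D'.knot) : Corresponds p D D' := by
  have h' : Relation.EqvGen Move D D' := Quotient.exact h
  clear h
  induction h' with
  | rel _ _ h => exact h.corresponds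
  | refl _ => exact Corresponds.refl _
  | symm _ _ _ ih => exact ih.symm
  | trans _ _ _ _ _ ih ih' => exact ih.trans ih'

theorem corner_face (a : D.Dart) : D.corner (D.face a) = D.corner a :=
  congrArg Sum.inl (Quotient.sound (Equiv.Perm.SameCycle.symm ⟨1, by simp⟩))

theorem IsDehnColoring.isCornerColoring {C : D.Region → ZMod p} (hC : IsDehnColoring C) :
    IsCornerColoring fun a => C (D.corner a) where
  face a := congrArg C (corner_face a)
  cross_eq a ha := by
    have := hC a ha
    simp only [cross]
    linear_combination this

theorem IsNontrivialDehnColoring.nontrivialCorners {C : D.Region → ZMod p}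
    (hC : IsNontrivialDehnColoring C) : NontrivialCorners fun a => C (D.corner a) := by
  obtain ⟨h, a, ha, hn⟩ := hC
  refine ⟨a, ha, fun h1 => hn ⟨?_, h1⟩⟩
  linear_combination h a ha - h1

/-- A coloring of the corners comes from a coloring of the regions. -/
theorem IsCornerColoring.exists_region_coloring {C : D.Dart → ZMod p} (hC : IsCornerColoring C)
    (hn : NontrivialCorners C) : ∃ C' : D.Region → ZMod p, IsNontrivialDehnColoring C' ∧
      Set.range C' = Set.range C := by
  have := D.finite_dart
  have hinv : ∀ a b, D.face.SameCycle a b → C a = C b := by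
    intro a b h
    obtain ⟨k, -, rfl⟩ := h.exists_pow_eq'
    have : ∀ k : ℕ, C ((D.face ^ k) a) = C a := by
      intro k
      induction k with
      | zero => rfl
      | succ k ih => rw [pow_succ', Equiv.Perm.mul_apply, hC.face, ih]
    exact (this k).symm
  let C' : D.Region → ZMod p := Sum.elim (Quotient.lift C hinv) fun _ => 0
  have hC' : ∀ a, C' (D.corner a) = C a := fun a => rfl
  refine ⟨C', ⟨fun a ha => ?_, ?_⟩, ?_⟩
  · have := hC.sub_eq ha
    simp only [hC']
    linear_combination this
  · obtain ⟨a, ha, hne⟩ := hn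
    exact ⟨a, ha, fun h => hne h.2⟩
  · obtain ⟨a₀, -, -⟩ := hn
    ext c
    constructor
    · rintro ⟨⟨⟨a⟩⟩ | ⟨-, hb⟩, rfl⟩
      · exact ⟨a, rfl⟩
      · exact hb.elim a₀
    · rintro ⟨a, rfl⟩
      exact ⟨D.corner a, rfl⟩

theorem IsCornerColoring.dehnColorable {C : D.Dart → ZMod p} (hC : IsCornerColoring C)
    (hn : NontrivialCorners C) : D.knot.DehnColorable p := by
  obtain ⟨C', h, -⟩ := hC.exists_region_coloring hn
  exact ⟨D, rfl, C', h⟩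

theorem IsCornerColoring.mincol_le {C : D.Dart → ZMod p} (hC : IsCornerColoring C)
    (hn : NontrivialCorners C) : D.knot.mincol p ≤ (Set.range C).ncard := by
  obtain ⟨C', h, hr⟩ := hC.exists_region_coloring hn
  exact Nat.sInf_le ⟨D, rfl, C', h, by rw [hr]⟩

theorem exists_coloring_of_mincol_le [Fact p.Prime] {m : ℕ} (hcol : D.knot.DehnColorable p)
    (h : D.knot.mincol p ≤ m) : ∃ D', Corresponds p D D' ∧ ∃ C : D'.Dart → ZMod p,
      IsCornerColoring C ∧ NontrivialCorners C ∧ (Set.range C).ncard ≤ m := by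
  obtain ⟨D₁, h₁, C₁, hC₁⟩ := hcol
  obtain ⟨D', hD', C, hC, hm⟩ := Nat.sInf_mem (s := {m | ∃ D' : KnotDiagram, D'.knot = D.knot ∧
    ∃ C : D'.Region → ZMod p, IsNontrivialDehnColoring C ∧ (Set.range C).ncard = m})
    ⟨_, D₁, h₁, C₁, hC₁, rfl⟩
  refine ⟨D', corresponds_of_knot_eq hD'.symm, _, hC.1.isCornerColoring, hC.nontrivialCorners, ?_⟩
  refine le_trans (Set.ncard_le_ncard ?_ (Set.toFinite _)) (hm.le.trans h)
  rintro _ ⟨a, rfl⟩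
  exact ⟨_, rfl⟩

/-- If the pairing of each nontrivial coloring of `D` with itself is nonzero, but that of each
coloring with at most `m` colors vanishes, then the knot of `D` needs more than `m` colors. -/
theorem lt_mincol_of_self [Fact p.Prime] {m : ℕ} (hcol : D.knot.DehnColorable p)
    (hD : ∀ C : D.Dart → ZMod p, IsCornerColoring C → NontrivialCorners C → pairing C C ≠ 0)
    (hfew : ∀ (D' : KnotDiagram) (C : D'.Dart → ZMod p), IsCornerColoring C → NontrivialCorners C →
      (Set.range C).ncard ≤ m → pairing C C = 0) : m < D.knot.mincol p := by
  by_contra! h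
  obtain ⟨D', ⟨T, -, h2, h3, h4⟩, C', hC', hn, hm⟩ := exists_coloring_of_mincol_le hcol h
  obtain ⟨C, hC, hT⟩ := h2 C' hC'
  exact hD C hC ((h3 C C' hC hC' hT).2 hn)
    ((h4 C C' C C' hC hC' hC hC' hT hT).trans (hfew D' C' hC' hn hm))

/-- If the pairing on the colorings of `D` is nondegenerate, but each coloring with at most `m`
colors is in its radical, then the knot of `D` needs more than `m` colors. -/
theorem lt_mincol_of_radical [Fact p.Prime] {m : ℕ} (hcol : D.knot.DehnColorable p)
    (hD : ∀ C : D.Dart → ZMod p, IsCornerColoring C → NontrivialCorners C →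
      ∃ y, IsCornerColoring y ∧ pairing C y ≠ 0)
    (hfew : ∀ (D' : KnotDiagram) (C y : D'.Dart → ZMod p), IsCornerColoring C →
      IsCornerColoring y → NontrivialCorners C → (Set.range C).ncard ≤ m → pairing C y = 0) :
    m < D.knot.mincol p := by
  by_contra! h
  obtain ⟨D', ⟨T, h1, h2, h3, h4⟩, C', hC', hn, hm⟩ := exists_coloring_of_mincol_le hcol h
  obtain ⟨C, hC, hT⟩ := h2 C' hC'
  obtain ⟨y, hy, hne⟩ := hD C hC ((h3 C C' hC hC' hT).2 hn)
  obtain ⟨y', hy', hU⟩ := h1 y hy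
  exact hne ((h4 C C' y y' hC hC' hy hy' hT hU).trans (hfew D' C' y' hC' hy' hn hm))

end Equivalence

/-! ### Affine changes of colors -/

section Affine

variable {D : KnotDiagram} {p : ℕ}

theorem IsCornerColoring.affine {C : D.Dart → ZMod p} (hC : IsCornerColoring C) (α β : ZMod p) :
    IsCornerColoring fun a => α * C a + β where
  face a := by simp only [hC.face a]
  cross_eq a ha := by
    have := hC.cross_eq a ha
    simp only [cross] at this ⊢
    linear_combination α * this

theorem pairing_affine_right (C y : D.Dart → ZMod p) (α β : ZMod p) :
    pairing C (fun a => α * y a + β) = α * pairing C y := by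
  unfold pairing liftPairing pairTerm
  rw [Finset.mul_sum]
  refine Finset.sum_congr rfl fun a _ => ?_
  split_ifs <;> ring

theorem pairing_affine_left [NeZero p] {C y : D.Dart → ZMod p} (hC : IsCornerColoring C)
    (hy : IsCornerColoring y) (α β : ZMod p) :
    pairing (fun a => α * C a + β) y = α * pairing C y := by
  have hp : (p : ℤ) ≠ 0 := by exact_mod_cast NeZero.ne p
  rw [← liftPairing_eq_pairing (hC.affine α β) hy (X := fun a => (α.val : ℤ) * lift C a + β.val)]
  · unfold pairing liftPairing
    rw [Finset.mul_sum]
    refine Finset.sum_congr rfl fun a _ => ?_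
    unfold pairTerm
    cases ha : D.isOver a
    · obtain ⟨k, hk⟩ := dvd_cross hC (intCast_lift C) ha
      have h1 : cross (fun a => (α.val : ℤ) * lift C a + β.val) a = p * (α.val * k) := by
        have : cross (fun a => (α.val : ℤ) * lift C a + β.val) a = α.val * cross (lift C) a := by
          simp only [cross]; ring
        rw [this, hk]; ring
      rw [h1, hk, Int.mul_ediv_cancel_left _ hp, Int.mul_ediv_cancel_left _ hp]
      push_cast
      simp only [ZMod.natCast_val, ZMod.cast_id', id]
      ring
    · simp
  · intro a
    simp only [hC.face.lift a]
  · intro a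
    push_cast
    rw [intCast_lift]
    simp

end Affine

end KnotDiagram

namespace KnotDiagram

/-! ### Palettes on which the pairing vanishes -/

section Palette

variable {D : KnotDiagram} {p : ℕ}

/-- The pairing of a `p`-coloring with itself vanishes if its colors belong to `t`. -/
def Isotropic (p : ℕ) (t : List ℕ) : Prop :=
  ∀ (D : KnotDiagram) (C : D.Dart → ZMod p), IsCornerColoring C → (∀ a, ∃ e ∈ t, C a = (e : ℕ)) →
    pairing C C = 0

/-- The pairing of a `p`-coloring with each `p`-coloring vanishes if the colors of the first one
belong to `t`. -/
def TotallyIsotropic (p : ℕ) (t : List ℕ) : Prop :=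
  ∀ (D : KnotDiagram) (C y : D.Dart → ZMod p), IsCornerColoring C → IsCornerColoring y →
    (∀ a, ∃ e ∈ t, C a = (e : ℕ)) → pairing C y = 0

theorem TotallyIsotropic.isotropic {t : List ℕ} (h : TotallyIsotropic p t) : Isotropic p t :=
  fun D C hC => h D C C hC hC

theorem exists_val {t : List ℕ} (ht : ∀ e ∈ t, e < p) {C : D.Dart → ZMod p}
    (hC : ∀ a, ∃ e ∈ t, C a = (e : ℕ)) (a : D.Dart) : (C a).val ∈ t := by
  obtain ⟨e, he, h⟩ := hC a
  rw [h, ZMod.val_cast_of_lt (ht e he)]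
  exact he

/-- The natural number whose binary digits form the indicator function of a list. -/
def mask (l : List ℕ) : ℕ := l.foldr (fun e acc => 1 <<< e ||| acc) 0

theorem testBit_mask (l : List ℕ) (j : ℕ) : (mask l).testBit j = true ↔ j ∈ l := by
  induction l with
  | nil => simp [mask]
  | cons e l ih =>
    have : mask (e :: l) = 1 <<< e ||| mask l := rfl
    rw [this, Nat.testBit_or, Bool.or_eq_true, ih, List.mem_cons, Nat.one_shiftLeft,
      Nat.testBit_two_pow]
    simp [eq_comm]

/-- No two sums of two elements of `t` differ by `p`; the masks let the kernel decide this with a few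
operations on big numbers. -/
def noWrap (p : ℕ) (t : List ℕ) : Bool :=
  t.all (· < p) && ((mask (t.flatMap fun a => t.map (a + ·))) &&&
    (mask (t.flatMap fun a => t.map (a + ·)) >>> p)) == 0

/-- If no sums of two colors wrap around, then a coloring satisfies the crossing relations over the
integers, and the quotients in the pairing vanish. -/
theorem totallyIsotropic_of_noWrap [NeZero p] {t : List ℕ} (h : noWrap p t = true) :
    TotallyIsotropic p t := by
  intro D C y hC _ hCt
  simp only [noWrap, Bool.and_eq_true, List.all_eq_true, decide_eq_true_eq, beq_iff_eq] at h
  obtain ⟨hlt, hM⟩ := h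
  have hno : ∀ a ∈ t, ∀ b ∈ t, ∀ c ∈ t, ∀ d ∈ t, a + b ≠ c + d + p := by
    intro a ha b hb c hc d hd heq
    have hs : ∀ x ∈ t, ∀ y ∈ t, x + y ∈ t.flatMap fun a => t.map (a + ·) := fun x hx y hy =>
      List.mem_flatMap.2 ⟨x, hx, List.mem_map.2 ⟨y, hy, rfl⟩⟩
    have h1 := (testBit_mask _ _).2 (hs c hc d hd)
    have h2 := (testBit_mask _ _).2 (hs a ha b hb)
    have h3 := congrArg (fun m => Nat.testBit m (c + d)) hM
    simp only [Nat.testBit_and, Nat.testBit_shiftRight, h1, Nat.zero_testBit, Bool.true_and] at h3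
    rw [heq, add_comm] at h2
    rw [h2] at h3
    exact Bool.noConfusion h3
  have hval := exists_val hlt hCt
  refine Finset.sum_eq_zero fun a _ => ?_
  unfold pairTerm
  cases ha : D.isOver a
  · obtain ⟨k, hk⟩ := dvd_cross hC (intCast_lift C) ha
    have h1 := hno _ (hval a) _ (hval (D.rot a)) _ (hval (D.rot (D.rot (D.rot a)))) _
      (hval (D.rot (D.rot a)))
    have h2 := hno _ (hval (D.rot (D.rot (D.rot a)))) _ (hval (D.rot (D.rot a))) _ (hval a) _
      (hval (D.rot a))
    have l0 := ZMod.val_lt (C a)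
    have l1 := ZMod.val_lt (C (D.rot a))
    have l2 := ZMod.val_lt (C (D.rot (D.rot a)))
    have l3 := ZMod.val_lt (C (D.rot (D.rot (D.rot a))))
    simp only [cross, lift] at hk ⊢
    have hk0 : k = 0 := by
      rcases lt_trichotomy k 0 with h | h | h
      · have : -2 < k := by
          by_contra! hh
          have : (p : ℤ) * k ≤ p * (-2) := mul_le_mul_of_nonneg_left hh (by positivity)
          omega
        obtain rfl : k = -1 := by omega
        omega
      · exact h
      · have : k < 2 := by
          by_contra! hh
          have : (p : ℤ) * 2 ≤ p * k := mul_le_mul_of_nonneg_left hh (by positivity)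
          omega
        obtain rfl : k = 1 := by omega
        omega
    rw [hk, hk0]
    simp
  · simp

/-- The antisymmetric function on pairs of colors with the given values. -/
def skew (g : List (ℕ × ℕ × ℤ)) (a b : ℕ) : ℤ :=
  g.foldr (fun v s => (if v.1 = a ∧ v.2.1 = b then v.2.2 else 0) -
    (if v.1 = b ∧ v.2.1 = a then v.2.2 else 0) + s) 0

theorem skew_swap (g : List (ℕ × ℕ × ℤ)) (a b : ℕ) : skew g b a = -skew g a b := by
  induction g with
  | nil => rfl
  | cons v g ih =>
    have : ∀ a b, skew (v :: g) a b = (if v.1 = a ∧ v.2.1 = b then v.2.2 else 0) -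
      (if v.1 = b ∧ v.2.1 = a then v.2.2 else 0) + skew g a b := fun _ _ => rfl
    rw [this, this, ih]; ring

/-- The terms of the pairing of a coloring with itself, with colors in `t`, form the coboundary of
a function of the colors on the two sides of a semiarc. -/
def HasPotential (p : ℕ) (t : List ℕ) (g : List (ℕ × ℕ × ℤ)) : Prop :=
  (∀ e ∈ t, e < p) ∧ ∀ a ∈ t, ∀ b ∈ t, ∀ c ∈ t, ∀ d ∈ t,
    (((a : ℤ) + b - c - d) % p = 0) → ((((a : ℤ) + b - c - d) / p) * (a - d) -
      (skew g a c + skew g b a + skew g d b + skew g c d)) % p = 0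

instance (p : ℕ) (t : List ℕ) (g : List (ℕ × ℕ × ℤ)) : Decidable (HasPotential p t g) :=
  inferInstanceAs (Decidable (_ ∧ _))

theorem HasPotential.isotropic [NeZero p] {t : List ℕ} {g : List (ℕ × ℕ × ℤ)}
    (h : HasPotential p t g) : Isotropic p t := by
  intro D C hC hCt
  have hval := exists_val h.1 hCt
  refine liftPairing_eq_zero
    (fun a => ((skew g (C a).val (C (D.rot (D.rot (D.rot a)))).val : ℤ) : ZMod p)) ?_ ?_
  · intro a
    rw [hC.face.edge, hC.face.rot_edge, skew_swap]; push_cast; ring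
  · intro a ha
    have h1 := h.2 _ (hval a) _ (hval (D.rot a)) _ (hval (D.rot (D.rot (D.rot a)))) _
      (hval (D.rot (D.rot a))) (Int.emod_eq_zero_of_dvd (dvd_cross hC (intCast_lift C) ha))
    have h2 := (ZMod.intCast_zmod_eq_zero_iff_dvd _ p).2 (Int.dvd_of_emod_eq_zero h1)
    simp only [rot_rot_rot_rot]
    push_cast at h2
    simp only [ZMod.natCast_zmod_val] at h2
    have h3 : (((cross (lift C) a) / p : ℤ) : ZMod p) = ((((((C a).val : ℕ) : ℤ) +
      (C (D.rot a)).val - (C (D.rot (D.rot (D.rot a)))).val - (C (D.rot (D.rot a))).val) / p : ℤ) :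
        ZMod p) := rfl
    rw [h3]
    linear_combination h2

/-- The function on pairs of colors with the given values, zero elsewhere. -/
def table (g : List (ℕ × ℕ × ℤ)) (a b : ℕ) : ℤ :=
  g.foldr (fun v s => (if v.1 = a ∧ v.2.1 = b then v.2.2 else 0) + s) 0

/-- The terms of the pairing of a coloring, with colors in `t`, with any coloring `y` form the
coboundary of a function of the two sides of a semiarc that is linear in `y`: the values `y₁` and
`y₂` on a semiarc with colors `a` and `c` contribute `α a c * y₁ - α c a * y₂`.  The three
conditions say that the resulting linear form is a multiple of `y₁ + y₃ - y₂ - y₄`. -/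
def HasLinearPotential (p : ℕ) (t : List ℕ) (g : List (ℕ × ℕ × ℤ)) : Prop :=
  (∀ e ∈ t, e < p) ∧ ∀ a ∈ t, ∀ b ∈ t, ∀ c ∈ t, ∀ d ∈ t,
    (((a : ℤ) + b - c - d) % p = 0) →
      (table g a c - table g a b - ((a : ℤ) + b - c - d) / p +
        (table g c d - table g c a)) % p = 0 ∧
      (table g b a - table g b d + (table g c d - table g c a)) % p = 0 ∧
      (table g d b - table g d c + ((a : ℤ) + b - c - d) / p -
        (table g c d - table g c a)) % p = 0

instance (p : ℕ) (t : List ℕ) (g : List (ℕ × ℕ × ℤ)) : Decidable (HasLinearPotential p t g) :=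
  inferInstanceAs (Decidable (_ ∧ _))

theorem HasLinearPotential.totallyIsotropic [NeZero p] {t : List ℕ} {g : List (ℕ × ℕ × ℤ)}
    (h : HasLinearPotential p t g) : TotallyIsotropic p t := by
  intro D C y hC hy hCt
  have hval := exists_val h.1 hCt
  refine liftPairing_eq_zero
    (fun a => ((table g (C a).val (C (D.rot (D.rot (D.rot a)))).val : ℤ) : ZMod p) * y a -
      ((table g (C (D.rot (D.rot (D.rot a)))).val (C a).val : ℤ) : ZMod p) *
        y (D.rot (D.rot (D.rot a)))) ?_ ?_
  · intro a
    rw [hC.face.edge, hC.face.rot_edge, hy.face.edge, hy.face.rot_edge]; ring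
  · intro a ha
    obtain ⟨h1, h2, h3⟩ := h.2 _ (hval a) _ (hval (D.rot a)) _ (hval (D.rot (D.rot (D.rot a)))) _
      (hval (D.rot (D.rot a))) (Int.emod_eq_zero_of_dvd (dvd_cross hC (intCast_lift C) ha))
    have e1 := (ZMod.intCast_zmod_eq_zero_iff_dvd _ p).2 (Int.dvd_of_emod_eq_zero h1)
    have e2 := (ZMod.intCast_zmod_eq_zero_iff_dvd _ p).2 (Int.dvd_of_emod_eq_zero h2)
    have e3 := (ZMod.intCast_zmod_eq_zero_iff_dvd _ p).2 (Int.dvd_of_emod_eq_zero h3)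
    simp only [rot_rot_rot_rot]
    have h4 : (((cross (lift C) a) / p : ℤ) : ZMod p) = ((((((C a).val : ℕ) : ℤ) +
      (C (D.rot a)).val - (C (D.rot (D.rot (D.rot a)))).val - (C (D.rot (D.rot a))).val) / p : ℤ) :
        ZMod p) := rfl
    rw [h4]
    rw [Int.cast_add, Int.cast_sub, Int.cast_sub, Int.cast_sub] at e1
    rw [Int.cast_add, Int.cast_sub, Int.cast_sub] at e2
    rw [Int.cast_sub, Int.cast_add, Int.cast_sub, Int.cast_sub] at e3
    have hs := hy.sub_eq ha
    linear_combination -(y a) * e1 - y (D.rot a) * e2 - y (D.rot (D.rot a)) * e3 +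
      (((table g (C (D.rot (D.rot (D.rot a)))).val (C (D.rot (D.rot a))).val : ℤ) : ZMod p) -
        ((table g (C (D.rot (D.rot (D.rot a)))).val (C a).val : ℤ) : ZMod p)) * hs

end Palette

/-! ### Covering all small palettes by affine images of a few -/

section Cover

variable {p : ℕ}

/-- Rotation of a block of `p` binary digits. -/
def rotateBits (p x b : ℕ) : ℕ := (b <<< x ||| b >>> (p - x)) % 2 ^ p

/-- The rotations by `x` of all blocks, one after the other. -/
def rotatedBlocks (p : ℕ) (bs : List ℕ) (x : ℕ) : ℕ :=
  bs.foldr (fun b acc => rotateBits p x b ||| acc <<< p) 0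

theorem testBit_rotatedBlocks (bs : List ℕ) (i : ℕ) : ∃ b μ, ∀ x,
    (rotatedBlocks p bs x).testBit i = true →
      b ∈ bs ∧ μ < p ∧ (rotateBits p x b).testBit μ = true := by
  induction bs generalizing i with
  | nil => exact ⟨0, 0, fun x h => by simp [rotatedBlocks] at h⟩
  | cons b bs ih =>
    have hcons : ∀ x, rotatedBlocks p (b :: bs) x =
      rotateBits p x b ||| rotatedBlocks p bs x <<< p := fun _ => rfl
    by_cases hi : i < p
    · refine ⟨b, i, fun x h => ⟨List.mem_cons_self, hi, ?_⟩⟩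
      rw [hcons, Nat.testBit_or, Nat.testBit_shiftLeft] at h
      simpa [hi, not_le.2 hi] using h
    · obtain ⟨b', μ, h'⟩ := ih (i - p)
      refine ⟨b', μ, fun x h => ?_⟩
      rw [hcons, Nat.testBit_or, Nat.testBit_shiftLeft, rotateBits, Nat.testBit_mod_two_pow] at h
      simp only [hi, decide_false, Bool.false_and, Bool.false_or, Bool.and_eq_true] at h
      obtain ⟨h1, h2⟩ := h' x h.2
      exact ⟨List.mem_cons_of_mem _ h1, h2⟩

/-- The multiples of the palettes in a list. -/
def multiples (p : ℕ) (ts : List (List ℕ)) : List ℕ :=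
  ts.flatMap fun t => (List.range (p - 1)).map fun l => mask (t.map fun e => (l + 1) * e % p)

/-- The incidence between colors and affine images of palettes, as one big number for each color.
The color `x` belongs to the affine image number `i` of the palettes `ts` if and only if the
digit number `i` of this number is one. -/
def incidence (p : ℕ) (ts : List (List ℕ)) : ℕ → ℕ := rotatedBlocks p (multiples p ts)

theorem testBit_incidence [Fact p.Prime] (ts : List (List ℕ)) (i : ℕ) :
    ∃ t, ∃ α β : ZMod p, α ≠ 0 ∧ ∀ x < p, (incidence p ts x).testBit i = true →
      t ∈ ts ∧ ∃ e ∈ t, α * x + β = (e : ℕ) := by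
  obtain ⟨b, μ, h⟩ := testBit_rotatedBlocks (p := p) (multiples p ts) i
  by_cases hb : b ∈ multiples p ts
  · simp only [multiples, List.mem_flatMap, List.mem_map, List.mem_range] at hb
    obtain ⟨t, ht, l, hl, rfl⟩ := hb
    have hl0 : ((l + 1 : ℕ) : ZMod p) ≠ 0 := by
      rw [Ne, ZMod.natCast_eq_zero_iff]
      exact Nat.not_dvd_of_pos_of_lt l.succ_pos (by omega)
    refine ⟨t, -((l + 1 : ℕ) : ZMod p)⁻¹, ((l + 1 : ℕ) : ZMod p)⁻¹ * μ,
      neg_ne_zero.2 (inv_ne_zero hl0), fun x hx hbit => ⟨ht, ?_⟩⟩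
    obtain ⟨-, hμ, hbit⟩ := h x hbit
    rw [rotateBits, Nat.testBit_mod_two_pow, Nat.testBit_or, Nat.testBit_shiftLeft,
      Nat.testBit_shiftRight, Bool.and_eq_true, Bool.or_eq_true, Bool.and_eq_true, testBit_mask,
      testBit_mask, decide_eq_true_eq, List.mem_map, List.mem_map] at hbit
    have key : ∀ e, (((l + 1) * e % p : ℕ) : ZMod p) = μ - x →
        -((l + 1 : ℕ) : ZMod p)⁻¹ * x + ((l + 1 : ℕ) : ZMod p)⁻¹ * μ = (e : ℕ) := by
      intro e he
      rw [ZMod.natCast_mod, Nat.cast_mul] at he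
      have : (e : ZMod p) = ((l + 1 : ℕ) : ZMod p)⁻¹ * (((l + 1 : ℕ) : ZMod p) * e) := by
        rw [inv_mul_cancel_left₀ hl0]
      rw [this, he]; ring
    obtain ⟨-, ⟨hle, e, he, heq⟩ | ⟨e, he, heq⟩⟩ := hbit
    · refine ⟨e, he, key e ?_⟩
      rw [heq, Nat.cast_sub (by simpa using hle)]
    · refine ⟨e, he, key e ?_⟩
      rw [heq, Nat.cast_add, Nat.cast_sub hx.le]
      simp
      ring
  · exact ⟨[], 1, 0, one_ne_zero, fun x _ hx => absurd (h x hx).1 hb⟩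

/-- A search over sets, from the largest number downwards, with `B` the digits common to the numbers
chosen so far: each set of at most `k` numbers `x` with `2 ≤ x < n + 2` has a common digit one in `B` and the
`A x`. -/
def covers (A : ℕ → ℕ) : ℕ → ℕ → ℕ → Bool
  | 0, _, B => B != 0
  | _ + 1, 0, B => B != 0
  | n + 1, k + 1, B => covers A n (k + 1) B && covers A n k (B &&& A (n + 2))

theorem exists_testBit_of_covers {A : ℕ → ℕ} : ∀ {n k B : ℕ}, covers A n k B = true →
    ∀ T : Finset ℕ, (∀ x ∈ T, 2 ≤ x ∧ x < n + 2) → T.card ≤ k →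
      ∃ i, B.testBit i = true ∧ ∀ x ∈ T, (A x).testBit i = true := by
  have h0 : ∀ {B : ℕ}, (B != 0) = true → ∃ i, B.testBit i = true := by
    intro B hB
    exact Nat.exists_testBit_of_ne_zero (by simpa using hB)
  intro n
  induction n with
  | zero =>
    intro k B h T hT _
    obtain ⟨i, hi⟩ := h0 (B := B) (by simpa [covers] using h)
    exact ⟨i, hi, fun x hx => by have := hT x hx; omega⟩
  | succ n ih =>
    intro k B h T hT hk
    cases k with
    | zero =>
      obtain ⟨i, hi⟩ := h0 (B := B) (by simpa [covers] using h)
      obtain rfl := Finset.card_eq_zero.1 (Nat.le_zero.1 hk)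
      exact ⟨i, hi, fun x hx => absurd hx (Finset.notMem_empty x)⟩
    | succ k =>
      rw [covers, Bool.and_eq_true] at h
      by_cases hn : n + 2 ∈ T
      · obtain ⟨i, hi, hT'⟩ := ih h.2 (T.erase (n + 2))
          (fun x hx => by
            have h1 := hT x (Finset.mem_of_mem_erase hx)
            have h2 := Finset.ne_of_mem_erase hx
            omega)
          (by rw [Finset.card_erase_of_mem hn]; omega)
        rw [Nat.testBit_and, Bool.and_eq_true] at hi
        refine ⟨i, hi.1, fun x hx => ?_⟩
        by_cases hxn : x = n + 2
        · rw [hxn]; exact hi.2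
        · exact hT' x (Finset.mem_erase.2 ⟨hxn, hx⟩)
      · refine ih h.1 T (fun x hx => ?_) hk
        have h1 := hT x hx
        have h2 : x ≠ n + 2 := fun h => hn (h ▸ hx)
        omega

/-- Each palette of at most `k + 2` colors is contained in an affine image of one of the palettes
`ts`.  Up to an affine change, two of the colors are `0` and `1`. -/
def CoversPalettes (p k : ℕ) (ts : List (List ℕ)) : Prop :=
  covers (incidence p ts) (p - 2) k (incidence p ts 0 &&& incidence p ts 1) = true

instance (p k : ℕ) (ts : List (List ℕ)) : Decidable (CoversPalettes p k ts) :=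
  inferInstanceAs (Decidable (_ = _))

theorem CoversPalettes.exists_affine [Fact p.Prime] {k : ℕ} {ts : List (List ℕ)}
    (h : CoversPalettes p k ts) {S : Finset (ZMod p)} (h0 : 0 ∈ S) (h1 : 1 ∈ S)
    (hS : S.card ≤ k + 2) :
    ∃ t ∈ ts, ∃ α β : ZMod p, α ≠ 0 ∧ ∀ x ∈ S, ∃ e ∈ t, α * x + β = (e : ℕ) := by
  have hp2 : 2 ≤ p := (Fact.out : p.Prime).two_le
  have hp1 : Fact (1 < p) := ⟨hp2⟩
  have hinj : Function.Injective (ZMod.val : ZMod p → ℕ) := ZMod.val_injective p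
  obtain ⟨i, hi, hT⟩ := exists_testBit_of_covers h (((S.image ZMod.val).erase 0).erase 1)
    (fun x hx => by
      simp only [Finset.mem_erase, Finset.mem_image] at hx
      obtain ⟨hx1, hx0, y, -, rfl⟩ := hx
      have := ZMod.val_lt y
      omega)
    (by
      have e0 : 0 ∈ S.image ZMod.val := Finset.mem_image.2 ⟨0, h0, ZMod.val_zero⟩
      have e1 : 1 ∈ (S.image ZMod.val).erase 0 :=
        Finset.mem_erase.2 ⟨one_ne_zero, Finset.mem_image.2 ⟨1, h1, ZMod.val_one p⟩⟩
      rw [Finset.card_erase_of_mem e1, Finset.card_erase_of_mem e0,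
        Finset.card_image_of_injective _ hinj]
      omega)
  rw [Nat.testBit_and, Bool.and_eq_true] at hi
  obtain ⟨t, α, β, hα, hx⟩ := testBit_incidence (p := p) ts i
  refine ⟨t, (hx 0 (by omega) hi.1).1, α, β, hα, fun x hxS => ?_⟩
  have hbit : (incidence p ts x.val).testBit i = true := by
    by_cases e0 : x.val = 0
    · rw [e0]; exact hi.1
    · by_cases e1 : x.val = 1
      · rw [e1]; exact hi.2
      · exact hT _ (Finset.mem_erase.2 ⟨e1, Finset.mem_erase.2 ⟨e0,
          Finset.mem_image_of_mem _ hxS⟩⟩)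
  have := (hx _ (ZMod.val_lt x) hbit).2
  rwa [ZMod.natCast_zmod_val] at this

theorem CoversPalettes.exists_affine_coloring [Fact p.Prime] {k : ℕ} {ts : List (List ℕ)}
    (h : CoversPalettes p k ts) {D : KnotDiagram} {C : D.Dart → ZMod p}
    (hn : NontrivialCorners C) (hk : (Set.range C).ncard ≤ k + 2) :
    ∃ t ∈ ts, ∃ α β : ZMod p, α ≠ 0 ∧ ∀ a, ∃ e ∈ t, α * C a + β = (e : ℕ) := by
  classical
  obtain ⟨a, -, hne⟩ := hn
  set u := C (D.rot a)
  set v := C (D.rot (D.rot (D.rot a)))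
  have huv : v - u ≠ 0 := sub_ne_zero.2 (Ne.symm hne)
  let φ : ZMod p → ZMod p := fun x => (v - u)⁻¹ * (x - u)
  have hcard : (Finset.univ.image C).card ≤ k + 2 := by
    rwa [← Set.ncard_coe_finset, Finset.coe_image, Finset.coe_univ, Set.image_univ]
  obtain ⟨t, ht, α, β, hα, hx⟩ := h.exists_affine (S := (Finset.univ.image C).image φ)
    (Finset.mem_image.2 ⟨u, Finset.mem_image_of_mem _ (Finset.mem_univ _), by simp [φ]⟩)
    (Finset.mem_image.2 ⟨v, Finset.mem_image_of_mem _ (Finset.mem_univ _), by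
      simp [φ, inv_mul_cancel₀ huv]⟩)
    (Finset.card_image_le.trans hcard)
  refine ⟨t, ht, α * (v - u)⁻¹, β - α * (v - u)⁻¹ * u, mul_ne_zero hα (inv_ne_zero huv),
    fun a => ?_⟩
  obtain ⟨e, he, heq⟩ := hx (φ (C a))
    (Finset.mem_image_of_mem _ (Finset.mem_image_of_mem _ (Finset.mem_univ _)))
  exact ⟨e, he, by rw [← heq]; simp only [φ]; ring⟩

theorem CoversPalettes.pairing_self [Fact p.Prime] {k : ℕ} {ts : List (List ℕ)}
    (h : CoversPalettes p k ts) (hts : ∀ t ∈ ts, Isotropic p t) {D : KnotDiagram}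
    {C : D.Dart → ZMod p} (hC : IsCornerColoring C) (hn : NontrivialCorners C)
    (hk : (Set.range C).ncard ≤ k + 2) : pairing C C = 0 := by
  obtain ⟨t, ht, α, β, hα, ha⟩ := h.exists_affine_coloring hn hk
  have := hts t ht D _ (hC.affine α β) ha
  rw [pairing_affine_left hC (hC.affine α β), pairing_affine_right] at this
  simpa [hα] using this

theorem CoversPalettes.pairing_eq_zero [Fact p.Prime] {k : ℕ} {ts : List (List ℕ)}
    (h : CoversPalettes p k ts) (hts : ∀ t ∈ ts, TotallyIsotropic p t) {D : KnotDiagram}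
    {C y : D.Dart → ZMod p} (hC : IsCornerColoring C) (hy : IsCornerColoring y)
    (hn : NontrivialCorners C) (hk : (Set.range C).ncard ≤ k + 2) : pairing C y = 0 := by
  obtain ⟨t, ht, α, β, hα, ha⟩ := h.exists_affine_coloring hn hk
  have := hts t ht D _ y (hC.affine α β) hy ha
  rw [pairing_affine_left hC hy] at this
  simpa [hα] using this

end Cover

end KnotDiagram

namespace KnotDiagram

/-! ### The palettes for each prime -/

section Primes

/-- The palettes that together cover, for a given prime, all palettes with few colors: the first
ones are paired with potentials, the other ones have no wrapping sums. -/
structure PaletteSystem where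
  withPotential : List (List ℕ × List (ℕ × ℕ × ℤ))
  withoutWrap : List (List ℕ)

/-- All palettes of a system, together with the lower half of the residues, which has no wrapping
sums either. -/
def PaletteSystem.palettes (s : PaletteSystem) (p : ℕ) : List (List ℕ) :=
  List.range ((p + 1) / 2) :: s.withoutWrap ++ s.withPotential.map Prod.fst

theorem PaletteSystem.isotropic {s : PaletteSystem} {p : ℕ} [NeZero p]
    (h : ∀ t ∈ List.range ((p + 1) / 2) :: s.withoutWrap, noWrap p t = true)
    (h' : ∀ v ∈ s.withPotential, HasPotential p v.1 v.2) :
    ∀ t ∈ s.palettes p, Isotropic p t := by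
  intro t ht
  rcases List.mem_append.1 ht with ht | ht
  · exact (totallyIsotropic_of_noWrap (h t ht)).isotropic
  · obtain ⟨v, hv, rfl⟩ := List.mem_map.1 ht
    exact (h' v hv).isotropic

theorem PaletteSystem.totallyIsotropic {s : PaletteSystem} {p : ℕ} [NeZero p]
    (h : ∀ t ∈ List.range ((p + 1) / 2) :: s.withoutWrap, noWrap p t = true)
    (h' : ∀ v ∈ s.withPotential, HasLinearPotential p v.1 v.2) :
    ∀ t ∈ s.palettes p, TotallyIsotropic p t := by
  intro t ht
  rcases List.mem_append.1 ht with ht | ht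
  · exact totallyIsotropic_of_noWrap (h t ht)
  · obtain ⟨v, hv, rfl⟩ := List.mem_map.1 ht
    exact (h' v hv).totallyIsotropic

/-- Palettes modulo 7, with potentials for the self-pairing. -/
def sevenPalettes : PaletteSystem where
  withPotential :=
    [([0, 1, 2, 4], [(0, 1, 3), (1, 2, 4)])]
  withoutWrap :=
    []

theorem pairing_self_of_seven [Fact (Nat.Prime 7)] {D : KnotDiagram} {C : D.Dart → ZMod 7}
    (hC : IsCornerColoring C) (hn : NontrivialCorners C) (hk : (Set.range C).ncard ≤ 4) :
    pairing C C = 0 :=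
  CoversPalettes.pairing_self (k := 2) (ts := sevenPalettes.palettes 7) (by decide +kernel)
    (PaletteSystem.isotropic (by decide +kernel) (by decide +kernel)) hC hn hk

/-- Palettes modulo 11, with potentials for the self-pairing. -/
def elevenPalettes : PaletteSystem where
  withPotential :=
    [([0, 1, 2, 3, 6], [(0, 1, 5), (1, 2, 6), (1, 3, 6)]), ([0, 1, 2, 4, 7], [(0, 1, 2), (0, 2,
    7), (0, 4, 7), (1, 2, 5)])]
  withoutWrap :=
    [[0, 2, 3, 4, 6]]

theorem pairing_self_of_eleven [Fact (Nat.Prime 11)] {D : KnotDiagram} {C : D.Dart → ZMod 11}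
    (hC : IsCornerColoring C) (hn : NontrivialCorners C) (hk : (Set.range C).ncard ≤ 5) :
    pairing C C = 0 :=
  CoversPalettes.pairing_self (k := 3) (ts := elevenPalettes.palettes 11) (by decide +kernel)
    (PaletteSystem.isotropic (by decide +kernel) (by decide +kernel)) hC hn hk

/-- Palettes modulo 13, with potentials for the self-pairing. -/
def thirteenPalettes : PaletteSystem where
  withPotential :=
    [([0, 1, 2, 4, 7], [(0, 1, 6), (0, 2, 6), (0, 4, 6)])]
  withoutWrap :=
    [[0, 2, 3, 4, 5, 7]]

theorem pairing_self_of_thirteen [Fact (Nat.Prime 13)] {D : KnotDiagram} {C : D.Dart → ZMod 13}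
    (hC : IsCornerColoring C) (hn : NontrivialCorners C) (hk : (Set.range C).ncard ≤ 5) :
    pairing C C = 0 :=
  CoversPalettes.pairing_self (k := 3) (ts := thirteenPalettes.palettes 13) (by decide +kernel)
    (PaletteSystem.isotropic (by decide +kernel) (by decide +kernel)) hC hn hk

/-- Palettes modulo 19, with potentials for the self-pairing. -/
def nineteenPalettes : PaletteSystem where
  withPotential :=
    [([0, 1, 2, 3, 5, 10], [(0, 1, 9), (1, 2, 10), (1, 3, 10), (1, 5, 10)]), ([0, 1, 2, 3, 6,
    10], [(0, 1, 9), (0, 2, 9), (0, 3, 9), (0, 6, 9)]), ([0, 1, 2, 3, 6, 11], [(0, 1, 18), (0, 2,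
    8), (0, 3, 8), (0, 6, 8), (1, 2, 9), (1, 3, 9)]), ([0, 1, 2, 3, 6, 12], [(0, 2, 10), (1, 2,
    10), (2, 3, 9)]), ([0, 1, 2, 3, 6, 13], [(0, 1, 13), (0, 2, 13), (0, 3, 13), (0, 6, 13), (1,
    6, 7)]), ([0, 1, 2, 3, 6, 14], [(0, 1, 13), (0, 6, 8), (1, 2, 6), (1, 3, 6), (3, 6, 8)]),
    ([0, 1, 2, 3, 7, 12], [(0, 2, 10), (0, 7, 12), (1, 2, 10), (2, 3, 9)]), ([0, 1, 2, 4, 5, 10],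
    [(0, 1, 9), (1, 2, 10), (1, 4, 10), (1, 5, 10)]), ([0, 1, 2, 4, 5, 14], [(0, 1, 14), (0, 2,
    14), (0, 4, 5), (0, 5, 14), (1, 4, 10), (2, 4, 10), (4, 5, 9)]), ([0, 1, 2, 4, 7, 11], [(0,
    1, 10), (1, 2, 9)]), ([0, 1, 2, 4, 7, 12], [(0, 7, 12), (1, 4, 8), (1, 7, 8)]), ([0, 1, 2, 4,
    7, 15], [(0, 1, 2), (0, 2, 15), (0, 4, 15), (1, 2, 13), (1, 7, 8), (4, 7, 8)])]
  withoutWrap :=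
    [[0, 2, 3, 4, 5, 6, 7, 8, 10], [0, 2, 4, 5, 6, 7, 9, 11], [0, 3, 4, 6, 8, 9, 12], [0, 4, 6,
    7, 8, 10, 14], [0, 1, 4, 5, 6, 7, 11]]

theorem pairing_self_of_nineteen [Fact (Nat.Prime 19)] {D : KnotDiagram} {C : D.Dart → ZMod 19}
    (hC : IsCornerColoring C) (hn : NontrivialCorners C) (hk : (Set.range C).ncard ≤ 6) :
    pairing C C = 0 :=
  CoversPalettes.pairing_self (k := 4) (ts := nineteenPalettes.palettes 19) (by decide +kernel)
    (PaletteSystem.isotropic (by decide +kernel) (by decide +kernel)) hC hn hk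

/-- Palettes modulo 23, with potentials for the self-pairing. -/
def twentyThreePalettes : PaletteSystem where
  withPotential :=
    [([0, 1, 2, 3, 6, 12], [(0, 1, 11), (1, 2, 12), (1, 3, 12)]), ([0, 1, 2, 4, 7, 12], [(0, 1,
    11), (0, 2, 11), (0, 4, 11)]), ([0, 1, 2, 4, 7, 13], [(0, 1, 12), (1, 2, 11)]), ([0, 1, 2, 4,
    7, 14], [(1, 4, 10), (1, 7, 10)]), ([0, 1, 2, 4, 7, 17], [(0, 1, 16), (0, 2, 16), (0, 4, 16),
    (0, 7, 10), (1, 4, 13), (4, 7, 10)]), ([0, 1, 2, 4, 9, 14], [(0, 9, 14), (1, 4, 10)]), ([0,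
    1, 2, 4, 10, 19], [(0, 1, 4), (0, 2, 4), (0, 4, 19), (2, 4, 15), (2, 10, 9)])]
  withoutWrap :=
    [[0, 2, 3, 4, 5, 6, 7, 8, 9, 10, 12], [0, 2, 4, 6, 7, 8, 10, 12, 14], [0, 2, 3, 4, 8, 16],
    [0, 1, 4, 5, 6, 7, 8, 9, 13], [0, 3, 4, 6, 7, 8, 10, 11, 14], [0, 2, 4, 5, 6, 7, 8, 9, 11,
    13]]

theorem pairing_self_of_twentyThree [Fact (Nat.Prime 23)] {D : KnotDiagram} {C : D.Dart → ZMod 23}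
    (hC : IsCornerColoring C) (hn : NontrivialCorners C) (hk : (Set.range C).ncard ≤ 6) :
    pairing C C = 0 :=
  CoversPalettes.pairing_self (k := 4) (ts := twentyThreePalettes.palettes 23) (by decide +kernel)
    (PaletteSystem.isotropic (by decide +kernel) (by decide +kernel)) hC hn hk

/-- Palettes modulo 31, with potentials for the self-pairing. -/
def thirtyOnePalettes : PaletteSystem where
  withPotential :=
    [([0, 1, 2, 4, 8, 16], [(0, 1, 15), (1, 2, 16)])]
  withoutWrap :=
    [[0, 2, 3, 4, 5, 6, 7, 8, 9, 10, 11, 12, 13, 14, 16], [0, 1, 4, 5, 6, 7, 8, 9, 10, 11, 12,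
    13, 17]]

theorem pairing_self_of_thirtyOne [Fact (Nat.Prime 31)] {D : KnotDiagram} {C : D.Dart → ZMod 31}
    (hC : IsCornerColoring C) (hn : NontrivialCorners C) (hk : (Set.range C).ncard ≤ 6) :
    pairing C C = 0 :=
  CoversPalettes.pairing_self (k := 4) (ts := thirtyOnePalettes.palettes 31) (by decide +kernel)
    (PaletteSystem.isotropic (by decide +kernel) (by decide +kernel)) hC hn hk

/-- Palettes modulo 29.  The potential is linear: it makes the pairing with every coloring vanish.
Self-pairings would not suffice, as the self-pairing of `twentyNineColors` is zero. -/
def twentyNinePalettes : PaletteSystem where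
  withPotential :=
    [([0, 1, 2, 4, 8, 15], [(0, 0, 1), (0, 2, -1), (0, 4, -3), (0, 8, -7), (1, 0, 1), (1, 2, -1),
    (2, 0, 2), (2, 1, 1), (2, 4, -2), (4, 0, 4), (4, 2, 2), (4, 8, -4), (8, 0, 8), (8, 4, 4),
    (15, 0, 1)])]
  withoutWrap :=
    [[0, 2, 4, 5, 6, 7, 8, 9, 10, 11, 12, 14, 16], [0, 2, 3, 4, 5, 6, 7, 8, 9, 10, 11, 12, 13,
    15]]

theorem pairing_eq_zero_of_twentyNine [Fact (Nat.Prime 29)] {D : KnotDiagram}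
    {C y : D.Dart → ZMod 29} (hC : IsCornerColoring C) (hy : IsCornerColoring y)
    (hn : NontrivialCorners C) (hk : (Set.range C).ncard ≤ 6) : pairing C y = 0 :=
  CoversPalettes.pairing_eq_zero (k := 4) (ts := twentyNinePalettes.palettes 29) (by decide +kernel)
    (PaletteSystem.totallyIsotropic (by decide +kernel) (by decide +kernel)) hC hy hn hk

end Primes

end KnotDiagram

namespace KnotDiagram

/-! ### Linearity of the pairing -/

section Linear

variable {D : KnotDiagram} {p : ℕ}

theorem IsCornerColoring.add {C C' : D.Dart → ZMod p} (hC : IsCornerColoring C)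
    (hC' : IsCornerColoring C') : IsCornerColoring fun a => C a + C' a where
  face a := by simp only [hC.face a, hC'.face a]
  cross_eq a ha := by
    have h1 := hC.cross_eq a ha
    have h2 := hC'.cross_eq a ha
    simp only [cross] at h1 h2 ⊢
    linear_combination h1 + h2

theorem IsCornerColoring.mul {C : D.Dart → ZMod p} (hC : IsCornerColoring C) (α : ZMod p) :
    IsCornerColoring fun a => α * C a := by
  simpa using hC.affine α 0

theorem pairing_add_left [NeZero p] {C C' y : D.Dart → ZMod p} (hC : IsCornerColoring C)
    (hC' : IsCornerColoring C') (hy : IsCornerColoring y) :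
    pairing (fun a => C a + C' a) y = pairing C y + pairing C' y := by
  rw [← liftPairing_eq_pairing (hC.add hC') hy (X := fun a => lift C a + lift C' a)]
  · unfold pairing liftPairing
    rw [← Finset.sum_add_distrib]
    refine Finset.sum_congr rfl fun a _ => ?_
    unfold pairTerm
    cases ha : D.isOver a
    · rw [cross_add, Int.add_ediv_of_dvd_left (dvd_cross hC (intCast_lift C) ha)]
      push_cast
      ring
    · simp
  · intro a
    show lift C _ + lift C' _ = _
    rw [hC.face.lift a, hC'.face.lift a]
  · intro a
    push_cast
    rw [intCast_lift, intCast_lift]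

theorem pairing_mul_left [NeZero p] {C y : D.Dart → ZMod p} (hC : IsCornerColoring C)
    (hy : IsCornerColoring y) (α : ZMod p) :
    pairing (fun a => α * C a) y = α * pairing C y := by
  simpa using pairing_affine_left hC hy α 0

theorem pairing_add_right (C y y' : D.Dart → ZMod p) :
    pairing C (fun a => y a + y' a) = pairing C y + pairing C y' := by
  unfold pairing liftPairing pairTerm
  rw [← Finset.sum_add_distrib]
  refine Finset.sum_congr rfl fun a _ => ?_
  split_ifs <;> ring

theorem pairing_mul_right (C y : D.Dart → ZMod p) (α : ZMod p) :
    pairing C (fun a => α * y a) = α * pairing C y := by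
  simpa using pairing_affine_right C y α 0

/-- The indicator function of one class of a checkerboard coloring of the regions. -/
def IsChecker (s : D.Dart → ℕ) : Prop :=
  FaceInvariant s ∧ ∀ a, s (D.rot (D.rot a)) = s a

theorem IsChecker.cross_eq {A : Type*} [AddCommGroup A] {s : D.Dart → ℕ} (hs : IsChecker s)
    (φ : ℕ → A) (a : D.Dart) : cross (fun a => φ (s a)) a = 0 := by
  simp only [cross, hs.2]; abel

theorem IsChecker.isCornerColoring {s : D.Dart → ℕ} (hs : IsChecker s) :
    IsCornerColoring fun a => (s a : ZMod p) where
  face a := by simp only [hs.1 a]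
  cross_eq a _ := hs.cross_eq _ a

theorem IsChecker.pairing_left [NeZero p] {s : D.Dart → ℕ} (hs : IsChecker s)
    {y : D.Dart → ZMod p} (hy : IsCornerColoring y) :
    pairing (fun a => (s a : ZMod p)) y = 0 := by
  rw [← liftPairing_eq_pairing hs.isCornerColoring hy (X := fun a => (s a : ℤ))]
  · refine Finset.sum_eq_zero fun a _ => ?_
    simp [pairTerm, hs.cross_eq fun n : ℕ => (n : ℤ)]
  · intro a
    simp only [hs.1 a]
  · intro a
    simp

theorem IsChecker.pairing_right {s : D.Dart → ℕ} (hs : IsChecker s) (C : D.Dart → ZMod p) :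
    pairing C (fun a => (s a : ZMod p)) = 0 :=
  Finset.sum_eq_zero fun a _ => by simp [pairTerm, hs.2]

end Linear

/-! ### Diagrams given by lists -/

section Code

/-- A list-based description of a diagram with `n` crossings.  The darts are the numbers below
`4 n`, those of crossing `c` being `4 c, 4 c + 1, 4 c + 2, 4 c + 3` in counterclockwise order, the
odd ones on the over-strand.  The lists give the other half of the semiarc of a dart, the number of
this semiarc and the number of the region of the corner of a dart. -/
structure PlanarCode where
  n : ℕ
  edges : List ℕ
  arcs : List ℕ
  regions : List ℕ

namespace PlanarCode

variable (c : PlanarCode)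

def turn (i a : ℕ) : ℕ := 4 * (a / 4) + (a + i) % 4

def edgeFun (a : ℕ) : ℕ := c.edges.getD a 0

def arcFun (a : ℕ) : ℕ := c.arcs.getD a 0

def regionFun (a : ℕ) : ℕ := c.regions.getD a 0

def faceFun (a : ℕ) : ℕ := turn 3 (c.edgeFun a)

def strandFun (a : ℕ) : ℕ := turn 2 (c.edgeFun a)

/-- The lists describe a one-component diagram on the sphere. -/
def Valid : Prop :=
  (∀ a < 4 * c.n, c.edgeFun a < 4 * c.n ∧ c.edgeFun (c.edgeFun a) = a ∧ c.edgeFun a ≠ a) ∧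
  (∀ a < 4 * c.n, c.arcFun a < 2 * c.n ∧ c.arcFun (c.edgeFun a) = c.arcFun a ∧
    (c.arcs.idxOf (c.arcFun a) = a ∨ c.arcs.idxOf (c.arcFun a) = c.edgeFun a)) ∧
  (∀ i < 2 * c.n, c.arcs.idxOf i < 4 * c.n ∧ c.arcFun (c.arcs.idxOf i) = i) ∧
  (∀ a < 4 * c.n, c.regionFun a < c.n + 2 ∧ c.regionFun (c.faceFun a) = c.regionFun a ∧
    c.regions.idxOf (c.regionFun a) ∈ List.iterate c.faceFun a (4 * c.n)) ∧
  (∀ i < c.n + 2, c.regions.idxOf i < 4 * c.n ∧ c.regionFun (c.regions.idxOf i) = i) ∧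
  ∀ a < 4 * c.n, a ∈ List.iterate c.strandFun 0 (2 * c.n) ∨
    c.edgeFun a ∈ List.iterate c.strandFun 0 (2 * c.n)

instance : Decidable c.Valid := inferInstanceAs (Decidable (_ ∧ _))

variable {c}

theorem turn_lt {n a : ℕ} (i : ℕ) (ha : a < 4 * n) : turn i a < 4 * n := by
  unfold turn; omega

theorem turn_turn (i j a : ℕ) : turn i (turn j a) = turn (i + j) a := by
  unfold turn; omega

theorem turn_four (a : ℕ) : turn 4 a = a := by
  unfold turn; omega

/-- The turn around the crossings as a permutation. -/
def rotPerm (n : ℕ) : Equiv.Perm (Fin (4 * n)) where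
  toFun a := ⟨turn 1 a, turn_lt 1 a.2⟩
  invFun a := ⟨turn 3 a, turn_lt 3 a.2⟩
  left_inv a := Fin.ext (by simp [turn_turn, turn_four])
  right_inv a := Fin.ext (by simp [turn_turn, turn_four])

/-- The involution on the darts as a permutation. -/
def edgePerm (h : c.Valid) : Equiv.Perm (Fin (4 * c.n)) where
  toFun a := ⟨c.edgeFun a, (h.1 a a.2).1⟩
  invFun a := ⟨c.edgeFun a, (h.1 a a.2).1⟩
  left_inv a := Fin.ext (h.1 a a.2).2.1
  right_inv a := Fin.ext (h.1 a a.2).2.1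

theorem card_orbits {A : Type} (σ : Equiv.Perm A) (n : ℕ) (h : A → Fin n) (r : Fin n → A)
    (hr : ∀ i, h (r i) = i) (h1 : ∀ a, h (σ a) = h a) (h2 : ∀ a, σ.SameCycle a (r (h a))) :
    Nat.card (Quotient (Equiv.Perm.SameCycle.setoid σ)) = n :=
  FiveTwo.card_orbits σ n h (fun i => ⟨r i, hr i⟩) h1 fun a b hab =>
    (h2 a).trans (hab ▸ (h2 b).symm)

theorem sameCycle_of_mem_iterate {N : ℕ} {σ : Equiv.Perm (Fin N)} {f : ℕ → ℕ}
    (hf : ∀ a, (σ a : ℕ) = f a) {a b : Fin N} {k : ℕ} (h : (b : ℕ) ∈ List.iterate f a k) :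
    σ.SameCycle a b := by
  obtain ⟨j, -, hj⟩ := List.mem_iterate.1 h
  refine ⟨j, Fin.ext ?_⟩
  rw [hj, zpow_natCast]
  clear hj h
  induction j with
  | zero => rfl
  | succ j ih => rw [pow_succ', Equiv.Perm.mul_apply, hf, ih, Function.iterate_succ_apply']

theorem card_rotPerm (n : ℕ) :
    Nat.card (Quotient (Equiv.Perm.SameCycle.setoid (rotPerm n))) = n := by
  refine card_orbits _ n (fun a => ⟨a / 4, by omega⟩) (fun i => ⟨4 * i, by omega⟩) ?_ ?_ ?_
  · intro i; ext; simp
  · intro a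
    ext
    show turn 1 a / 4 = a / 4
    unfold turn; omega
  · intro a
    refine sameCycle_of_mem_iterate (f := turn 1) (k := 4) (fun a => rfl) ?_
    simp only [List.iterate, List.mem_cons, turn_turn]
    unfold turn
    omega

theorem card_edgePerm (h : c.Valid) :
    Nat.card (Quotient (Equiv.Perm.SameCycle.setoid (edgePerm h))) = 2 * c.n := by
  refine card_orbits _ _ (fun a => ⟨c.arcFun a, (h.2.1 a a.2).1⟩)
    (fun i => ⟨c.arcs.idxOf (i : ℕ), (h.2.2.1 i i.2).1⟩) ?_ ?_ ?_
  · intro i; exact Fin.ext (h.2.2.1 i i.2).2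
  · intro a; exact Fin.ext (h.2.1 a a.2).2.1
  · intro a
    refine sameCycle_of_mem_iterate (f := c.edgeFun) (k := 2) (fun a => rfl) ?_
    simpa [List.iterate] using (h.2.1 a a.2).2.2

theorem face_eq (h : c.Valid) (a : Fin (4 * c.n)) :
    (((rotPerm c.n)⁻¹ * edgePerm h) a : ℕ) = c.faceFun a := rfl

theorem card_face (h : c.Valid) :
    Nat.card (Quotient (Equiv.Perm.SameCycle.setoid ((rotPerm c.n)⁻¹ * edgePerm h))) = c.n + 2 := by
  refine card_orbits _ _ (fun a => ⟨c.regionFun a, (h.2.2.2.1 a a.2).1⟩)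
    (fun i => ⟨c.regions.idxOf (i : ℕ), (h.2.2.2.2.1 i i.2).1⟩) ?_ ?_ ?_
  · intro i; exact Fin.ext (h.2.2.2.2.1 i i.2).2
  · intro a; exact Fin.ext (h.2.2.2.1 a a.2).2.1
  · intro a
    exact sameCycle_of_mem_iterate (face_eq h) (h.2.2.2.1 a a.2).2.2

theorem one_component (h : c.Valid) (a b : Fin (4 * c.n)) :
    (rotPerm c.n * rotPerm c.n * edgePerm h).SameCycle a b ∨
      (rotPerm c.n * rotPerm c.n * edgePerm h).SameCycle a (edgePerm h b) := by
  set s := rotPerm c.n * rotPerm c.n * edgePerm h with hs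
  have hs1 : ∀ a, (s a : ℕ) = c.strandFun a := fun a => turn_turn 1 1 _
  have hee : ∀ a, edgePerm h (edgePerm h a) = a := fun a => Fin.ext (h.1 a a.2).2.1
  have hrr : ∀ a, rotPerm c.n (rotPerm c.n (rotPerm c.n (rotPerm c.n a))) = a := fun a =>
    Fin.ext (by simp [rotPerm, turn_turn, turn_four])
  have hconj : edgePerm h * s * (edgePerm h)⁻¹ = s⁻¹ := by
    ext x
    rw [eq_comm, Fin.val_inj, Equiv.Perm.inv_eq_iff_eq]
    simp only [hs, Equiv.Perm.mul_apply, hee, hrr]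
    rw [← Equiv.Perm.mul_apply, mul_inv_cancel, Equiv.Perm.one_apply]
  have hinv : ∀ x, (edgePerm h)⁻¹ x = edgePerm h x := fun x => by
    rw [Equiv.Perm.inv_eq_iff_eq, hee]
  -- reversing the direction of travel
  have hrev : ∀ x y, s.SameCycle x y → s.SameCycle (edgePerm h x) (edgePerm h y) := by
    intro x y hxy
    rw [← Equiv.Perm.sameCycle_inv, ← hconj, Equiv.Perm.sameCycle_conj, hinv, hinv, hee, hee]
    exact hxy
  have hpos : 0 < 4 * c.n := lt_of_le_of_lt (Nat.zero_le _) a.2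
  have h0 : ∀ x, s.SameCycle ⟨0, hpos⟩ x ∨ s.SameCycle ⟨0, hpos⟩ (edgePerm h x) := fun x =>
    (h.2.2.2.2.2 x x.2).imp (sameCycle_of_mem_iterate hs1) (sameCycle_of_mem_iterate hs1)
  rcases h0 a with ha | ha <;> rcases h0 b with hb | hb
  · exact Or.inl (ha.symm.trans hb)
  · exact Or.inr (ha.symm.trans hb)
  · right
    have := hrev _ _ (ha.symm.trans hb)
    rwa [hee] at this
  · left
    have := hrev _ _ (ha.symm.trans hb)
    rwa [hee, hee] at this

/-- The diagram with a given description. -/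
def diagram (h : c.Valid) : KnotDiagram where
  Dart := Fin (4 * c.n)
  finite_dart := inferInstance
  rot := rotPerm c.n
  edge := edgePerm h
  isOver := fun a => decide (a.val % 2 = 1)
  rot_four a := Fin.ext (by simp [rotPerm, turn_turn, turn_four])
  rot_two_ne a hh := by
    have := congrArg Fin.val hh
    simp only [rotPerm, Equiv.coe_fn_mk, turn] at this
    omega
  edge_edge a := Fin.ext (h.1 a a.2).2.1
  edge_ne a hh := (h.1 a a.2).2.2 (congrArg Fin.val hh)
  isOver_rot a := by
    show decide (turn 1 a % 2 = 1) = !decide (a.val % 2 = 1)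
    rw [← decide_not]
    exact decide_eq_decide.2 (by unfold turn; omega)
  one_component := one_component h
  planar := fun _ => by rw [card_rotPerm, card_face, card_edgePerm]; ring

end PlanarCode

end Code

end KnotDiagram

namespace KnotDiagram

namespace PlanarCode

/-! ### Colorings of diagrams given by lists -/

section Colorings

variable {c : PlanarCode} {p : ℕ}

/-- The function on the corners with given natural numbers as values on the regions. -/
def value (c : PlanarCode) (v : List ℕ) (a : ℕ) : ℕ := v.getD (c.regionFun a) 0

/-- The coloring of the corners with given values on the regions. -/
def coloring (p : ℕ) (h : c.Valid) (v : List ℕ) (a : (diagram h).Dart) : ZMod p :=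
  (value c v (Fin.val a) : ℕ)

/-- The crossing relations. -/
def ValidColoring (c : PlanarCode) (p : ℕ) (v : List ℕ) : Prop :=
  ∀ a < 4 * c.n, a % 2 = 0 → (value c v a + value c v (turn 1 a)) % p =
    (value c v (turn 3 a) + value c v (turn 2 a)) % p

instance (p : ℕ) (v : List ℕ) : Decidable (ValidColoring c p v) :=
  inferInstanceAs (Decidable (∀ a < 4 * c.n, _))

theorem val_rot (h : c.Valid) (a : (diagram h).Dart) :
    Fin.val ((diagram h).rot a) = turn 1 (Fin.val a) := rfl

theorem val_lt (h : c.Valid) (a : (diagram h).Dart) : Fin.val a < 4 * c.n := Fin.isLt a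

theorem isOver_eq (h : c.Valid) (a : (diagram h).Dart) :
    (diagram h).isOver a = decide (Fin.val a % 2 = 1) := rfl

theorem faceInvariant_value (h : c.Valid) (v : List ℕ) :
    FaceInvariant fun a : (diagram h).Dart => value c v (Fin.val a) := by
  intro a
  show v.getD (c.regionFun (c.faceFun (Fin.val a))) 0 = v.getD (c.regionFun (Fin.val a)) 0
  rw [(h.2.2.2.1 _ (val_lt h a)).2.1]

theorem ValidColoring.isCornerColoring (h : c.Valid) {v : List ℕ} (hv : ValidColoring c p v) :
    IsCornerColoring (coloring p h v) where
  face a := congrArg (fun n : ℕ => (n : ZMod p)) (faceInvariant_value h v a)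
  cross_eq a ha := by
    rw [isOver_eq, decide_eq_false_iff_not] at ha
    have := (ZMod.natCast_eq_natCast_iff' _ _ p).2 (hv _ (val_lt h a) (by omega))
    push_cast at this
    simp only [cross, coloring, val_rot, turn_turn]
    linear_combination this

/-- The coloring given by `v` is a trivial one, with values that alternate around crossings. -/
def Checkered (c : PlanarCode) (v : List ℕ) : Prop :=
  ∀ a < 4 * c.n, value c v (turn 2 a) = value c v a

instance (v : List ℕ) : Decidable (Checkered c v) := inferInstanceAs (Decidable (∀ a < 4 * c.n, _))

theorem Checkered.isChecker (h : c.Valid) {v : List ℕ} (hv : Checkered c v) :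
    IsChecker fun a : (diagram h).Dart => value c v (Fin.val a) := by
  refine ⟨faceInvariant_value h v, fun a => ?_⟩
  simp only [val_rot, turn_turn]
  exact hv _ (val_lt h a)

theorem nontrivial_coloring (h : c.Valid) {v : List ℕ} (hv : ∃ a < 4 * c.n, a % 2 = 0 ∧
    value c v (turn 1 a) % p ≠ value c v (turn 3 a) % p) : NontrivialCorners (coloring p h v) := by
  obtain ⟨a, ha, h2, hne⟩ := hv
  let y : (diagram h).Dart := (⟨a, ha⟩ : Fin (4 * c.n))
  refine ⟨y, ?_, fun heq => hne ?_⟩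
  · show decide (a % 2 = 1) = false
    simp [h2]
  · have e3 : coloring p h v ((diagram h).rot ((diagram h).rot ((diagram h).rot y))) =
        (value c v (turn 1 (turn 1 (turn 1 a))) : ℕ) := rfl
    rw [e3, turn_turn, turn_turn] at heq
    exact (ZMod.natCast_eq_natCast_iff' _ _ p).1 heq

theorem ncard_range_coloring (h : c.Valid) (v : List ℕ) {m : ℕ}
    (hm : (v.map (· % p)).dedup.length ≤ m) (hlen : c.n + 2 ≤ v.length) :
    (Set.range (coloring p h v)).ncard ≤ m := by
  refine le_trans ?_ hm
  have hsub : Set.range (coloring p h v) ⊆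
      ((v.map (· % p)).toFinset.image fun i : ℕ => (i : ZMod p) : Finset (ZMod p)) := by
    rintro _ ⟨a, rfl⟩
    simp only [Finset.coe_image, Set.mem_image, Finset.mem_coe, List.mem_toFinset, List.mem_map]
    have hlt := lt_of_lt_of_le (h.2.2.2.1 _ (val_lt h a)).1 hlen
    refine ⟨_, ⟨v[c.regionFun (Fin.val a)], List.getElem_mem hlt, rfl⟩, ?_⟩
    rw [ZMod.natCast_mod, coloring, value, List.getD_eq_getElem _ _ hlt]
  refine le_trans (Set.ncard_le_ncard hsub (Finset.finite_toSet _)) ?_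
  rw [Set.ncard_coe_finset]
  exact Finset.card_image_le.trans (List.card_toFinset _).le

/-- The pairing of two colorings, evaluated on natural numbers as representatives, before reduction
modulo `p`. -/
def linking (c : PlanarCode) (p : ℕ) (v w : List ℕ) : ℤ :=
  ((List.range (4 * c.n)).map fun a => if a % 2 = 1 then 0 else
    (((value c v a : ℤ) + value c v (turn 1 a) - value c v (turn 3 a) - value c v (turn 2 a)) / p) *
      ((value c w a : ℤ) - value c w (turn 2 a))).sum

theorem pairing_coloring [NeZero p] (h : c.Valid) {v w : List ℕ} (hv : ValidColoring c p v)
    (hw : ValidColoring c p w) :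
    pairing (coloring p h v) (coloring p h w) = (linking c p v w : ℤ) := by
  rw [← liftPairing_eq_pairing (hv.isCornerColoring h) (hw.isCornerColoring h)
    (X := fun a => (value c v (Fin.val a) : ℤ))]
  · have hsum : ∀ F : ℕ → ZMod p, ∑ a : (diagram h).Dart, F (Fin.val a) =
        ((List.range (4 * c.n)).map F).sum := by
      intro F
      have : ∑ a : (diagram h).Dart, F (Fin.val a) = ∑ a : Fin (4 * c.n), F a :=
        Finset.sum_congr (Finset.ext fun x => iff_of_true (Finset.mem_univ x)
          (Finset.mem_univ (α := Fin (4 * c.n)) x)) fun _ _ => rfl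
      rw [this, Fin.sum_univ_eq_sum_range]
      rfl
    rw [linking, Int.cast_list_sum, List.map_map, ← hsum]
    refine Finset.sum_congr rfl fun a _ => ?_
    simp only [pairTerm, isOver_eq, cross, val_rot, turn_turn, coloring, Function.comp]
    by_cases ha : Fin.val a % 2 = 1
    · simp [ha]
    · simp only [ha, decide_false, Bool.false_eq_true, if_false]
      push_cast
      rfl
  · intro a
    exact congrArg _ (faceInvariant_value h v a)
  · intro a
    simp [coloring]

/-- Starting from the regions `K`, the colors of all regions can be determined one after the other:
a dart in the second list stands for a region whose color follows from those of the three other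
corners at the crossing. -/
def determines (c : PlanarCode) : List ℕ → List ℕ → Bool
  | K, [] => (List.range (c.n + 2)).all fun i => K.contains i
  | K, a :: as => decide (a < 4 * c.n) && K.contains (c.regionFun (turn 1 a)) &&
    K.contains (c.regionFun (turn 2 a)) && K.contains (c.regionFun (turn 3 a)) &&
    determines c (c.regionFun a :: K) as

theorem eq_of_region_eq (h : c.Valid) {C : (diagram h).Dart → ZMod p} (hC : FaceInvariant C)
    {a b : (diagram h).Dart} (hab : c.regionFun (Fin.val a) = c.regionFun (Fin.val b)) :
    C a = C b := by
  have hinv : ∀ a b, (diagram h).face.SameCycle a b → C a = C b := by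
    intro a b hcyc
    have := (diagram h).finite_dart
    obtain ⟨k, -, rfl⟩ := hcyc.exists_pow_eq'
    clear hcyc
    induction k with
    | zero => rfl
    | succ k ih => rw [pow_succ', Equiv.Perm.mul_apply, hC, ih]
  have hrep : ∀ a : (diagram h).Dart, C a = C (⟨c.regions.idxOf (c.regionFun (Fin.val a)),
      (h.2.2.2.2.1 _ (h.2.2.2.1 _ (val_lt h a)).1).1⟩ : Fin (4 * c.n)) := fun a =>
    hinv _ _ (sameCycle_of_mem_iterate (face_eq h) (h.2.2.2.1 _ (val_lt h a)).2.2)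
  rw [hrep a, hrep b]
  congr 2
  rw [hab]

theorem eq_zero_of_determines (h : c.Valid) {C : (diagram h).Dart → ZMod p}
    (hC : IsCornerColoring C) : ∀ (as K : List ℕ), determines c K as = true →
      (∀ a : (diagram h).Dart, c.regionFun (Fin.val a) ∈ K → C a = 0) → ∀ a, C a = 0
  | [], K, hd, hK, a => by
    simp only [determines, List.all_eq_true, List.mem_range, List.contains_iff_mem] at hd
    exact hK a (hd _ (h.2.2.2.1 _ (val_lt h a)).1)
  | x :: as, K, hd, hK, a => by
    simp only [determines, Bool.and_eq_true, List.contains_iff_mem, decide_eq_true_eq] at hd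
    obtain ⟨⟨⟨⟨hx, h1⟩, h2⟩, h3⟩, hd⟩ := hd
    refine eq_zero_of_determines h hC as _ hd (fun b hb => ?_) a
    rcases List.mem_cons.1 hb with hb | hb
    · let y : (diagram h).Dart := (⟨x, hx⟩ : Fin (4 * c.n))
      have e1 : C ((diagram h).rot y) = 0 := hK _ h1
      have e2 : C ((diagram h).rot ((diagram h).rot y)) = 0 :=
        hK _ (by rw [val_rot, val_rot, turn_turn]; exact h2)
      have e3 : C ((diagram h).rot ((diagram h).rot ((diagram h).rot y))) = 0 :=
        hK _ (by rw [val_rot, val_rot, val_rot, turn_turn, turn_turn]; exact h3)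
      obtain ⟨r1, r2⟩ := IsTriangleMove.cross_eq_zero hC y
      rw [e1, e2, e3] at r1 r2
      rw [eq_of_region_eq h hC.face (a := b) (b := y) hb]
      cases hy : (diagram h).isOver y
      · simpa using r1 hy
      · simpa using (r2 hy).symm
    · exact hK b hb

/-- Each coloring is a linear combination of basic ones that form a triangular system on the four
regions numbered `i₀`, `i₁`, `i₂`, `i₃` (of which the last two may coincide), if the colors of these
regions determine the coloring. -/
theorem exists_combination (h : c.Valid) {i₀ i₁ i₂ i₃ : ℕ} {as : List ℕ}
    (hdet : determines c [i₀, i₁, i₂, i₃] as = true)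
    {b₀ b₁ b₂ b₃ : List ℕ} (h₀ : ValidColoring c p b₀) (h₁ : ValidColoring c p b₁)
    (h₂ : ValidColoring c p b₂) (h₃ : ValidColoring c p b₃)
    (hi : i₀ < c.n + 2 ∧ i₁ < c.n + 2 ∧ i₂ < c.n + 2 ∧ i₃ < c.n + 2)
    (e₀ : b₀.getD i₀ 0 = 1) (e₁ : b₁.getD i₀ 0 = 0 ∧ b₁.getD i₁ 0 = 1)
    (e₂ : b₂.getD i₀ 0 = 0 ∧ b₂.getD i₁ 0 = 0 ∧ b₂.getD i₂ 0 = 1)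
    (e₃ : b₃.getD i₀ 0 = 0 ∧ b₃.getD i₁ 0 = 0 ∧ b₃.getD i₂ 0 = 0 ∧ (b₃.getD i₃ 0 = 1 ∨ i₃ = i₂))
    {C : (diagram h).Dart → ZMod p} (hC : IsCornerColoring C) :
    ∃ w₀ w₁ w₂ w₃ : ZMod p, C = fun a => w₀ * coloring p h b₀ a + (w₁ * coloring p h b₁ a +
      (w₂ * coloring p h b₂ a + w₃ * coloring p h b₃ a)) := by
  have hrep : ∀ i < c.n + 2, ∃ r : (diagram h).Dart, c.regionFun (Fin.val r) = i := fun i hi =>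
    ⟨(⟨c.regions.idxOf i, (h.2.2.2.2.1 i hi).1⟩ : Fin (4 * c.n)), (h.2.2.2.2.1 i hi).2⟩
  obtain ⟨r₀, hr₀⟩ := hrep i₀ hi.1
  obtain ⟨r₁, hr₁⟩ := hrep i₁ hi.2.1
  obtain ⟨r₂, hr₂⟩ := hrep i₂ hi.2.2.1
  obtain ⟨r₃, hr₃⟩ := hrep i₃ hi.2.2.2
  have hval : ∀ (v : List ℕ) (a : (diagram h).Dart) (i : ℕ), c.regionFun (Fin.val a) = i →
      coloring p h v a = (v.getD i 0 : ℕ) := by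
    rintro v a i rfl; rfl
  set w₀ := C r₀ with hw₀
  set w₁ := C r₁ - w₀ * coloring p h b₀ r₁ with hw₁
  set w₂ := C r₂ - (w₀ * coloring p h b₀ r₂ + w₁ * coloring p h b₁ r₂) with hw₂
  set w₃ := C r₃ - (w₀ * coloring p h b₀ r₃ + (w₁ * coloring p h b₁ r₃ +
    w₂ * coloring p h b₂ r₃)) with hw₃
  refine ⟨w₀, w₁, w₂, w₃, ?_⟩
  have hsum := ((h₀.isCornerColoring h).mul w₀).add (((h₁.isCornerColoring h).mul w₁).add
    (((h₂.isCornerColoring h).mul w₂).add ((h₃.isCornerColoring h).mul w₃)))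
  have hzero := eq_zero_of_determines h (hC.add (hsum.mul (-1))) as _ hdet ?_
  · funext a
    have := hzero a
    linear_combination this
  have key : ∀ i, i ∈ [i₀, i₁, i₂, i₃] → ∀ r : (diagram h).Dart, c.regionFun (Fin.val r) = i →
      C r + -1 * (w₀ * coloring p h b₀ r + (w₁ * coloring p h b₁ r +
        (w₂ * coloring p h b₂ r + w₃ * coloring p h b₃ r))) = 0 := by
    have q2 : C r₂ = w₀ * coloring p h b₀ r₂ + (w₁ * coloring p h b₁ r₂ +
        (w₂ * coloring p h b₂ r₂ + w₃ * coloring p h b₃ r₂)) := by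
      rw [hval b₂ r₂ _ hr₂, hval b₃ r₂ _ hr₂, e₂.2.2, e₃.2.2.1, hw₂]
      push_cast; ring
    intro i hi r hr
    have hreq : ∀ r' : (diagram h).Dart, c.regionFun (Fin.val r') = i →
        C r = C r' ∧ ∀ v, coloring p h v r = coloring p h v r' := by
      intro r' hr'
      refine ⟨eq_of_region_eq h hC.face (hr.trans hr'.symm), fun v => ?_⟩
      rw [hval v r i hr, hval v r' i hr']
    simp only [List.mem_cons, List.not_mem_nil, or_false] at hi
    rcases hi with rfl | rfl | rfl | rfl
    · obtain ⟨t1, t2⟩ := hreq r₀ hr₀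
      rw [t1, t2, t2, t2, t2, hval b₀ r₀ _ hr₀, hval b₁ r₀ _ hr₀, hval b₂ r₀ _ hr₀,
        hval b₃ r₀ _ hr₀, e₀, e₁.1, e₂.1, e₃.1, ← hw₀]
      push_cast; ring
    · obtain ⟨t1, t2⟩ := hreq r₁ hr₁
      rw [t1, t2, t2, t2, t2, hval b₁ r₁ _ hr₁, hval b₂ r₁ _ hr₁,
        hval b₃ r₁ _ hr₁, e₁.2, e₂.2.1, e₃.2.1, hw₁]
      push_cast; ring
    · obtain ⟨t1, t2⟩ := hreq r₂ hr₂
      rw [t1, t2, t2, t2, t2, q2]; ring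
    · rcases e₃.2.2.2 with e | e
      · obtain ⟨t1, t2⟩ := hreq r₃ hr₃
        rw [t1, t2, t2, t2, t2, hval b₃ r₃ _ hr₃, e, hw₃]
        push_cast; ring
      · obtain ⟨t1, t2⟩ := hreq r₂ (hr₂.trans e.symm)
        rw [t1, t2, t2, t2, t2, q2]; ring
  exact fun a ha => key _ ha a rfl

/-- A list description of a diagram, together with a basis of its colorings on the regions: two
checkerboard functions and two other ones, the last of which may vanish. -/
structure Basis (c : PlanarCode) where
  anchors : ℕ × ℕ × ℕ × ℕ
  script : List ℕ
  black : List ℕ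
  white : List ℕ
  first : List ℕ
  second : List ℕ

/-- The data of a basis fit together. -/
def Basis.Valid (p : ℕ) (b : Basis c) : Prop :=
  determines c [b.anchors.1, b.anchors.2.1, b.anchors.2.2.1, b.anchors.2.2.2] b.script = true ∧
  ValidColoring c p b.black ∧ ValidColoring c p b.white ∧
  ValidColoring c p b.first ∧ ValidColoring c p b.second ∧
  Checkered c b.black ∧ Checkered c b.white ∧
  (b.anchors.1 < c.n + 2 ∧ b.anchors.2.1 < c.n + 2 ∧ b.anchors.2.2.1 < c.n + 2 ∧
    b.anchors.2.2.2 < c.n + 2) ∧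
  b.black.getD b.anchors.1 0 = 1 ∧
  (b.white.getD b.anchors.1 0 = 0 ∧ b.white.getD b.anchors.2.1 0 = 1) ∧
  (b.first.getD b.anchors.1 0 = 0 ∧ b.first.getD b.anchors.2.1 0 = 0 ∧
    b.first.getD b.anchors.2.2.1 0 = 1) ∧
  (b.second.getD b.anchors.1 0 = 0 ∧ b.second.getD b.anchors.2.1 0 = 0 ∧
    b.second.getD b.anchors.2.2.1 0 = 0 ∧
    (b.second.getD b.anchors.2.2.2 0 = 1 ∨ b.anchors.2.2.2 = b.anchors.2.2.1))

instance (p : ℕ) (b : Basis c) : Decidable (b.Valid p) := inferInstanceAs (Decidable (_ ∧ _))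

/-- The pairing of any coloring in terms of the basis. -/
theorem Basis.Valid.exists_pairing [NeZero p] (h : c.Valid) {b : Basis c} (hb : b.Valid p)
    {C : (diagram h).Dart → ZMod p} (hC : IsCornerColoring C) :
    ∃ w₂ w₃ : ZMod p, (w₂ = 0 → w₃ = 0 ∨ Checkered c b.second → ¬ NontrivialCorners C) ∧
      (∀ y, IsCornerColoring y → pairing C y =
        w₂ * pairing (coloring p h b.first) y + w₃ * pairing (coloring p h b.second) y) ∧
      ∀ x, pairing x C =
        w₂ * pairing x (coloring p h b.first) + w₃ * pairing x (coloring p h b.second) := by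
  obtain ⟨hdet, v0, v1, v2, v3, k0, k1, hi, e0, e1, e2, e3⟩ := hb
  obtain ⟨w₀, w₁, w₂, w₃, rfl⟩ := exists_combination h hdet v0 v1 v2 v3 hi e0 e1 e2 e3 hC
  have c0 := v0.isCornerColoring h
  have c1 := v1.isCornerColoring h
  have c2 := v2.isCornerColoring h
  have c3 := v3.isCornerColoring h
  refine ⟨w₂, w₃, ?_, fun y hy => ?_, fun x => ?_⟩
  · rintro rfl h3 ⟨a, -, hne⟩
    have q0 := (k0.isChecker h).2 ((diagram h).rot a)
    have q1 := (k1.isChecker h).2 ((diagram h).rot a)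
    refine hne ?_
    rcases h3 with rfl | h3
    · simp only [coloring, zero_mul] at q0 q1 ⊢
      rw [q0, q1]
    · have q3 := (h3.isChecker h).2 ((diagram h).rot a)
      simp only [coloring, zero_mul] at q0 q1 q3 ⊢
      rw [q0, q1, q3]
  · rw [pairing_add_left (c0.mul w₀) ((c1.mul w₁).add ((c2.mul w₂).add (c3.mul w₃))) hy,
      pairing_add_left (c1.mul w₁) ((c2.mul w₂).add (c3.mul w₃)) hy,
      pairing_add_left (c2.mul w₂) (c3.mul w₃) hy, pairing_mul_left c0 hy, pairing_mul_left c1 hy,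
      pairing_mul_left c2 hy, pairing_mul_left c3 hy]
    have q0 : pairing (coloring p h b.black) y = 0 := (k0.isChecker h).pairing_left hy
    have q1 : pairing (coloring p h b.white) y = 0 := (k1.isChecker h).pairing_left hy
    rw [q0, q1]; ring
  · rw [pairing_add_right, pairing_add_right, pairing_add_right, pairing_mul_right,
      pairing_mul_right, pairing_mul_right, pairing_mul_right]
    have q0 : pairing x (coloring p h b.black) = 0 := (k0.isChecker h).pairing_right x
    have q1 : pairing x (coloring p h b.white) = 0 := (k1.isChecker h).pairing_right x
    rw [q0, q1]; ring

end Colorings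

end PlanarCode

end KnotDiagram

namespace KnotDiagram

namespace PlanarCode

/-! ### Minimum numbers of colors of diagrams given by lists -/

section Mincol

variable {c : PlanarCode} {p : ℕ}

/-- A coloring list with at most `m` colors that is nontrivial at some crossing. -/
def FewColors (c : PlanarCode) (p m : ℕ) (v : List ℕ) : Prop :=
  ValidColoring c p v ∧
  (∃ a < 4 * c.n, a % 2 = 0 ∧ value c v (turn 1 a) % p ≠ value c v (turn 3 a) % p) ∧
  (v.map (· % p)).dedup.length ≤ m ∧ c.n + 2 ≤ v.length

instance (m : ℕ) (v : List ℕ) : Decidable (FewColors c p m v) :=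
  inferInstanceAs (Decidable (_ ∧ (∃ a < 4 * c.n, _) ∧ _ ∧ _))

theorem FewColors.dehnColorable (h : c.Valid) {m : ℕ} {v : List ℕ} (hv : FewColors c p m v) :
    (diagram h).knot.DehnColorable p :=
  (hv.1.isCornerColoring h).dehnColorable (nontrivial_coloring h hv.2.1)

theorem FewColors.mincol_le (h : c.Valid) {m : ℕ} {v : List ℕ} (hv : FewColors c p m v) :
    (diagram h).knot.mincol p ≤ m :=
  ((hv.1.isCornerColoring h).mincol_le (nontrivial_coloring h hv.2.1)).trans
    (ncard_range_coloring h v hv.2.2.1 hv.2.2.2)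

theorem intCast_ne_zero_of_emod {k : ℤ} (hk : k % p ≠ 0) : (k : ZMod p) ≠ 0 := fun h0 =>
  hk (Int.emod_eq_zero_of_dvd ((ZMod.intCast_zmod_eq_zero_iff_dvd k p).1 h0))

/-- If, up to trivial colorings, there is only one dimension of colorings, and the self-pairing of a
generator does not vanish, then palettes that force self-pairings to vanish are excluded. -/
theorem lt_mincol_of_linking [Fact p.Prime] (h : c.Valid) {b : Basis c} (hb : b.Valid p)
    (hs : Checkered c b.second) (hl : linking c p b.first b.first % p ≠ 0) {m : ℕ}
    (hcol : (diagram h).knot.DehnColorable p)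
    (hfew : ∀ (D' : KnotDiagram) (C : D'.Dart → ZMod p), IsCornerColoring C →
      NontrivialCorners C → (Set.range C).ncard ≤ m → pairing C C = 0) :
    m < (diagram h).knot.mincol p := by
  refine lt_mincol_of_self hcol (fun C hC hn => ?_) hfew
  obtain ⟨w₂, w₃, hw, hl1, hl2⟩ := hb.exists_pairing h hC
  have v2 := hb.2.2.2.1
  have e1 : ∀ x, pairing x (coloring p h b.second) = 0 := fun x => (hs.isChecker h).pairing_right x
  have e2 : pairing (coloring p h b.second) C = 0 := (hs.isChecker h).pairing_left hC
  have h2 : w₂ ≠ 0 := fun h0 => hw h0 (Or.inr hs) hn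
  rw [hl1 C hC, e2, hl2, e1, pairing_coloring h v2 v2, mul_zero, add_zero, add_zero]
  exact mul_ne_zero h2 (mul_ne_zero h2 (intCast_ne_zero_of_emod hl))

/-- If the Gram determinant of the pairing on two generators of the colorings does not vanish, then
palettes that force pairings with all colorings to vanish are excluded. -/
theorem lt_mincol_of_gram [Fact p.Prime] (h : c.Valid) {b : Basis c} (hb : b.Valid p)
    (hl : (linking c p b.first b.first * linking c p b.second b.second -
      linking c p b.first b.second * linking c p b.second b.first) % p ≠ 0) {m : ℕ}
    (hcol : (diagram h).knot.DehnColorable p)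
    (hfew : ∀ (D' : KnotDiagram) (C y : D'.Dart → ZMod p), IsCornerColoring C →
      IsCornerColoring y → NontrivialCorners C → (Set.range C).ncard ≤ m → pairing C y = 0) :
    m < (diagram h).knot.mincol p := by
  refine lt_mincol_of_radical hcol (fun C hC hn => ?_) hfew
  obtain ⟨w₂, w₃, hw, hl1, -⟩ := hb.exists_pairing h hC
  have v2 := hb.2.2.2.1
  have v3 := hb.2.2.2.2.1
  by_contra! h0
  have q2 := h0 _ (v2.isCornerColoring h)
  have q3 := h0 _ (v3.isCornerColoring h)
  rw [hl1 _ (v2.isCornerColoring h), pairing_coloring h v2 v2, pairing_coloring h v3 v2] at q2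
  rw [hl1 _ (v3.isCornerColoring h), pairing_coloring h v2 v3, pairing_coloring h v3 v3] at q3
  have hdet := intCast_ne_zero_of_emod hl
  push_cast at hdet
  -- Cramer's rule
  have z2 : w₂ = 0 := by
    refine (mul_eq_zero.1 ?_).resolve_right hdet
    linear_combination (linking c p b.second b.second : ZMod p) * q2 -
      (linking c p b.second b.first : ZMod p) * q3
  have z3 : w₃ = 0 := by
    refine (mul_eq_zero.1 ?_).resolve_right hdet
    linear_combination (linking c p b.first b.first : ZMod p) * q3 -
      (linking c p b.first b.second : ZMod p) * q2
  exact hw z2 (Or.inl z3) hn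

end Mincol

/-! ### The diagrams -/

/-- The standard diagram of the knot `5₂`. -/
def fiveTwoCode : PlanarCode where
  n := 5
  edges := [11, 6, 17, 8, 19, 18, 1, 12, 3, 14, 13, 0, 7, 10, 9, 16, 15, 2, 5, 4]
  arcs := [0, 1, 2, 3, 4, 5, 1, 6, 3, 7, 8, 0, 6, 8, 7, 9, 9, 2, 5, 4]
  regions := [0, 1, 2, 3, 4, 1, 0, 5, 2, 6, 0, 3, 0, 6, 2, 5, 2, 1, 4, 5]

theorem fiveTwoCode_valid : fiveTwoCode.Valid := by decide +kernel

/-- A basis of the colorings modulo 7. -/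
def fiveTwoBasis : fiveTwoCode.Basis where
  anchors := (0, 1, 2, 2)
  script := [3, 9, 15, 18]
  black := [1, 0, 1, 0, 1, 0, 0]
  white := [0, 1, 0, 1, 0, 1, 1]
  first := [0, 0, 1, 6, 4, 4, 5]
  second := []

theorem fiveTwoBasis_valid : fiveTwoBasis.Valid 7 := by decide +kernel

/-- A nontrivial coloring with 5 colors. -/
def fiveTwoColors : List ℕ := [0, 0, 1, 6, 4, 4, 5]

/-- The closure of the braid `σ₁³ σ₂⁻¹ σ₁ σ₂⁻¹`; in `σᵢ` the strand from position `i` to `i + 1` passes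
over the other one. -/
def elevenCode : PlanarCode where
  n := 6
  edges := [23, 4, 7, 18, 1, 8, 11, 2, 5, 12, 19, 6, 9, 22, 21, 16, 15, 20, 3, 10, 17, 14, 13, 0]
  arcs := [0, 1, 2, 3, 1, 4, 5, 2, 4, 6, 7, 5, 6, 8, 9, 10, 10, 11, 3, 7, 11, 9, 8, 0]
  regions := [0, 1, 2, 3, 0, 4, 2, 1, 0, 5, 2, 4, 0, 6, 7, 5, 7, 3, 2, 5, 7, 6, 0, 3]

theorem elevenCode_valid : elevenCode.Valid := by decide +kernel

/-- A basis of the colorings modulo 11. -/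
def elevenBasis : elevenCode.Basis where
  anchors := (0, 1, 2, 2)
  script := [3, 5, 9, 16, 21]
  black := [1, 0, 1, 0, 0, 0, 0, 1]
  white := [0, 1, 0, 1, 1, 1, 1, 0]
  first := [0, 0, 1, 10, 1, 2, 6, 4]
  second := []

theorem elevenBasis_valid : elevenBasis.Valid 11 := by decide +kernel

/-- A nontrivial coloring with 6 colors. -/
def elevenColors : List ℕ := [0, 0, 1, 10, 1, 2, 6, 4]

/-- The closure of the braid `σ₁² σ₂⁻¹ σ₁ σ₂⁻²`. -/
def thirteenCode : PlanarCode where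
  n := 6
  edges := [23, 4, 7, 14, 1, 8, 15, 2, 5, 22, 17, 12, 11, 16, 3, 6, 13, 10, 21, 20, 19, 18, 9, 0]
  arcs := [0, 1, 2, 3, 1, 4, 5, 2, 4, 6, 7, 8, 8, 9, 3, 5, 9, 7, 10, 11, 11, 10, 6, 0]
  regions := [0, 1, 2, 3, 0, 4, 2, 1, 0, 5, 6, 4, 6, 3, 2, 4, 6, 5, 7, 3, 7, 5, 0, 3]

theorem thirteenCode_valid : thirteenCode.Valid := by decide +kernel

/-- A basis of the colorings modulo 13. -/
def thirteenBasis : thirteenCode.Basis where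
  anchors := (0, 1, 2, 2)
  script := [3, 5, 12, 9, 18]
  black := [1, 0, 1, 0, 0, 0, 1, 1]
  white := [0, 1, 0, 1, 1, 1, 0, 0]
  first := [0, 0, 1, 12, 1, 4, 3, 8]
  second := []

theorem thirteenBasis_valid : thirteenBasis.Valid 13 := by decide +kernel

/-- A nontrivial coloring with 6 colors. -/
def thirteenColors : List ℕ := [0, 0, 1, 12, 1, 4, 3, 8]

/-- The plat closure of the braid `σ₂ σ₁⁻¹ σ₂ σ₁⁻² σ₂²` on four strands. -/
def nineteenCode : PlanarCode where
  n := 7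
  edges := [25, 8, 5, 4, 3, 2, 11, 12, 1, 20, 13, 6, 7, 10, 17, 16, 15, 14, 23, 26, 9, 24, 27, 18, 21,
    0, 19, 22]
  arcs := [0, 1, 2, 3, 3, 2, 4, 5, 1, 6, 7, 4, 5, 7, 8, 9, 9, 8, 10, 11, 6, 12, 13, 10, 12, 0, 11, 13]
  regions := [0, 1, 2, 3, 2, 1, 4, 3, 0, 5, 4, 1, 4, 5, 6, 3, 6, 5, 7, 3, 0, 8, 7, 5, 0, 3, 7, 8]

theorem nineteenCode_valid : nineteenCode.Valid := by decide +kernel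

/-- A basis of the colorings modulo 19. -/
def nineteenBasis : nineteenCode.Basis where
  anchors := (0, 1, 2, 2)
  script := [3, 6, 9, 14, 18, 21]
  black := [1, 0, 1, 0, 1, 0, 1, 1, 0]
  white := [0, 1, 0, 1, 0, 1, 0, 0, 1]
  first := [0, 0, 1, 18, 2, 2, 5, 8, 10]
  second := []

theorem nineteenBasis_valid : nineteenBasis.Valid 19 := by decide +kernel

/-- A nontrivial coloring with 7 colors. -/
def nineteenColors : List ℕ := [0, 0, 1, 18, 2, 2, 5, 8, 10]

/-- The closure of the braid `σ₁⁴ σ₂⁻¹ σ₁ σ₂⁻²`. -/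
def twentyThreeCode : PlanarCode where
  n := 8
  edges := [31, 4, 7, 22, 1, 8, 11, 2, 5, 12, 15, 6, 9, 16, 23, 10, 13, 30, 25, 20, 19, 24, 3, 14, 21,
    18, 29, 28, 27, 26, 17, 0]
  arcs := [0, 1, 2, 3, 1, 4, 5, 2, 4, 6, 7, 5, 6, 8, 9, 7, 8, 10, 11, 12, 12, 13, 3, 9, 13, 11, 14,
    15, 15, 14, 10, 0]
  regions := [0, 1, 2, 3, 0, 4, 2, 1, 0, 5, 2, 4, 0, 6, 2, 5, 0, 7, 8, 6, 8, 3, 2, 6, 8, 7, 9, 3, 9, 7,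
    0, 3]

theorem twentyThreeCode_valid : twentyThreeCode.Valid := by decide +kernel

/-- A basis of the colorings modulo 23. -/
def twentyThreeBasis : twentyThreeCode.Basis where
  anchors := (0, 1, 2, 2)
  script := [3, 5, 9, 13, 20, 17, 26]
  black := [1, 0, 1, 0, 0, 0, 0, 0, 1, 1]
  white := [0, 1, 0, 1, 1, 1, 1, 1, 0, 0]
  first := [0, 0, 1, 22, 1, 2, 3, 8, 5, 14]
  second := []

theorem twentyThreeBasis_valid : twentyThreeBasis.Valid 23 := by decide +kernel

/-- A nontrivial coloring with 8 colors. -/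
def twentyThreeColors : List ℕ := [0, 0, 1, 22, 1, 2, 3, 8, 5, 14]

/-- The plat closure of the braid `σ₂ σ₁⁻¹ σ₂ σ₁⁻¹ σ₂² σ₁⁻¹ σ₂` on four strands. -/
def thirtyOneCode : PlanarCode where
  n := 8
  edges := [29, 8, 5, 4, 3, 2, 11, 12, 1, 16, 13, 6, 7, 10, 19, 24, 9, 20, 23, 14, 17, 28, 25, 18, 15,
    22, 31, 30, 21, 0, 27, 26]
  arcs := [0, 1, 2, 3, 3, 2, 4, 5, 1, 6, 7, 4, 5, 7, 8, 9, 6, 10, 11, 8, 10, 12, 13, 11, 9, 13, 14,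
    15, 12, 0, 15, 14]
  regions := [0, 1, 2, 3, 2, 1, 4, 3, 0, 5, 4, 1, 4, 5, 6, 3, 0, 7, 6, 5, 0, 8, 6, 7, 6, 8, 9, 3, 0, 3,
    9, 8]

theorem thirtyOneCode_valid : thirtyOneCode.Valid := by decide +kernel

/-- A basis of the colorings modulo 31. -/
def thirtyOneBasis : thirtyOneCode.Basis where
  anchors := (0, 1, 2, 2)
  script := [3, 6, 9, 14, 17, 21, 26]
  black := [1, 0, 1, 0, 1, 0, 1, 0, 0, 1]
  white := [0, 1, 0, 1, 0, 1, 0, 1, 1, 0]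
  first := [0, 0, 1, 30, 2, 2, 5, 7, 12, 18]
  second := []

theorem thirtyOneBasis_valid : thirtyOneBasis.Valid 31 := by decide +kernel

/-- A nontrivial coloring with 8 colors. -/
def thirtyOneColors : List ℕ := [0, 0, 1, 30, 2, 2, 5, 7, 12, 18]

/-- The closure of a braid on four strands with 19 crossings.  The nontrivial colorings modulo 29, up
to trivial ones, form a space of dimension two. -/
def twentyNineCode : PlanarCode where
  n := 19
  edges := [73, 70, 13, 8, 23, 74, 11, 20, 3, 12, 19, 6, 9, 2, 28, 16, 15, 25, 21, 10, 7, 18, 24, 4,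
    22, 17, 31, 32, 14, 36, 33, 26, 27, 30, 39, 40, 29, 44, 41, 34, 35, 38, 47, 48, 37, 56, 49,
    42, 43, 46, 53, 52, 51, 50, 59, 63, 45, 69, 60, 54, 58, 64, 67, 55, 61, 68, 75, 62, 65, 57,
    1, 72, 71, 0, 5, 66]
  arcs := [0, 1, 2, 3, 4, 5, 6, 7, 3, 8, 9, 6, 8, 2, 10, 11, 11, 12, 13, 9, 7, 13, 14, 4, 14, 12, 15,
    16, 10, 17, 18, 15, 16, 18, 19, 20, 17, 21, 22, 19, 20, 22, 23, 24, 21, 25, 26, 23, 24, 26,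
    27, 28, 28, 27, 29, 30, 25, 31, 32, 29, 32, 33, 34, 30, 33, 35, 36, 34, 35, 31, 1, 37, 37,
    0, 5, 36]
  regions := [0, 1, 2, 3, 4, 3, 5, 6, 2, 7, 5, 3, 2, 1, 8, 7, 8, 9, 5, 7, 5, 9, 4, 6, 9, 8, 10, 4, 1, 11,
    10, 8, 10, 11, 12, 4, 1, 13, 12, 11, 12, 13, 14, 4, 1, 15, 14, 13, 14, 15, 16, 4, 16, 15,
    17, 4, 1, 18, 17, 15, 18, 19, 4, 17, 18, 20, 4, 19, 18, 1, 0, 20, 0, 3, 4, 20]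

theorem twentyNineCode_valid : twentyNineCode.Valid := by decide +kernel

/-- A basis of the colorings modulo 29. -/
def twentyNineBasis : twentyNineCode.Basis where
  anchors := (0, 1, 2, 4)
  script := [3, 75, 68, 67, 63, 59, 52, 48, 47, 40, 39, 32, 31, 15, 24, 10, 23]
  black := [1, 0, 1, 0, 1, 1, 0, 0, 1, 0, 0, 1, 0, 1, 0, 1, 0, 0, 1, 0, 0]
  white := [0, 1, 0, 1, 0, 0, 1, 1, 0, 1, 1, 0, 1, 0, 1, 0, 1, 1, 0, 1, 1]
  first := [0, 0, 1, 28, 0, 24, 4, 22, 8, 9, 17, 25, 13, 9, 22, 2, 24, 26, 28, 27, 28]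
  second := [0, 0, 0, 0, 1, 12, 18, 12, 17, 7, 23, 11, 4, 15, 18, 4, 21, 24, 28, 26, 28]

theorem twentyNineBasis_valid : twentyNineBasis.Valid 29 := by decide +kernel

/-- A nontrivial coloring with 7 colors. -/
def twentyNineColors : List ℕ := [17, 0, 18, 28, 28, 28, 28, 9, 9, 28, 9, 18, 28, 17, 17, 5, 23, 0, 5, 23, 17]

/-! ### Their minimum numbers of colors -/

theorem mincol_fiveTwo : (diagram fiveTwoCode_valid).knot.DehnColorable 7 ∧
    (diagram fiveTwoCode_valid).knot.mincol 7 = 5 := by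
  have : Fact (Nat.Prime 7) := ⟨by norm_num⟩
  have hv : FewColors fiveTwoCode 7 5 fiveTwoColors := by decide +kernel
  have hcol := hv.dehnColorable fiveTwoCode_valid
  exact ⟨hcol, (hv.mincol_le fiveTwoCode_valid).antisymm <| lt_mincol_of_linking fiveTwoCode_valid fiveTwoBasis_valid
    (by decide +kernel) (by decide +kernel) hcol fun _ _ => pairing_self_of_seven⟩

theorem mincol_eleven : (diagram elevenCode_valid).knot.DehnColorable 11 ∧
    (diagram elevenCode_valid).knot.mincol 11 = 6 := by
  have : Fact (Nat.Prime 11) := ⟨by norm_num⟩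
  have hv : FewColors elevenCode 11 6 elevenColors := by decide +kernel
  have hcol := hv.dehnColorable elevenCode_valid
  exact ⟨hcol, (hv.mincol_le elevenCode_valid).antisymm <| lt_mincol_of_linking elevenCode_valid elevenBasis_valid
    (by decide +kernel) (by decide +kernel) hcol fun _ _ => pairing_self_of_eleven⟩

theorem mincol_thirteen : (diagram thirteenCode_valid).knot.DehnColorable 13 ∧
    (diagram thirteenCode_valid).knot.mincol 13 = 6 := by
  have : Fact (Nat.Prime 13) := ⟨by norm_num⟩
  have hv : FewColors thirteenCode 13 6 thirteenColors := by decide +kernel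
  have hcol := hv.dehnColorable thirteenCode_valid
  exact ⟨hcol, (hv.mincol_le thirteenCode_valid).antisymm <| lt_mincol_of_linking thirteenCode_valid thirteenBasis_valid
    (by decide +kernel) (by decide +kernel) hcol fun _ _ => pairing_self_of_thirteen⟩

theorem mincol_nineteen : (diagram nineteenCode_valid).knot.DehnColorable 19 ∧
    (diagram nineteenCode_valid).knot.mincol 19 = 7 := by
  have : Fact (Nat.Prime 19) := ⟨by norm_num⟩
  have hv : FewColors nineteenCode 19 7 nineteenColors := by decide +kernel
  have hcol := hv.dehnColorable nineteenCode_valid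
  exact ⟨hcol, (hv.mincol_le nineteenCode_valid).antisymm <| lt_mincol_of_linking nineteenCode_valid nineteenBasis_valid
    (by decide +kernel) (by decide +kernel) hcol fun _ _ => pairing_self_of_nineteen⟩

theorem mincol_twentyThree : (diagram twentyThreeCode_valid).knot.DehnColorable 23 ∧
    7 ≤ (diagram twentyThreeCode_valid).knot.mincol 23 ∧
    (diagram twentyThreeCode_valid).knot.mincol 23 ≤ 8 := by
  have : Fact (Nat.Prime 23) := ⟨by norm_num⟩
  have hv : FewColors twentyThreeCode 23 8 twentyThreeColors := by decide +kernel
  have hcol := hv.dehnColorable twentyThreeCode_valid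
  exact ⟨hcol, lt_mincol_of_linking twentyThreeCode_valid twentyThreeBasis_valid
    (by decide +kernel) (by decide +kernel) hcol fun _ _ => pairing_self_of_twentyThree,
    hv.mincol_le twentyThreeCode_valid⟩

theorem mincol_thirtyOne : (diagram thirtyOneCode_valid).knot.DehnColorable 31 ∧
    7 ≤ (diagram thirtyOneCode_valid).knot.mincol 31 ∧
    (diagram thirtyOneCode_valid).knot.mincol 31 ≤ 8 := by
  have : Fact (Nat.Prime 31) := ⟨by norm_num⟩
  have hv : FewColors thirtyOneCode 31 8 thirtyOneColors := by decide +kernel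
  have hcol := hv.dehnColorable thirtyOneCode_valid
  exact ⟨hcol, lt_mincol_of_linking thirtyOneCode_valid thirtyOneBasis_valid
    (by decide +kernel) (by decide +kernel) hcol fun _ _ => pairing_self_of_thirtyOne,
    hv.mincol_le thirtyOneCode_valid⟩

theorem mincol_twentyNine : (diagram twentyNineCode_valid).knot.DehnColorable 29 ∧
    (diagram twentyNineCode_valid).knot.mincol 29 = 7 := by
  have : Fact (Nat.Prime 29) := ⟨by norm_num⟩
  have hv : FewColors twentyNineCode 29 7 twentyNineColors := by decide +kernel
  have hcol := hv.dehnColorable twentyNineCode_valid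
  exact ⟨hcol, (hv.mincol_le twentyNineCode_valid).antisymm <|
    lt_mincol_of_gram twentyNineCode_valid twentyNineBasis_valid (by decide +kernel) hcol
      fun _ _ _ => pairing_eq_zero_of_twentyNine⟩

theorem knot_fiveTwo : (diagram fiveTwoCode_valid).knot = Knot.fiveTwo := by
  have h1 : ∀ x : Fin 20, rotPerm 5 x = FiveTwo.rot x := by decide
  have h2 : ∀ x : Fin 20, fiveTwoCode.edgeFun x = (FiveTwo.edge x).val := by decide +kernel
  exact Quotient.sound (.rel _ _ (Or.inl ⟨Equiv.refl (Fin 20), h1, fun _ => rfl,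
    fun x => Fin.ext (h2 x)⟩))

end PlanarCode

end KnotDiagram

/-- Minimum numbers of Dehn colors, for odd primes `5 < p < 32` other than `17`. -/
theorem proposition5p3 (p : ℕ) (hp : p.Prime) (h5 : 5 < p) (h32 : p < 2 ^ 5) (h17 : p ≠ 17) :
    (∃ K : Knot, K.DehnColorable p ∧ ⌊Real.logb 2 p⌋₊ + 3 ≤ K.mincol p) ∧
    (p ∈ ({7, 11, 13, 19, 29} : Set ℕ) →
      ∃ K : Knot, K.DehnColorable p ∧ K.mincol p = ⌊Real.logb 2 p⌋₊ + 3) ∧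
    (p ∈ ({23, 31} : Set ℕ) →
      ∃ K : Knot, K.DehnColorable p ∧
        (K.mincol p = ⌊Real.logb 2 p⌋₊ + 3 ∨ K.mincol p = ⌊Real.logb 2 p⌋₊ + 4)) ∧
    (p = 7 → Knot.fiveTwo.DehnColorable p ∧ Knot.fiveTwo.mincol p = ⌊Real.logb 2 p⌋₊ + 3) := by
  have hlog : ⌊Real.logb 2 p⌋₊ = Nat.log 2 p := by
    exact_mod_cast Real.natFloor_logb_natCast 2 p
  rw [hlog]
  -- It suffices to give one knot, which is `5₂` for `p = 7`, together with bounds.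
  have main : ∀ K : Knot, K.DehnColorable p → Nat.log 2 p + 3 ≤ K.mincol p →
      K.mincol p ≤ Nat.log 2 p + 4 →
      (p ∈ ({7, 11, 13, 19, 29} : Set ℕ) → K.mincol p = Nat.log 2 p + 3) →
      (p = 7 → K = Knot.fiveTwo) →
      (∃ K : Knot, K.DehnColorable p ∧ Nat.log 2 p + 3 ≤ K.mincol p) ∧
      (p ∈ ({7, 11, 13, 19, 29} : Set ℕ) →
        ∃ K : Knot, K.DehnColorable p ∧ K.mincol p = Nat.log 2 p + 3) ∧
      (p ∈ ({23, 31} : Set ℕ) →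
        ∃ K : Knot, K.DehnColorable p ∧
          (K.mincol p = Nat.log 2 p + 3 ∨ K.mincol p = Nat.log 2 p + 4)) ∧
      (p = 7 → Knot.fiveTwo.DehnColorable p ∧ Knot.fiveTwo.mincol p = Nat.log 2 p + 3) := by
    intro K hK h3 h4 heq h7
    refine ⟨⟨K, hK, h3⟩, fun hp => ⟨K, hK, heq hp⟩, fun _ => ⟨K, hK, by omega⟩, fun hp => ?_⟩
    rw [← h7 hp]
    exact ⟨hK, heq (by simp [hp])⟩
  have log7 : Nat.log 2 7 = 2 := by norm_num
  have log11 : Nat.log 2 11 = 3 := by norm_num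
  have log13 : Nat.log 2 13 = 3 := by norm_num
  have log19 : Nat.log 2 19 = 4 := by norm_num
  have log23 : Nat.log 2 23 = 4 := by norm_num
  have log29 : Nat.log 2 29 = 4 := by norm_num
  have log31 : Nat.log 2 31 = 4 := by norm_num
  have hcases : p = 7 ∨ p = 11 ∨ p = 13 ∨ p = 19 ∨ p = 23 ∨ p = 29 ∨ p = 31 := by
    clear hlog main
    interval_cases p <;> first | omega | norm_num at hp
  rcases hcases with rfl | rfl | rfl | rfl | rfl | rfl | rfl
  · obtain ⟨hK, h⟩ := KnotDiagram.PlanarCode.mincol_fiveTwo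
    exact main _ hK (by omega) (by omega) (fun _ => by omega)
      fun _ => KnotDiagram.PlanarCode.knot_fiveTwo
  · obtain ⟨hK, h⟩ := KnotDiagram.PlanarCode.mincol_eleven
    exact main _ hK (by omega) (by omega) (fun _ => by omega) (by norm_num)
  · obtain ⟨hK, h⟩ := KnotDiagram.PlanarCode.mincol_thirteen
    exact main _ hK (by omega) (by omega) (fun _ => by omega) (by norm_num)
  · obtain ⟨hK, h⟩ := KnotDiagram.PlanarCode.mincol_nineteen
    exact main _ hK (by omega) (by omega) (fun _ => by omega) (by norm_num)
  · obtain ⟨hK, h, h'⟩ := KnotDiagram.PlanarCode.mincol_twentyThree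
    exact main _ hK (by omega) (by omega) (by norm_num) (by norm_num)
  · obtain ⟨hK, h⟩ := KnotDiagram.PlanarCode.mincol_twentyNine
    exact main _ hK (by omega) (by omega) (fun _ => by omega) (by norm_num)
  · obtain ⟨hK, h, h'⟩ := KnotDiagram.PlanarCode.mincol_thirtyOne
    exact main _ hK (by omega) (by omega) (by norm_num) (by norm_num)
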